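/- **Setting.** Let $n\ge 1$ and $D=n+5$. Consider on $\mathbb{R}^{D}$, with coordinates $(t,y,x^1,\dots,x^{n+3})$, the time-independent plane wave metric $$ds^2=-(1+A(x))\,dt^2+(1-A(x))\,dy^2-2A(x)\,dt\,dy+\sum_{q=1}^{n+3}(dx^q)^2,\qquad A(x)=\sum_q A_q (x^q)^2,$$ with diagonal profile satisfying the vacuum condition $\sum_q A_q=0$. A *stationary Type I geometry* consists of a smooth immersion $X:M\to\mathbb{R}^3$ of a smooth 2-manifold, a non-empty connected open set $W\subseteq M$ on which $X$ is a minimal surface of $\mathbb{R}^3$, and a smooth vector field $V=V^q(x)\partial_q$ in the transverse directions, such that $\xi=\partial_t+V$ is a Killing field of the plane wave, is tangent to the 3-dimensional worldvolume $(\tau,\sigma)\mapsto(t,y,x)=(\tau,0,(X(\sigma),0))$ over $W$, and satisfies $\mathbf{k}^2:=-g(\xi,\xi)>0$ there. Static geometries ($V=0$) are included. It *solves the blackfold equations* if $$K^i=n\,u^au^b{K_{ab}}^i\ \text{ (in all normal directions } i\text{, over } W),\qquad \mathbf{k}=0\ \text{ on } \partial W ,$$ where ${K_{ab}}^i$ is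 the extrinsic curvature of the worldvolume in space-time, $K^i=\gamma^{ab}{K_{ab}}^i$ its trace with respect to the induced metric $\gamma$, $u=\xi/\mathbf{k}$, and $\partial W$ is the frontier of $W$ in $M$. Call the geometry *non-trivial* if $V$ does not vanish identically on $X(W)$ or $(A_1,A_2,A_3)\neq(0,0,0)$. **Theorem.** 1. If a non-trivial stationary Type I geometry satisfies the first blackfold equation $K^i=n\,u^au^b{K_{ab}}^i$, then $X(W)$ lies in a plane or in a helicoid. More precisely, either $X(W)\subseteq\{x: N\cdot x=d\}$ where $N\neq0$ is an eigenvector of $\mathrm{diag}(A_1,A_2,A_3)$ with eigenvalue $m$ and $md=0$; or $X(W)$ lies in a helicoid and there is $k\in\{1,2,3\}$ such that $A_k=0$ and the other two of $A_1,A_2,A_3$ are equal, the axis of the helicoid being the $x_k$-axis unless $A_1=A_2=A_3=0$. 2. The plane $x_3=0$ is a solution: for every $\Omega\in\mathbb{R}$ with $\Omega=0$ or $A_1=A_2$, every connected component of $\{\mathbf{k}^2>0\}$ in this plane, with $V=\Omega(x_1\partial_2-x_2\partial_1)$, is a stationary Type I geometry and solves the blackfold equations, including the boundary condition. 3. The helicoid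 $(\rho\cos\theta,\rho\sin\theta,h\theta)$, $h\ne0$, is a solution if $A_1=A_2$ and $A_3=0$: for every $\Omega\in\mathbb{R}$, every connected component of $\{\mathbf{k}^2>0\}$ in it, with $V=\Omega(x_1\partial_2-x_2\partial_1+h\,\partial_3)$, is a stationary Type I geometry and solves the blackfold equations, including the boundary condition. 4. The catenoid ($l=0$) and Scherk's second surfaces ($0<|l|<1$) $$\begin{aligned}X^1&=l c\sinh\tfrac{\rho}{c}\sin\phi+\sqrt{1-l^2}\,c\cosh\tfrac{\rho}{c}\cos\phi,\\ X^2&=-l c\sinh\tfrac{\rho}{c}\cos\phi+\sqrt{1-l^2}\,c\cosh\tfrac{\rho}{c}\sin\phi,\\ X^3&=l c\,\phi+\sqrt{1-l^2}\,\rho ,\end{aligned}\qquad c>0,$$ fail: no non-trivial stationary Type I geometry on a piece of one of them satisfies the first blackfold equation. (They do carry stationary Type I geometries: with $V=\Omega(x_1\partial_2-x_2\partial_1+lc\,\partial_3)$, every connected component of $\{\mathbf{k}^2>0\}$ is one, provided $\Omega=0$, or $A_1=A_2$ and additionally $l=0$ or $A_3=0$.) -/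

import Mathlib

open scoped ContDiff Manifold

noncomputable section

namespace Blackfold

/-! ### Submanifold geometry in coordinates -/

section Geometry

variable {ι κ : Type} [Fintype ι] [DecidableEq ι] [Fintype κ] [DecidableEq κ]

/-- The partial derivative `∂_a f` at `s`. -/
def pd (f : (κ → ℝ) → ℝ) (a : κ) (s : κ → ℝ) : ℝ := fderiv ℝ f s (Pi.single a 1)

/-- The Christoffel symbols `Γ^ρ_{μν}` of a metric `g` on coordinate space. -/
def christoffel (g : (ι → ℝ) → Matrix ι ι ℝ) (x : ι → ℝ) (ρ μ ν : ι) : ℝ :=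
  (1 / 2) * ∑ σ, (g x)⁻¹ ρ σ *
    (pd (fun z => g z σ ν) μ x + pd (fun z => g z σ μ) ν x - pd (fun z => g z μ ν) σ x)

/-- `ξ` is a Killing vector field of `g`: the Lie derivative of `g` along `ξ` vanishes. -/
def IsKilling (g : (ι → ℝ) → Matrix ι ι ℝ) (ξ : (ι → ℝ) → ι → ℝ) : Prop :=
  ∀ x μ ν, ∑ σ, (ξ x σ * pd (fun z => g z μ ν) σ x
    + g x σ ν * pd (fun z => ξ z σ) μ x + g x μ σ * pd (fun z => ξ z σ) ν x) = 0

/-- The tangent vectors `u^μ_a = ∂_a Φ^μ` of a parametrised submanifold `Φ`. -/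
def tangent (Φ : (κ → ℝ) → ι → ℝ) (s : κ → ℝ) (μ : ι) (a : κ) : ℝ := pd (fun z => Φ z μ) a s

/-- The induced metric `γ_ab = g_{μν} ∂_a Φ^μ ∂_b Φ^ν`. -/
def inducedMetric (g : (ι → ℝ) → Matrix ι ι ℝ) (Φ : (κ → ℝ) → ι → ℝ) (s : κ → ℝ) :
    Matrix κ κ ℝ :=
  Matrix.of fun a b => ∑ μ, ∑ ν, g (Φ s) μ ν * tangent Φ s μ a * tangent Φ s ν b

/-- `N` is a covector normal to the submanifold: `N_μ u^μ_a = 0`. -/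
def IsConormal (Φ : (κ → ℝ) → ι → ℝ) (s : κ → ℝ) (N : ι → ℝ) : Prop :=
  ∀ a, ∑ μ, N μ * tangent Φ s μ a = 0

/-- The extrinsic curvature `K_ab` in the direction of a normal covector `N`:
`N_μ ∂_a ∂_b Φ^μ + N_ρ Γ^ρ_{μν} u^μ_a u^ν_b`. -/
def extrinsicCurvature (g : (ι → ℝ) → Matrix ι ι ℝ) (Φ : (κ → ℝ) → ι → ℝ) (s : κ → ℝ)
    (N : ι → ℝ) (a b : κ) : ℝ :=
  ∑ ρ, N ρ * (pd (fun z => tangent Φ z ρ b) a s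
    + ∑ μ, ∑ ν, christoffel g (Φ s) ρ μ ν * tangent Φ s μ a * tangent Φ s ν b)

/-- The mean extrinsic curvature `γ^{ab} K_ab` in the direction of a normal covector `N`. -/
def meanCurvature (g : (ι → ℝ) → Matrix ι ι ℝ) (Φ : (κ → ℝ) → ι → ℝ) (s : κ → ℝ)
    (N : ι → ℝ) : ℝ :=
  ∑ a, ∑ b, (inducedMetric g Φ s)⁻¹ a b * extrinsicCurvature g Φ s N a b

end Geometry

/-! ### Plane waves and Type I worldvolumes

Transverse coordinates are indexed by `Fin 3 ⊕ Fin n`, the first summand being the `ℝ³` that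
contains the surface. Space-time coordinates are indexed by `Fin 2 ⊕ (Fin 3 ⊕ Fin n)`, the first
summand being `(t, y)`, so that `D = n + 5`. -/

section PlaneWave

variable {n : ℕ}

/-- The space-time index set. -/
abbrev Idx (n : ℕ) : Type := Fin 2 ⊕ (Fin 3 ⊕ Fin n)

/-- The wave profile `A(x) = ∑_q A_q (x^q)²`. -/
def profile (A : Fin 3 ⊕ Fin n → ℝ) (x : Idx n → ℝ) : ℝ := ∑ q, A q * x (Sum.inr q) ^ 2

/-- The plane wave metric
`-(1 + A(x)) dt² + (1 - A(x)) dy² - 2 A(x) dt dy + ∑_q (dx^q)²`. -/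
def planeWave (A : Fin 3 ⊕ Fin n → ℝ) (x : Idx n → ℝ) : Matrix (Idx n) (Idx n) ℝ :=
  Matrix.fromBlocks
    !![-(1 + profile A x), -profile A x; -profile A x, 1 - profile A x] 0 0 1

/-- The point of transverse space `ℝ³ × ℝⁿ` given by a point of `ℝ³`. -/
def transverse (n : ℕ) (x : Fin 3 → ℝ) : Fin 3 ⊕ Fin n → ℝ := Sum.elim x 0

/-- The background vector field `∂_t + V^q(x) ∂_q`. -/
def stationaryField (V : (Fin 3 ⊕ Fin n → ℝ) → Fin 3 ⊕ Fin n → ℝ) (x : Idx n → ℝ) : Idx n → ℝ :=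
  Sum.elim ![1, 0] (V fun q => x (Sum.inr q))

/-- The Type I worldvolume over a parametrised surface `Y` of `ℝ³`:
`(t, y, x^q) = (τ, 0, Y(σ), 0)`, where `s = (τ, σ)`. -/
def typeI (n : ℕ) (Y : (Fin 2 → ℝ) → Fin 3 → ℝ) (s : Fin 3 → ℝ) : Idx n → ℝ :=
  Sum.elim ![s 0, 0] (transverse n (Y (Fin.tail s)))

/-- `𝐤² = -g(∂_t + V, ∂_t + V)` at the point of the worldvolume over the point `x` of `ℝ³`
(it does not depend on `t`). -/
def modulusSq (A : Fin 3 ⊕ Fin n → ℝ) (V : (Fin 3 ⊕ Fin n → ℝ) → Fin 3 ⊕ Fin n → ℝ)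
    (x : Fin 3 → ℝ) : ℝ :=
  let P : Idx n → ℝ := Sum.elim 0 (transverse n x)
  ∑ μ, ∑ ν, -(planeWave A P μ ν * stationaryField V P μ * stationaryField V P ν)

/-- `k^a` are the components of a worldvolume vector at `s` which is pushed forward to the
background vector `∂_t + V`. -/
def MapsToField (V : (Fin 3 ⊕ Fin n → ℝ) → Fin 3 ⊕ Fin n → ℝ) (Y : (Fin 2 → ℝ) → Fin 3 → ℝ)
    (s : Fin 3 → ℝ) (k : Fin 3 → ℝ) : Prop :=
  ∀ μ, ∑ a, tangent (typeI n Y) s μ a * k a = stationaryField V (typeI n Y s) μ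

variable {M : Type*} [TopologicalSpace M] [ChartedSpace (Fin 2 → ℝ) M]

/-- The spatial surface `X : M → ℝ³`, the worldvolume region `W ⊆ M` (whose boundary is its
frontier in `M`) and the field `∂_t + V` form a stationary Type I geometry in the plane wave with
profile `A`, minimal in `ℝ³`. Static geometries (`V = 0`) are included. -/
structure IsStationaryTypeI (A : Fin 3 ⊕ Fin n → ℝ)
    (V : (Fin 3 ⊕ Fin n → ℝ) → Fin 3 ⊕ Fin n → ℝ) (X : M → Fin 3 → ℝ) (W : Set M) : Prop where
  smooth : ContMDiff 𝓘(ℝ, Fin 2 → ℝ) 𝓘(ℝ, Fin 3 → ℝ) ∞ X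
  immersion : ∀ e ∈ atlas (Fin 2 → ℝ) M, ∀ p ∈ e.source,
    Function.Injective (fderiv ℝ (X ∘ e.symm) (e p))
  isOpen : IsOpen W
  isConnected : IsConnected W
  /-- the surface is minimal in Euclidean `ℝ³` -/
  minimal : ∀ e ∈ atlas (Fin 2 → ℝ) M, ∀ p ∈ e.source ∩ W, ∀ N : Fin 3 → ℝ,
    IsConormal (X ∘ e.symm) (e p) N → meanCurvature (fun _ => 1) (X ∘ e.symm) (e p) N = 0
  smooth_field : ContDiff ℝ ∞ V
  /-- `∂_t + V` is a Killing vector field of the background -/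
  killing : IsKilling (planeWave A) (stationaryField V)
  /-- `∂_t + V` is tangent to the worldvolume -/
  tangency : ∀ e ∈ atlas (Fin 2 → ℝ) M, ∀ p ∈ e.source ∩ W, ∀ τ : ℝ,
    ∃ k : Fin 3 → ℝ, MapsToField V (X ∘ e.symm) (Fin.cons τ (e p)) k
  /-- `∂_t + V` is timelike on the worldvolume -/
  timelike : ∀ p ∈ W, 0 < modulusSq A V (X p)

/-- The extrinsic blackfold equation `K^i = n u^a u^b K_ab^i` with `u^a = 𝐤^a / 𝐤`, in all normal
directions `i` of the worldvolume in space-time and at all points over `W`. -/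
def ExtrinsicEquation (A : Fin 3 ⊕ Fin n → ℝ)
    (V : (Fin 3 ⊕ Fin n → ℝ) → Fin 3 ⊕ Fin n → ℝ) (X : M → Fin 3 → ℝ) (W : Set M) : Prop :=
  ∀ e ∈ atlas (Fin 2 → ℝ) M, ∀ p ∈ e.source ∩ W, ∀ τ : ℝ,
    let Φ := typeI n (X ∘ e.symm)
    let s : Fin 3 → ℝ := Fin.cons τ (e p)
    ∃ k : Fin 3 → ℝ, MapsToField V (X ∘ e.symm) s k ∧
      let u : Fin 3 → ℝ := fun a => k a / √(modulusSq A V (X p))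
      ∀ N : Idx n → ℝ, IsConormal Φ s N →
        meanCurvature (planeWave A) Φ s N =
          n * ∑ a, ∑ b, u a * u b * extrinsicCurvature (planeWave A) Φ s N a b

/-- The blackfold equations: the extrinsic equation, and `𝐤 = 0` on the boundary. -/
def BlackfoldEquations (A : Fin 3 ⊕ Fin n → ℝ)
    (V : (Fin 3 ⊕ Fin n → ℝ) → Fin 3 ⊕ Fin n → ℝ) (X : M → Fin 3 → ℝ) (W : Set M) : Prop :=
  ExtrinsicEquation A V X W ∧ ∀ p ∈ frontier W, modulusSq A V (X p) = 0

/-- The geometry is not a static one in directions along which the wave is flat: it rotates or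
translates (`V ≠ 0` somewhere on `W`), or `A_1, A_2, A_3` do not all vanish. -/
def IsNontrivial (A : Fin 3 ⊕ Fin n → ℝ)
    (V : (Fin 3 ⊕ Fin n → ℝ) → Fin 3 ⊕ Fin n → ℝ) (X : M → Fin 3 → ℝ) (W : Set M) : Prop :=
  (∃ p ∈ W, V (transverse n (X p)) ≠ 0) ∨ ∃ i : Fin 3, A (Sum.inl i) ≠ 0

/-- `Ω (x_1 ∂_2 - x_2 ∂_1 + h ∂_3)`. -/
def screwField (n : ℕ) (Ω h : ℝ) (x : Fin 3 ⊕ Fin n → ℝ) : Fin 3 ⊕ Fin n → ℝ :=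
  transverse n ![-Ω * x (Sum.inl 1), Ω * x (Sum.inl 0), Ω * h]

/-- The part `{𝐤² > 0}` of the surface `X`, or rather its connected component containing `p`. -/
def timelikeComponent (A : Fin 3 ⊕ Fin n → ℝ)
    (V : (Fin 3 ⊕ Fin n → ℝ) → Fin 3 ⊕ Fin n → ℝ) (X : M → Fin 3 → ℝ) (p : M) : Set M :=
  connectedComponentIn {q | 0 < modulusSq A V (X q)} p

end PlaneWave

/-! ### The surfaces -/

/-- The plane `x_3 = 0`. -/
def plane (σ : Fin 2 → ℝ) : Fin 3 → ℝ := ![σ 0, σ 1, 0]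

/-- The helicoid `(ρ cos θ, ρ sin θ, h θ)`. -/
def helicoid (h : ℝ) (σ : Fin 2 → ℝ) : Fin 3 → ℝ :=
  ![σ 0 * Real.cos (σ 1), σ 0 * Real.sin (σ 1), h * σ 1]

/-- Scherk's second surface with parameters `c` and `l`; the catenoid is the case `l = 0`. -/
def scherk (c l : ℝ) (σ : Fin 2 → ℝ) : Fin 3 → ℝ :=
  ![l * (c * Real.sinh (σ 0 / c)) * Real.sin (σ 1)
      + √(1 - l ^ 2) * (c * Real.cosh (σ 0 / c)) * Real.cos (σ 1),
    -l * (c * Real.sinh (σ 0 / c)) * Real.cos (σ 1)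
      + √(1 - l ^ 2) * (c * Real.cosh (σ 0 / c)) * Real.sin (σ 1),
    l * c * σ 1 + √(1 - l ^ 2) * σ 0]

/-- `S` lies in a plane `N · x = d` whose normal is an eigenvector `A N = m N` of
`A = diag(A_1, A_2, A_3)`, where `d = 0` or `m = 0`. -/
def LiesInPlane (A : Fin 3 → ℝ) (S : Set (Fin 3 → ℝ)) : Prop :=
  ∃ (N : Fin 3 → ℝ) (d m : ℝ), N ≠ 0 ∧ (∀ x ∈ S, N ⬝ᵥ x = d) ∧
    (∀ i, A i * N i = m * N i) ∧ m * d = 0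

/-- `S` lies in a helicoid (an image of a standard one under a rigid motion `x ↦ b + R x`), and
there is a coordinate direction `k` with `A_k = 0` and the other two `A_i` equal; the axis of the
helicoid is the `x_k`-axis unless `A_1 = A_2 = A_3 = 0`. -/
def LiesInHelicoid (A : Fin 3 → ℝ) (S : Set (Fin 3 → ℝ)) : Prop :=
  ∃ R ∈ Matrix.orthogonalGroup (Fin 3) ℝ, ∃ (b : Fin 3 → ℝ) (h : ℝ), h ≠ 0 ∧
    S ⊆ Set.range (fun σ => b + R.mulVec (helicoid h σ)) ∧
    ∃ k, A k = 0 ∧ (∀ i j, i ≠ k → j ≠ k → A i = A j) ∧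
      ((∃ i, A i ≠ 0) →
        Set.range (fun r : ℝ => b + r • R.mulVec (Pi.single 2 1)) =
          Set.range (fun r : ℝ => r • (Pi.single k 1 : Fin 3 → ℝ)))

end Blackfold

end

noncomputable section

namespace Blackfold

/-! ### Partial derivatives -/

/-! Over a Type I worldvolume the induced metric splits into −(1 + A(X)) dτ² and the Euclidean
metric of the surface. Killing's equation makes V, restricted to ℝ³, an infinitesimal rigid motion v
= a + b × x, where a is killed by A = diag(A₁, A₂, A₃) and the rotations about b preserve A. For a
minimal surface the extrinsic equation then yields a pointwise condition on each Euclidean normal N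
(`extrinsicEquation_vector`): N·v = 0 and N·(b × v) + (1 + 𝐤²/(n(1 + A(X)))) N·(A X) = 0.

Let b = 0. The factor is positive, so the linear field A X is tangent. If a ≠ 0, a constant vector
is tangent, so the shape operator has a kernel; being trace-free it vanishes, and the surface is
flat. If a = 0, there are three cases. When some non-zero A_i differs from the other two, the
Codazzi equation gives N·(Aᵖ X) = 0 for p = 1, 2, 3 off the flat points; a Vandermonde argument
leaves N_i X_i = 0, and the surface is flat (`flat_of_force`). When all A_i are equal, the surface
is a minimal cone, hence flat (`flat_of_cone`). When A = (λ, λ, 0) up to order, the horizontal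
radial field is tangent, and either all normals are vertical or the horizontal rulings turn at a
constant rate ε along the axis (`twist_const`, `Sheet.ruled`): a helicoid for ε ≠ 0, a plane
otherwise.

Let b ≠ 0. In a frame adapted to the screw axis, v is a rotation of rate β plus a translation α
along the axis, and A = diag(λ, λ, μ). If μ = 0, the equation is a scalar times the radial component
of N. The scalar can vanish on an open piece only if that piece lies in a cylinder about the axis or
has 𝐤 = 0, both impossible (`radial_of_screw`). So the radial field is tangent again, with ε = β/α,
or with a horizontal plane when α = 0. If μ ≠ 0, then α = 0 and the surface is invariant under
rotation. A piece off the plane x_3 = 0 would be a catenoid, on which the equation is entire in the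
catenary parameter and fails at the zeros of cosh (`catenary_false`).

These local statements are spread over the connected surface by patches (`Sheet`). On the plane and
the helicoid each term of the equation vanishes separately. Scherk's surfaces are analytic, so a
piece of one in a plane or helicoid would force the whole surface to satisfy the same analytic
equation, which a few points on the curve ρ = 0, and one off it for the plane, exclude. -/

theorem pd_const {κ : Type} [Fintype κ] [DecidableEq κ] (c : ℝ) (a : κ) (s : κ → ℝ) :
    pd (fun _ => c) a s = 0 := by
  simp [pd]

theorem pd_apply {κ : Type} [Fintype κ] [DecidableEq κ] (i a : κ) (s : κ → ℝ) :
    pd (fun z => z i) a s = if i = a then 1 else 0 := by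
  have h : HasFDerivAt (fun z : κ → ℝ => z i) (ContinuousLinearMap.proj (R := ℝ) i) s :=
    hasFDerivAt_apply i s
  rw [pd, h.fderiv]
  simp [Pi.single_apply]

/-! ### The plane wave metric, its inverse and its Christoffel symbols. -/

section Profile

variable {n : ℕ} (A : Fin 3 ⊕ Fin n → ℝ)

theorem hasFDerivAt_profile (x : Idx n → ℝ) :
    HasFDerivAt (profile A)
      (∑ q, (2 * A q * x (Sum.inr q)) • ContinuousLinearMap.proj (R := ℝ) (φ := fun _ : Idx n => ℝ)
        (Sum.inr q)) x := by
  unfold profile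
  refine HasFDerivAt.fun_sum fun q _ => ?_
  have h : HasFDerivAt (fun z : Idx n → ℝ => z (Sum.inr q))
    (ContinuousLinearMap.proj (R := ℝ) (φ := fun _ : Idx n => ℝ) (Sum.inr q)) x :=
    hasFDerivAt_apply _ x
  refine ((h.pow 2).const_mul (A q)).congr_fderiv ?_
  ext v
  simp
  ring

theorem pd_profile_inl (x : Idx n → ℝ) (i : Fin 2) : pd (profile A) (Sum.inl i) x = 0 := by
  simp [pd, (hasFDerivAt_profile A x).fderiv]

theorem pd_profile_inr (x : Idx n → ℝ) (q : Fin 3 ⊕ Fin n) :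
    pd (profile A) (Sum.inr q) x = 2 * A q * x (Sum.inr q) := by
  simp [pd, (hasFDerivAt_profile A x).fderiv, Pi.single_apply, -Fintype.sum_sum_type]

theorem pd_const_sub_profile (c : ℝ) (μ : Idx n) (x : Idx n → ℝ) :
    pd (fun z => c - profile A z) μ x = -pd (profile A) μ x := by
  simp only [pd]
  rw [fderiv_const_sub]
  simp

theorem planeWave_inl_inl (x : Idx n → ℝ) (i j : Fin 2) :
    planeWave A x (Sum.inl i) (Sum.inl j) =
      (if i = j then (if i = 0 then -1 else 1) else 0) - profile A x := by
  fin_cases i <;> fin_cases j <;> simp [planeWave] ; ring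

theorem planeWave_inl_inr (x : Idx n → ℝ) (i : Fin 2) (q : Fin 3 ⊕ Fin n) :
    planeWave A x (Sum.inl i) (Sum.inr q) = 0 := by simp [planeWave]

theorem planeWave_inr_inl (x : Idx n → ℝ) (i : Fin 2) (q : Fin 3 ⊕ Fin n) :
    planeWave A x (Sum.inr q) (Sum.inl i) = 0 := by simp [planeWave]

theorem planeWave_inr_inr (x : Idx n → ℝ) (p q : Fin 3 ⊕ Fin n) :
    planeWave A x (Sum.inr p) (Sum.inr q) = if p = q then 1 else 0 := by
  simp [planeWave, Matrix.one_apply]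

/-- The (t, y) block has determinant −1 whatever the value of the profile, so the metric is
nondegenerate everywhere and its inverse is polynomial in the profile. -/
theorem planeWave_inv (x : Idx n → ℝ) :
    (planeWave A x)⁻¹ = Matrix.fromBlocks
      !![-(1 - profile A x), -profile A x; -profile A x, 1 + profile A x]
      (0 : Matrix (Fin 2) (Fin 3 ⊕ Fin n) ℝ) (0 : Matrix (Fin 3 ⊕ Fin n) (Fin 2) ℝ)
      (1 : Matrix (Fin 3 ⊕ Fin n) (Fin 3 ⊕ Fin n) ℝ) := by
  apply Matrix.inv_eq_right_inv
  rw [planeWave, Matrix.fromBlocks_multiply]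
  simp only [Matrix.mul_zero, Matrix.zero_mul, add_zero, zero_add, mul_one]
  have h : !![-(1 + profile A x), -profile A x; -profile A x, 1 - profile A x] *
      !![-(1 - profile A x), -profile A x; -profile A x, 1 + profile A x] = 1 := by
    ext i j
    fin_cases i <;> fin_cases j <;> simp <;> ring
  rw [h, Matrix.fromBlocks_one]

theorem pd_planeWave_inl_inl (x : Idx n → ℝ) (i j : Fin 2) (μ : Idx n) :
    pd (fun z => planeWave A z (Sum.inl i) (Sum.inl j)) μ x = -pd (profile A) μ x := by
  simp_rw [planeWave_inl_inl]
  exact pd_const_sub_profile A _ μ x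

theorem pd_planeWave_inl_inr (x : Idx n → ℝ) (i : Fin 2) (q : Fin 3 ⊕ Fin n) (μ : Idx n) :
    pd (fun z => planeWave A z (Sum.inl i) (Sum.inr q)) μ x = 0 := by
  simp_rw [planeWave_inl_inr]
  exact pd_const _ μ x

theorem pd_planeWave_inr_inl (x : Idx n → ℝ) (i : Fin 2) (q : Fin 3 ⊕ Fin n) (μ : Idx n) :
    pd (fun z => planeWave A z (Sum.inr q) (Sum.inl i)) μ x = 0 := by
  simp_rw [planeWave_inr_inl]
  exact pd_const _ μ x

theorem pd_planeWave_inr_inr (x : Idx n → ℝ) (p q : Fin 3 ⊕ Fin n) (μ : Idx n) :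
    pd (fun z => planeWave A z (Sum.inr p) (Sum.inr q)) μ x = 0 := by
  simp_rw [planeWave_inr_inr]
  exact pd_const _ μ x

/-- All four entries of the (t, y) block are a constant minus the profile, so each of them
contributes the same gradient A_q x^q. -/
theorem christoffel_planeWave_inr (x : Idx n → ℝ) (q : Fin 3 ⊕ Fin n) (μ ν : Idx n) :
    christoffel (planeWave A) x (Sum.inr q) μ ν =
      if μ.isLeft ∧ ν.isLeft then A q * x (Sum.inr q) else 0 := by
  rw [christoffel, planeWave_inv, Fintype.sum_sum_type]
  rcases μ with i | p <;> rcases ν with j | r <;>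
  simp [pd_planeWave_inl_inl, pd_planeWave_inl_inr, pd_planeWave_inr_inl, pd_planeWave_inr_inr,
    Matrix.one_apply, pd_profile_inr, -Fintype.sum_sum_type]
  ring

/-- Among the symbols with upper index t or y only these are needed: conormals of a Type I
worldvolume have no t-component. -/
theorem christoffel_planeWave_y (x : Idx n → ℝ) (μ ν : Idx n) :
    christoffel (planeWave A) x (Sum.inl 1) μ ν =
      Sum.elim (fun _ => Sum.elim (fun _ => (0 : ℝ)) fun q => -(A q * x (Sum.inr q)))
        (fun q => Sum.elim (fun _ => -(A q * x (Sum.inr q))) fun _ => 0) μ ν := by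
  rw [christoffel, planeWave_inv, Fintype.sum_sum_type]
  rcases μ with i | p <;> rcases ν with j | r <;>
  simp [pd_planeWave_inl_inl, pd_planeWave_inl_inr, pd_planeWave_inr_inl, pd_planeWave_inr_inr,
    pd_profile_inr, pd_profile_inl, -Fintype.sum_sum_type]
  all_goals ring

theorem christoffel_const {ι : Type} [Fintype ι] [DecidableEq ι] (g : Matrix ι ι ℝ) (x : ι → ℝ)
    (ρ μ ν : ι) : christoffel (fun _ => g) x ρ μ ν = 0 := by
  simp [christoffel, pd_const]

end Profile

/-! ### The Type I worldvolume -/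

/-- The equivalence is what frees the two chain rules below from hypotheses: where F is not
differentiable, neither is the composite, and `fderiv` takes its default value 0 on both sides. -/
theorem differentiableAt_comp_tail {F : (Fin 2 → ℝ) → ℝ} {s : Fin 3 → ℝ} :
    DifferentiableAt ℝ (fun z : Fin 3 → ℝ => F (Fin.tail z)) s ↔
      DifferentiableAt ℝ F (Fin.tail s) := by
  have ht : Differentiable ℝ (fun z : Fin 3 → ℝ => (Fin.tail z : Fin 2 → ℝ)) := by
    unfold Fin.tail
    fun_prop
  constructor
  · intro h
    -- This map is a smooth section of `Fin.tail` through s; composing with it recovers F.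
    have hc : Differentiable ℝ (fun σ : Fin 2 → ℝ => (Fin.cons (s 0) σ : Fin 3 → ℝ)) := by
      rw [differentiable_pi]
      intro i
      refine Fin.cases ?_ (fun j => ?_) i
      · simp
      · simp only [Fin.cons_succ]
        fun_prop
    have h' : DifferentiableAt ℝ (fun z : Fin 3 → ℝ => F (Fin.tail z))
        (Fin.cons (s 0) (Fin.tail s)) := by rwa [Fin.cons_self_tail]
    have := h'.comp (Fin.tail s) (hc (Fin.tail s))
    simpa [Function.comp_def] using this
  · intro h
    exact DifferentiableAt.comp s h (ht s)

theorem pd_comp_tail_zero (F : (Fin 2 → ℝ) → ℝ) (s : Fin 3 → ℝ) :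
    pd (fun z : Fin 3 → ℝ => F (Fin.tail z)) 0 s = 0 := by
  by_cases h : DifferentiableAt ℝ F (Fin.tail s)
  · have ht : HasFDerivAt (fun z : Fin 3 → ℝ => (Fin.tail z : Fin 2 → ℝ))
        (ContinuousLinearMap.pi fun i : Fin 2 => ContinuousLinearMap.proj (R := ℝ)
          (φ := fun _ : Fin 3 => ℝ) i.succ) s := by
      rw [hasFDerivAt_pi]
      exact fun i => hasFDerivAt_apply i.succ s
    have hd := HasFDerivAt.comp s h.hasFDerivAt ht
    have e : (fun z : Fin 3 → ℝ => F (Fin.tail z)) = F ∘ fun z : Fin 3 → ℝ => Fin.tail z := rfl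
    rw [pd, e, hd.fderiv, ContinuousLinearMap.comp_apply]
    convert (fderiv ℝ F (Fin.tail s)).map_zero using 2
    ext i
    simp
  · rw [pd, fderiv_zero_of_not_differentiableAt (differentiableAt_comp_tail.not.mpr h)]
    rfl

theorem pd_comp_tail_succ (F : (Fin 2 → ℝ) → ℝ) (a : Fin 2) (s : Fin 3 → ℝ) :
    pd (fun z : Fin 3 → ℝ => F (Fin.tail z)) a.succ s = pd F a (Fin.tail s) := by
  by_cases h : DifferentiableAt ℝ F (Fin.tail s)
  · have ht : HasFDerivAt (fun z : Fin 3 → ℝ => (Fin.tail z : Fin 2 → ℝ))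
        (ContinuousLinearMap.pi fun i : Fin 2 => ContinuousLinearMap.proj (R := ℝ)
          (φ := fun _ : Fin 3 => ℝ) i.succ) s := by
      rw [hasFDerivAt_pi]
      exact fun i => hasFDerivAt_apply i.succ s
    have hd := HasFDerivAt.comp s h.hasFDerivAt ht
    have e : (fun z : Fin 3 → ℝ => F (Fin.tail z)) = F ∘ fun z : Fin 3 → ℝ => Fin.tail z := rfl
    rw [pd, e, hd.fderiv, ContinuousLinearMap.comp_apply, pd]
    congr 1
    ext i
    simp [Pi.single_apply]
  · rw [pd, pd, fderiv_zero_of_not_differentiableAt (differentiableAt_comp_tail.not.mpr h),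
      fderiv_zero_of_not_differentiableAt h]
    rfl

section TypeI

variable {n : ℕ} (A : Fin 3 ⊕ Fin n → ℝ) (Y : (Fin 2 → ℝ) → Fin 3 → ℝ) (s : Fin 3 → ℝ)

theorem tangent_typeI_t (a : Fin 3) :
    tangent (typeI n Y) s (Sum.inl 0) a = if a = 0 then 1 else 0 := by
  simp only [tangent, typeI, Sum.elim_inl, Matrix.cons_val_zero]
  rw [pd_apply]
  simp [eq_comm]

theorem tangent_typeI_y (a : Fin 3) : tangent (typeI n Y) s (Sum.inl 1) a = 0 := by
  simp only [tangent, typeI, Sum.elim_inl, Matrix.cons_val_one]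
  exact pd_const 0 a s

theorem tangent_typeI_flat (j : Fin n) (a : Fin 3) :
    tangent (typeI n Y) s (Sum.inr (Sum.inr j)) a = 0 := by
  simp only [tangent, typeI, transverse, Sum.elim_inr]
  exact pd_const 0 a s

theorem tangent_typeI_zero (i : Fin 3) :
    tangent (typeI n Y) s (Sum.inr (Sum.inl i)) 0 = 0 := by
  simp only [tangent, typeI, transverse, Sum.elim_inr, Sum.elim_inl]
  exact pd_comp_tail_zero (fun z => Y z i) s

theorem tangent_typeI_succ (i : Fin 3) (a : Fin 2) :
    tangent (typeI n Y) s (Sum.inr (Sum.inl i)) a.succ = tangent Y (Fin.tail s) i a := by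
  simp only [tangent, typeI, transverse, Sum.elim_inr, Sum.elim_inl]
  exact pd_comp_tail_succ (fun z => Y z i) a s

/-- The restriction to `ℝ³` of a space-time covector. -/
def spatial (N : Idx n → ℝ) : Fin 3 → ℝ := fun i => N (Sum.inr (Sum.inl i))

/-- The tangent ∂_τ is ∂_t, which kills the t-component. The worldvolume does not extend in y or in
the flat directions, so those components stay free. -/
theorem isConormal_typeI_iff (N : Idx n → ℝ) :
    IsConormal (typeI n Y) s N ↔
      N (Sum.inl 0) = 0 ∧ IsConormal Y (Fin.tail s) (spatial N) := by
  unfold IsConormal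
  rw [Fin.forall_fin_succ]
  simp only [Fintype.sum_sum_type, Fin.sum_univ_two, tangent_typeI_t, tangent_typeI_y,
    tangent_typeI_flat, tangent_typeI_zero, tangent_typeI_succ, spatial]
  simp

theorem profile_typeI : profile A (typeI n Y s) = ∑ i, A (Sum.inl i) * Y (Fin.tail s) i ^ 2 := by
  simp [profile, typeI, transverse]

theorem inducedMetric_typeI_zero_zero :
    inducedMetric (planeWave A) (typeI n Y) s 0 0 =
      -(1 + ∑ i, A (Sum.inl i) * Y (Fin.tail s) i ^ 2) := by
  simp only [inducedMetric, Matrix.of_apply, Fintype.sum_sum_type, Fin.sum_univ_two,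
    tangent_typeI_t, tangent_typeI_y, tangent_typeI_flat, tangent_typeI_zero,
    planeWave_inl_inl, profile_typeI]
  simp
  ring

theorem inducedMetric_typeI_zero_succ (a : Fin 2) :
    inducedMetric (planeWave A) (typeI n Y) s 0 a.succ = 0 := by
  simp only [inducedMetric, Matrix.of_apply, Fintype.sum_sum_type, Fin.sum_univ_two,
    tangent_typeI_t, tangent_typeI_y, tangent_typeI_flat, tangent_typeI_zero,
    planeWave_inl_inr, Fin.succ_ne_zero]
  simp

theorem inducedMetric_typeI_succ_zero (a : Fin 2) :
    inducedMetric (planeWave A) (typeI n Y) s a.succ 0 = 0 := by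
  simp only [inducedMetric, Matrix.of_apply, Fintype.sum_sum_type, Fin.sum_univ_two,
    tangent_typeI_t, tangent_typeI_y, tangent_typeI_flat, tangent_typeI_zero,
    planeWave_inr_inl, Fin.succ_ne_zero]
  simp

theorem inducedMetric_typeI_succ_succ (a b : Fin 2) :
    inducedMetric (planeWave A) (typeI n Y) s a.succ b.succ =
      inducedMetric (fun _ => 1) Y (Fin.tail s) a b := by
  simp only [inducedMetric, Matrix.of_apply, Fintype.sum_sum_type, Fin.sum_univ_two,
    tangent_typeI_t, tangent_typeI_y, tangent_typeI_flat, tangent_typeI_succ,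
    planeWave_inr_inr, Fin.succ_ne_zero]
  simp [Matrix.one_apply]

/-- The inverse of the induced metric of a Type I worldvolume. -/
theorem inducedMetric_typeI_inv (hA : 1 + ∑ i, A (Sum.inl i) * Y (Fin.tail s) i ^ 2 ≠ 0)
    (hY : IsUnit (inducedMetric (fun _ => 1) Y (Fin.tail s)).det) :
    (inducedMetric (planeWave A) (typeI n Y) s)⁻¹ = Matrix.of fun a b =>
      Fin.cases (Fin.cases (-(1 + ∑ i, A (Sum.inl i) * Y (Fin.tail s) i ^ 2)⁻¹) (fun _ => 0) b)
        (fun a' => Fin.cases 0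
          (fun b' => (inducedMetric (fun _ => 1) Y (Fin.tail s))⁻¹ a' b') b) a := by
  apply Matrix.inv_eq_right_inv
  have h1 := Matrix.mul_nonsing_inv _ hY
  ext a b
  rw [Matrix.mul_apply, Fin.sum_univ_succ]
  refine Fin.cases ?_ (fun a' => ?_) a <;> refine Fin.cases ?_ (fun b' => ?_) b
  · simp only [inducedMetric_typeI_zero_zero, inducedMetric_typeI_zero_succ, Matrix.of_apply,
      Fin.cases_zero, Fin.cases_succ]
    field_simp
    simp
  · simp only [inducedMetric_typeI_zero_zero, inducedMetric_typeI_zero_succ, Matrix.of_apply,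
      Fin.cases_zero, Fin.cases_succ]
    simp [(Fin.succ_ne_zero _).symm]
  · simp only [inducedMetric_typeI_succ_zero, inducedMetric_typeI_succ_succ, Matrix.of_apply,
      Fin.cases_zero, Fin.cases_succ]
    simp
  · simp only [inducedMetric_typeI_succ_zero, inducedMetric_typeI_succ_succ, Matrix.of_apply,
      Fin.cases_zero, Fin.cases_succ]
    have := congrFun (congrFun h1 a') b'
    rw [Matrix.mul_apply] at this
    rw [zero_mul, zero_add, this]
    simp [Matrix.one_apply]

variable (N : Idx n → ℝ)

/-- `∑_i A_i N_i Y_i`. -/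
def forceDot (A : Fin 3 ⊕ Fin n → ℝ) (N x : Fin 3 → ℝ) : ℝ := ∑ i, N i * (A (Sum.inl i) * x i)

theorem extrinsicCurvature_euclid (N : Fin 3 → ℝ) (σ : Fin 2 → ℝ) (a b : Fin 2) :
    extrinsicCurvature (fun _ => 1) Y σ N a b =
      ∑ i, N i * pd (fun z => tangent Y z i b) a σ := by
  simp [extrinsicCurvature, christoffel_const]

theorem pd_tangent_typeI_zero_left (μ : Idx n) (b : Fin 3) :
    pd (fun z => tangent (typeI n Y) z μ b) 0 s = 0 := by
  rcases μ with i | i | j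
  · fin_cases i
    · simp [tangent_typeI_t, pd_const]
    · simp [tangent_typeI_y, pd_const]
  · refine Fin.cases ?_ (fun b' => ?_) b
    · simp [tangent_typeI_zero, pd_const]
    · simp only [tangent_typeI_succ]
      exact pd_comp_tail_zero (fun z => tangent Y z i b') s
  · simp [tangent_typeI_flat, pd_const]

theorem pd_tangent_typeI_zero_right (μ : Idx n) (a : Fin 3) :
    pd (fun z => tangent (typeI n Y) z μ 0) a s = 0 := by
  rcases μ with i | i | j
  · fin_cases i
    · simp [tangent_typeI_t, pd_const]
    · simp [tangent_typeI_y, pd_const]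
  · simp [tangent_typeI_zero, pd_const]
  · simp [tangent_typeI_flat, pd_const]

theorem extrinsicCurvature_typeI_zero_zero (h0 : N (Sum.inl 0) = 0) :
    extrinsicCurvature (planeWave A) (typeI n Y) s N 0 0 =
      forceDot A (spatial N) (Y (Fin.tail s)) := by
  simp only [extrinsicCurvature, pd_tangent_typeI_zero_left, Fintype.sum_sum_type,
    Fin.sum_univ_two, h0, christoffel_planeWave_inr, christoffel_planeWave_y, tangent_typeI_t,
    tangent_typeI_y, tangent_typeI_zero, tangent_typeI_flat]
  simp [typeI, transverse, forceDot, spatial]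

/-- The mixed components see only the dy part of the conormal. Contracted with the velocity they
give half the derivative of the profile along V, which the Killing equation annihilates. -/
theorem extrinsicCurvature_typeI_zero_succ (h0 : N (Sum.inl 0) = 0) (b : Fin 2) :
    extrinsicCurvature (planeWave A) (typeI n Y) s N 0 b.succ =
      -N (Sum.inl 1) * forceDot A (fun i => tangent Y (Fin.tail s) i b) (Y (Fin.tail s)) := by
  simp only [extrinsicCurvature, pd_tangent_typeI_zero_left, Fintype.sum_sum_type,
    Fin.sum_univ_two, h0, christoffel_planeWave_inr, christoffel_planeWave_y, tangent_typeI_t,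
    tangent_typeI_y, tangent_typeI_zero, tangent_typeI_flat, tangent_typeI_succ]
  simp [typeI, transverse, forceDot, Fin.sum_univ_three]
  ring

theorem extrinsicCurvature_typeI_succ_zero (h0 : N (Sum.inl 0) = 0) (b : Fin 2) :
    extrinsicCurvature (planeWave A) (typeI n Y) s N b.succ 0 =
      -N (Sum.inl 1) * forceDot A (fun i => tangent Y (Fin.tail s) i b) (Y (Fin.tail s)) := by
  simp only [extrinsicCurvature, pd_tangent_typeI_zero_right, Fintype.sum_sum_type,
    Fin.sum_univ_two, h0, christoffel_planeWave_inr, christoffel_planeWave_y, tangent_typeI_t,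
    tangent_typeI_y, tangent_typeI_zero, tangent_typeI_flat, tangent_typeI_succ]
  simp [typeI, transverse, forceDot, Fin.sum_univ_three]
  ring

theorem extrinsicCurvature_typeI_succ_succ (h0 : N (Sum.inl 0) = 0) (a b : Fin 2) :
    extrinsicCurvature (planeWave A) (typeI n Y) s N a.succ b.succ =
      extrinsicCurvature (fun _ => 1) Y (Fin.tail s) (spatial N) a b := by
  have hp : ∀ i, pd (fun z => tangent Y (Fin.tail z) i b) a.succ s =
      pd (fun z => tangent Y z i b) a (Fin.tail s) := fun i =>
    pd_comp_tail_succ (fun z => tangent Y z i b) a s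
  have hp0 : pd (fun _ : Fin 3 → ℝ => (0 : ℝ)) a.succ s = 0 := pd_const _ _ _
  rw [extrinsicCurvature_euclid]
  simp only [extrinsicCurvature, Fintype.sum_sum_type,
    Fin.sum_univ_two, h0, christoffel_planeWave_inr, christoffel_planeWave_y, tangent_typeI_t,
    tangent_typeI_y, tangent_typeI_flat, tangent_typeI_succ, hp, hp0]
  simp [spatial]

/-- The mean curvature of a Type I worldvolume. -/
theorem meanCurvature_typeI (hA : 1 + ∑ i, A (Sum.inl i) * Y (Fin.tail s) i ^ 2 ≠ 0)
    (hY : IsUnit (inducedMetric (fun _ => 1) Y (Fin.tail s)).det) (h0 : N (Sum.inl 0) = 0) :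
    meanCurvature (planeWave A) (typeI n Y) s N =
      -(1 + ∑ i, A (Sum.inl i) * Y (Fin.tail s) i ^ 2)⁻¹ *
        forceDot A (spatial N) (Y (Fin.tail s)) +
      meanCurvature (fun _ => 1) Y (Fin.tail s) (spatial N) := by
  rw [meanCurvature, inducedMetric_typeI_inv A Y s hA hY, Fin.sum_univ_succ, Fin.sum_univ_succ]
  simp only [Fin.sum_univ_succ (n := 2), Matrix.of_apply, Fin.cases_zero, Fin.cases_succ,
    extrinsicCurvature_typeI_zero_zero A Y s N h0, extrinsicCurvature_typeI_succ_succ A Y s N h0,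
    zero_mul, Finset.sum_const_zero, add_zero, zero_add]
  rfl

/-- The right-hand side of the extrinsic equation on a Type I worldvolume. -/
theorem sum_extrinsicCurvature_typeI (h0 : N (Sum.inl 0) = 0) (u : Fin 3 → ℝ) :
    ∑ a, ∑ b, u a * u b * extrinsicCurvature (planeWave A) (typeI n Y) s N a b =
      u 0 ^ 2 * forceDot A (spatial N) (Y (Fin.tail s))
      - 2 * u 0 * N (Sum.inl 1) *
        ∑ b : Fin 2, u b.succ * forceDot A (fun i => tangent Y (Fin.tail s) i b) (Y (Fin.tail s))
      + ∑ a : Fin 2, ∑ b : Fin 2, u a.succ * u b.succ *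
          extrinsicCurvature (fun _ => 1) Y (Fin.tail s) (spatial N) a b := by
  rw [Fin.sum_univ_succ, Fin.sum_univ_succ]
  simp only [Fin.sum_univ_succ (n := 2),
    extrinsicCurvature_typeI_zero_zero A Y s N h0, extrinsicCurvature_typeI_succ_succ A Y s N h0,
    extrinsicCurvature_typeI_zero_succ A Y s N h0, extrinsicCurvature_typeI_succ_zero A Y s N h0]
  simp only [Fin.sum_univ_two]
  ring

/-- `∂_t + V` is tangent to a Type I worldvolume if and only if the restriction of `V` to `ℝ³` is
tangent to the surface and `V` has no components in the directions along which it is flat. -/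
theorem mapsToField_iff (V : (Fin 3 ⊕ Fin n → ℝ) → Fin 3 ⊕ Fin n → ℝ) (k : Fin 3 → ℝ) :
    MapsToField V Y s k ↔ k 0 = 1 ∧
      (∀ i, ∑ b, tangent Y (Fin.tail s) i b * k b.succ =
        V (transverse n (Y (Fin.tail s))) (Sum.inl i)) ∧
      ∀ j, V (transverse n (Y (Fin.tail s))) (Sum.inr j) = 0 := by
  have hV : (fun q => typeI n Y s (Sum.inr q)) = transverse n (Y (Fin.tail s)) := by
    ext q; simp [typeI]
  unfold MapsToField
  rw [Sum.forall, Sum.forall, Fin.forall_fin_two]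
  simp only [stationaryField, hV, tangent_typeI_t, tangent_typeI_y,
    tangent_typeI_flat, Fin.sum_univ_succ (n := 2), tangent_typeI_zero, tangent_typeI_succ]
  simp [eq_comm]

theorem modulusSq_eq (V : (Fin 3 ⊕ Fin n → ℝ) → Fin 3 ⊕ Fin n → ℝ) (x : Fin 3 → ℝ) :
    modulusSq A V x = 1 + ∑ i, A (Sum.inl i) * x i ^ 2 -
      ((∑ i, V (transverse n x) (Sum.inl i) ^ 2) + ∑ j, V (transverse n x) (Sum.inr j) ^ 2) := by
  have hV : (fun q => (Sum.elim 0 (transverse n x) : Idx n → ℝ) (Sum.inr q)) = transverse n x := by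
    ext q; simp
  have hP : profile A (Sum.elim 0 (transverse n x)) = ∑ i, A (Sum.inl i) * x i ^ 2 := by
    simp [profile, transverse]
  simp only [modulusSq, Fintype.sum_sum_type (α₁ := Fin 2), Fin.sum_univ_two, planeWave_inl_inl,
    planeWave_inl_inr, planeWave_inr_inl, planeWave_inr_inr, stationaryField, hV, hP]
  simp
  ring_nf

end TypeI

end Blackfold

namespace Blackfold

open Matrix

/-! ### Vector algebra in `ℝ³` -/

theorem dot3 (a b : Fin 3 → ℝ) : a ⬝ᵥ b = a 0 * b 0 + a 1 * b 1 + a 2 * b 2 := by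
  simp [dotProduct, Fin.sum_univ_three]

theorem cross3_zero (a b : Fin 3 → ℝ) : (a ⨯₃ b) 0 = a 1 * b 2 - a 2 * b 1 := by
  simp [cross_apply]

theorem cross3_one (a b : Fin 3 → ℝ) : (a ⨯₃ b) 1 = a 2 * b 0 - a 0 * b 2 := by
  simp [cross_apply]

theorem cross3_two (a b : Fin 3 → ℝ) : (a ⨯₃ b) 2 = a 0 * b 1 - a 1 * b 0 := by
  simp [cross_apply]

theorem dot3_self_pos {a : Fin 3 → ℝ} (ha : a ≠ 0) : 0 < a ⬝ᵥ a := by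
  rw [dot3]
  by_contra! h
  apply ha
  have h0 : a 0 = 0 := by nlinarith [sq_nonneg (a 0), sq_nonneg (a 1), sq_nonneg (a 2)]
  have h1 : a 1 = 0 := by nlinarith [sq_nonneg (a 0), sq_nonneg (a 1), sq_nonneg (a 2)]
  have h2 : a 2 = 0 := by nlinarith [sq_nonneg (a 0), sq_nonneg (a 1), sq_nonneg (a 2)]
  ext i
  fin_cases i <;> assumption

theorem eq_zero_of_cross {u N : Fin 3 → ℝ} (hN : N ⬝ᵥ N = 1) (h0 : N ⬝ᵥ u = 0)
    (hc : u ⨯₃ N = 0) : u = 0 := by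
  have c0 := congrFun hc 0
  have c1 := congrFun hc 1
  have c2 := congrFun hc 2
  rw [cross3_zero] at c0
  rw [cross3_one] at c1
  rw [cross3_two] at c2
  simp only [Pi.zero_apply] at c0 c1 c2
  rw [dot3] at hN h0
  ext i
  fin_cases i
  · change u 0 = 0
    linear_combination (-u 0) * hN + N 0 * h0 + N 1 * c2 - N 2 * c1
  · change u 1 = 0
    linear_combination (-u 1) * hN + N 1 * h0 + N 2 * c0 - N 0 * c2
  · change u 2 = 0
    linear_combination (-u 2) * hN + N 2 * h0 + N 0 * c1 - N 1 * c0

/-- A vector orthogonal to `N`, `w` and `N × w`, where `w ≠ 0` is orthogonal to the unit vector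
`N`, vanishes. -/
theorem eq_zero_of_dot {u N w : Fin 3 → ℝ} (hN : N ⬝ᵥ N = 1) (hw : w ≠ 0) (hNw : N ⬝ᵥ w = 0)
    (h0 : N ⬝ᵥ u = 0) (h1 : u ⬝ᵥ w = 0) (h2 : u ⬝ᵥ (N ⨯₃ w) = 0) : u = 0 := by
  apply eq_zero_of_cross hN h0
  have hp := dot3_self_pos hw
  rw [dot3] at hp h1 h2 hNw h0
  rw [cross3_zero, cross3_one, cross3_two] at h2
  ext i
  refine (mul_eq_zero.mp ?_).resolve_left hp.ne'
  fin_cases i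
  · change _ * (u ⨯₃ N) 0 = 0
    rw [cross3_zero]
    linear_combination (w 0) * h2 - (N 1 * w 2 - N 2 * w 1) * h1 +
      (w 2 * u 1 - w 1 * u 2) * hNw
  · change _ * (u ⨯₃ N) 1 = 0
    rw [cross3_one]
    linear_combination (w 1) * h2 - (N 2 * w 0 - N 0 * w 2) * h1 +
      (w 0 * u 2 - w 2 * u 0) * hNw
  · change _ * (u ⨯₃ N) 2 = 0
    rw [cross3_two]
    linear_combination (w 2) * h2 - (N 0 * w 1 - N 1 * w 0) * h1 +
      (w 1 * u 0 - w 0 * u 1) * hNw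

theorem two_le_infty : (2 : WithTop ℕ∞) ≤ ∞ := WithTop.coe_le_coe.mpr (le_top : (2 : ℕ∞) ≤ ⊤)

/-! ### Surfaces with a unit normal -/

/-- `Y` is a minimal immersion of the open set `U` of the plane in `ℝ³`, with unit normal `N`. -/
structure Surf (U : Set (Fin 2 → ℝ)) (Y N : (Fin 2 → ℝ) → Fin 3 → ℝ) : Prop where
  isOpen : IsOpen U
  smooth : ContDiffOn ℝ ∞ Y U
  smooth_normal : ContDiffOn ℝ ∞ N U
  unit : ∀ σ ∈ U, N σ ⬝ᵥ N σ = 1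
  normal : ∀ σ ∈ U, ∀ k, N σ ⬝ᵥ fderiv ℝ Y σ k = 0
  injective : ∀ σ ∈ U, Function.Injective (fderiv ℝ Y σ)
  -- Trace-freeness of the shape operator S without a choice of basis: with J = N × ·, this form is
  -- ⟨J S k, l⟩, and J S is symmetric exactly when tr S = 0.
  minimal : ∀ σ ∈ U, ∀ k l, N σ ⬝ᵥ (fderiv ℝ N σ k ⨯₃ fderiv ℝ Y σ l) =
    N σ ⬝ᵥ (fderiv ℝ N σ l ⨯₃ fderiv ℝ Y σ k)

/-- A function that vanishes on an open set has vanishing line derivatives there. -/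
theorem lineDeriv_eq_zero {U : Set (Fin 2 → ℝ)} (hU : IsOpen U) {F : (Fin 2 → ℝ) → ℝ}
    (hF : ∀ σ ∈ U, F σ = 0) {σ k : Fin 2 → ℝ} (hσ : σ ∈ U) {d : ℝ}
    (hd : HasLineDerivAt ℝ F d σ k) : d = 0 := by
  have hc : Continuous fun t : ℝ => σ + t • k := by fun_prop
  have h0 : HasLineDerivAt ℝ F 0 σ k := by
    have : HasDerivAt (fun _ : ℝ => (0 : ℝ)) 0 0 := hasDerivAt_const _ _
    refine this.congr_of_eventuallyEq ?_
    have : ∀ᶠ t in nhds (0 : ℝ), σ + t • k ∈ U :=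
      hc.continuousAt.eventually_mem (by simpa using hU.mem_nhds hσ)
    filter_upwards [this] with t ht using hF _ ht
  exact HasDerivAt.unique hd h0

/-- A differentiable function with vanishing line derivatives on a preconnected open set is
constant there. -/
theorem const_of_lineDeriv {U : Set (Fin 2 → ℝ)} (hU : IsOpen U) (hc : IsPreconnected U)
    {F : (Fin 2 → ℝ) → ℝ} (hF : DifferentiableOn ℝ F U)
    (hd : ∀ σ ∈ U, ∀ k, HasLineDerivAt ℝ F 0 σ k) {σ τ : Fin 2 → ℝ} (hσ : σ ∈ U) (hτ : τ ∈ U) :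
    F σ = F τ := by
  refine hU.is_const_of_fderiv_eq_zero hc hF (fun ρ hρ => ?_) hσ hτ
  ext k
  have h1 := ((hF ρ hρ).differentiableAt (hU.mem_nhds hρ)).hasFDerivAt.hasLineDerivAt k
  exact h1.unique (hd ρ hρ k)

namespace Surf

variable {U : Set (Fin 2 → ℝ)} {Y N : (Fin 2 → ℝ) → Fin 3 → ℝ} {σ : Fin 2 → ℝ}

theorem mono (h : Surf U Y N) {V : Set (Fin 2 → ℝ)} (hV : IsOpen V) (hVU : V ⊆ U) :
    Surf V Y N where
  isOpen := hV
  smooth := h.smooth.mono hVU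
  smooth_normal := h.smooth_normal.mono hVU
  unit σ hσ := h.unit σ (hVU hσ)
  normal σ hσ := h.normal σ (hVU hσ)
  injective σ hσ := h.injective σ (hVU hσ)
  minimal σ hσ := h.minimal σ (hVU hσ)

theorem contDiffAt (h : Surf U Y N) (hσ : σ ∈ U) : ContDiffAt ℝ ∞ Y σ :=
  h.smooth.contDiffAt (h.isOpen.mem_nhds hσ)

theorem contDiffAt_normal (h : Surf U Y N) (hσ : σ ∈ U) : ContDiffAt ℝ ∞ N σ :=
  h.smooth_normal.contDiffAt (h.isOpen.mem_nhds hσ)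

theorem differentiableAt (h : Surf U Y N) (hσ : σ ∈ U) : DifferentiableAt ℝ Y σ :=
  (h.contDiffAt hσ).differentiableAt (by simp)

theorem differentiableAt_normal (h : Surf U Y N) (hσ : σ ∈ U) : DifferentiableAt ℝ N σ :=
  (h.contDiffAt_normal hσ).differentiableAt (by simp)

theorem lineY (h : Surf U Y N) (hσ : σ ∈ U) (k : Fin 2 → ℝ) (i : Fin 3) :
    HasDerivAt (fun t : ℝ => Y (σ + t • k) i) (fderiv ℝ Y σ k i) 0 :=
  (hasDerivAt_pi.mp ((h.differentiableAt hσ).hasFDerivAt.hasLineDerivAt k)) i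

theorem lineN (h : Surf U Y N) (hσ : σ ∈ U) (k : Fin 2 → ℝ) (i : Fin 3) :
    HasDerivAt (fun t : ℝ => N (σ + t • k) i) (fderiv ℝ N σ k i) 0 :=
  (hasDerivAt_pi.mp ((h.differentiableAt_normal hσ).hasFDerivAt.hasLineDerivAt k)) i

/-- The line derivative of the partial derivative `∂_l Y`. -/
theorem lineDY (h : Surf U Y N) (hσ : σ ∈ U) (k l : Fin 2 → ℝ) (i : Fin 3) :
    HasDerivAt (fun t : ℝ => fderiv ℝ Y (σ + t • k) l i)
      (fderiv ℝ (fderiv ℝ Y) σ k l i) 0 := by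
  have h1 : DifferentiableAt ℝ (fderiv ℝ Y) σ :=
    ((h.contDiffAt hσ).fderiv_right (m := ∞) le_rfl).differentiableAt (by simp)
  have h2 := h1.hasFDerivAt.clm_apply (hasFDerivAt_const l σ)
  have h3 := hasDerivAt_pi.mp (h2.hasLineDerivAt k) i
  simpa using h3

theorem lineDN (h : Surf U Y N) (hσ : σ ∈ U) (k l : Fin 2 → ℝ) (i : Fin 3) :
    HasDerivAt (fun t : ℝ => fderiv ℝ N (σ + t • k) l i)
      (fderiv ℝ (fderiv ℝ N) σ k l i) 0 := by
  have h1 : DifferentiableAt ℝ (fderiv ℝ N) σ :=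
    ((h.contDiffAt_normal hσ).fderiv_right (m := ∞) le_rfl).differentiableAt (by simp)
  have h2 := h1.hasFDerivAt.clm_apply (hasFDerivAt_const l σ)
  have h3 := hasDerivAt_pi.mp (h2.hasLineDerivAt k) i
  simpa using h3

theorem second_symm (h : Surf U Y N) (hσ : σ ∈ U) (k l : Fin 2 → ℝ) :
    fderiv ℝ (fderiv ℝ Y) σ k l = fderiv ℝ (fderiv ℝ Y) σ l k :=
  ((h.contDiffAt hσ).isSymmSndFDerivAt (by simp only [minSmoothness_of_isRCLikeNormedField]; exact two_le_infty)).eq k l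

theorem second_symm_normal (h : Surf U Y N) (hσ : σ ∈ U) (k l : Fin 2 → ℝ) :
    fderiv ℝ (fderiv ℝ N) σ k l = fderiv ℝ (fderiv ℝ N) σ l k :=
  ((h.contDiffAt_normal hσ).isSymmSndFDerivAt (by simp only [minSmoothness_of_isRCLikeNormedField]; exact two_le_infty)).eq k l

theorem normal_dot_dN (h : Surf U Y N) (hσ : σ ∈ U) (k : Fin 2 → ℝ) :
    N σ ⬝ᵥ fderiv ℝ N σ k = 0 := by
  have hN := h.lineN hσ k
  have hd := (((((hN 0).mul (hN 0)).add ((hN 1).mul (hN 1))).add ((hN 2).mul (hN 2))).sub_const 1)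
  have := lineDeriv_eq_zero h.isOpen
    (F := fun σ => N σ 0 * N σ 0 + N σ 1 * N σ 1 + N σ 2 * N σ 2 - 1)
    (fun τ hτ => by have := h.unit τ hτ; rw [dot3] at this; linarith) hσ hd
  simp only [zero_smul, add_zero] at this
  rw [dot3]
  linarith

/-- The second fundamental form in terms of second derivatives of the immersion. -/
theorem normal_dot_second (h : Surf U Y N) (hσ : σ ∈ U) (k l : Fin 2 → ℝ) :
    N σ ⬝ᵥ fderiv ℝ (fderiv ℝ Y) σ k l = -(fderiv ℝ N σ k ⬝ᵥ fderiv ℝ Y σ l) := by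
  have hN := h.lineN hσ k
  have hY := h.lineDY hσ k l
  have hd := ((((hN 0).mul (hY 0)).add ((hN 1).mul (hY 1))).add ((hN 2).mul (hY 2)))
  have := lineDeriv_eq_zero h.isOpen
    (F := fun σ => N σ 0 * fderiv ℝ Y σ l 0 + N σ 1 * fderiv ℝ Y σ l 1 + N σ 2 * fderiv ℝ Y σ l 2)
    (fun τ hτ => by have := h.normal τ hτ l; rw [dot3] at this; linarith) hσ hd
  simp only [zero_smul, add_zero] at this
  rw [dot3, dot3]
  linarith

theorem dN_symm (h : Surf U Y N) (hσ : σ ∈ U) (k l : Fin 2 → ℝ) :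
    fderiv ℝ N σ k ⬝ᵥ fderiv ℝ Y σ l = fderiv ℝ N σ l ⬝ᵥ fderiv ℝ Y σ k := by
  have h1 := h.normal_dot_second hσ k l
  rw [h.second_symm hσ, h.normal_dot_second hσ] at h1
  linarith

/-- Every vector orthogonal to the normal is tangent. -/
theorem exists_tangent (h : Surf U Y N) (hσ : σ ∈ U) {w : Fin 3 → ℝ} (hw : N σ ⬝ᵥ w = 0) :
    ∃ k, fderiv ℝ Y σ k = w := by
  let φ : (Fin 3 → ℝ) →ₗ[ℝ] ℝ := dotProductBilin ℝ ℝ (N σ)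
  have hφ : ∀ x, φ x = N σ ⬝ᵥ x := fun x => rfl
  have hle : LinearMap.range (fderiv ℝ Y σ).toLinearMap ≤ LinearMap.ker φ := by
    rintro _ ⟨k, rfl⟩
    exact h.normal σ hσ k
  have h2 : Module.finrank ℝ (LinearMap.range (fderiv ℝ Y σ).toLinearMap) = 2 := by
    rw [LinearMap.finrank_range_of_inj (h.injective σ hσ)]
    simp
  have hs : LinearMap.range φ = ⊤ := by
    rw [LinearMap.range_eq_top]
    intro c
    refine ⟨c • N σ, ?_⟩
    rw [hφ, dotProduct_smul, h.unit σ hσ]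
    simp
  have h3 := LinearMap.finrank_range_add_finrank_ker φ
  rw [hs, finrank_top] at h3
  simp at h3
  have he := Submodule.eq_of_le_of_finrank_eq hle (by rw [h2]; omega)
  have : w ∈ LinearMap.ker φ := hw
  rw [← he] at this
  exact this

theorem dY_ne_zero (h : Surf U Y N) (hσ : σ ∈ U) {k : Fin 2 → ℝ} (hk : k ≠ 0) :
    fderiv ℝ Y σ k ≠ 0 := by
  intro h0
  apply hk
  apply h.injective σ hσ
  rw [h0, map_zero]

/-- The shape operator of a minimal surface anticommutes with the rotation by a right angle. -/
theorem dN_rot (h : Surf U Y N) (hσ : σ ∈ U) {k l : Fin 2 → ℝ}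
    (hl : fderiv ℝ Y σ l = N σ ⨯₃ fderiv ℝ Y σ k) :
    fderiv ℝ N σ l = -(N σ ⨯₃ fderiv ℝ N σ k) := by
  have hu := h.unit σ hσ
  by_cases hk : k = 0
  · have : l = 0 := by
      apply h.injective σ hσ
      rw [hl, hk]
      simp
    rw [this, hk]
    simp
  · have hw := h.dY_ne_zero hσ hk
    have hNw := h.normal σ hσ k
    have hm := h.minimal σ hσ k l
    have hs := h.dN_symm hσ k l
    have h1 := h.normal_dot_dN hσ k
    have h2 := h.normal_dot_dN hσ l
    rw [hl] at hm hs
    rw [← sub_eq_zero, sub_neg_eq_add]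
    generalize fderiv ℝ Y σ k = w at *
    generalize fderiv ℝ N σ k = a at *
    generalize fderiv ℝ N σ l = b at *
    generalize N σ = m at *
    -- Testing against w uses that the shape operator is self-adjoint, testing against N × w that it
    -- is trace-free.
    apply eq_zero_of_dot hu hw hNw
    · simp only [dot3, cross3_zero, cross3_one, cross3_two, Pi.add_apply] at *
      linear_combination h2
    · simp only [dot3, cross3_zero, cross3_one, cross3_two, Pi.add_apply] at *
      linear_combination -hs
    · simp only [dot3, cross3_zero, cross3_one, cross3_two, Pi.add_apply] at *
      linear_combination hm

/-- If the shape operator of a minimal surface has a kernel, it vanishes. -/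
theorem dN_eq_zero (h : Surf U Y N) (hσ : σ ∈ U) {k : Fin 2 → ℝ} (hk : k ≠ 0)
    (h0 : fderiv ℝ N σ k = 0) : fderiv ℝ N σ = 0 := by
  have hw := h.dY_ne_zero hσ hk
  have hNw := h.normal σ hσ k
  obtain ⟨l, hl⟩ := h.exists_tangent hσ (w := N σ ⨯₃ fderiv ℝ Y σ k) (by simp)
  -- By anticommutation the kernel also contains the direction rotated by a right angle, so it is
  -- everything; self-adjointness then transfers this to each `fderiv ℝ N σ m`.
  have hl0 : fderiv ℝ N σ l = 0 := by rw [h.dN_rot hσ hl, h0]; simp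
  ext1 m
  apply eq_zero_of_dot (h.unit σ hσ) hw hNw (h.normal_dot_dN hσ m)
  · rw [← h.dN_symm hσ k m, h0]; simp
  · rw [← hl, ← h.dN_symm hσ l m, hl0]; simp

/-- If a non-zero constant vector is tangent to a minimal surface, then the normal is locally
constant. -/
theorem dN_eq_zero_of_const (h : Surf U Y N) {c : Fin 3 → ℝ} (hc : c ≠ 0)
    (ht : ∀ σ ∈ U, N σ ⬝ᵥ c = 0) (hσ : σ ∈ U) : fderiv ℝ N σ = 0 := by
  obtain ⟨k, hk⟩ := h.exists_tangent hσ (ht σ hσ)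
  have hk0 : k ≠ 0 := by
    rintro rfl
    apply hc
    rw [← hk, map_zero]
  -- Differentiating N · c = 0 puts c in the kernel of the second fundamental form.
  have hl : ∀ l, fderiv ℝ N σ l ⬝ᵥ c = 0 := by
    intro l
    have hN := h.lineN hσ l
    have hd := ((((hN 0).mul_const (c 0)).add ((hN 1).mul_const (c 1))).add
      ((hN 2).mul_const (c 2)))
    have := lineDeriv_eq_zero h.isOpen
      (F := fun σ => N σ 0 * c 0 + N σ 1 * c 1 + N σ 2 * c 2)
      (fun τ hτ => by have := ht τ hτ; rw [dot3] at this; linarith) hσ hd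
    rw [dot3]
    linarith
  apply h.dN_eq_zero hσ hk0
  obtain ⟨l, hl'⟩ := h.exists_tangent hσ (w := N σ ⨯₃ fderiv ℝ Y σ k) (by simp)
  apply eq_zero_of_dot (h.unit σ hσ) (h.dY_ne_zero hσ hk0) (h.normal σ hσ k)
    (h.normal_dot_dN hσ k)
  · rw [hk]; exact hl k
  · rw [← hl', h.dN_symm hσ, hk]; exact hl l

/-- The differential of an immersed surface does not take values in a line. -/
theorem not_line (h : Surf U Y N) {c : Fin 3 → ℝ} (hσ : σ ∈ U)
    (hl : ∀ k, fderiv ℝ Y σ k ⨯₃ c = 0) : c = 0 := by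
  obtain ⟨k, hk⟩ : ∃ k : Fin 2 → ℝ, k ≠ 0 := ⟨1, one_ne_zero⟩
  have hw := h.dY_ne_zero hσ hk
  have hNw := h.normal σ hσ k
  obtain ⟨l, hl'⟩ := h.exists_tangent hσ (w := N σ ⨯₃ fderiv ℝ Y σ k) (by simp)
  have hu := h.unit σ hσ
  have e1 := hl k
  have e2 := hl l
  rw [hl'] at e2
  generalize fderiv ℝ Y σ k = w at *
  generalize N σ = m at *
  have a0 := congrFun e1 0
  have a1 := congrFun e1 1
  have a2 := congrFun e1 2
  have b0 := congrFun e2 0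
  have b1 := congrFun e2 1
  have b2 := congrFun e2 2
  have hp := dot3_self_pos hw
  refine eq_zero_of_dot hu hw hNw ?_ ?_ ?_ <;>
    simp only [dot3, cross3_zero, cross3_one, cross3_two, Pi.zero_apply] at *
  · refine (mul_eq_zero.mp ?_).resolve_left hp.ne'
    linear_combination (-(m 0 * w 1 - m 1 * w 0)) * a2 - (m 2 * w 0 - m 0 * w 2) * a1 -
      (m 1 * w 2 - m 2 * w 1) * a0 + (c 0 * w 0 + c 1 * w 1 + c 2 * w 2) * hNw
  · linear_combination (-m 0) * b0 - m 1 * b1 - m 2 * b2 - (c 0 * w 0 + c 1 * w 1 + c 2 * w 2) * hu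
      + (c 0 * m 0 + c 1 * m 1 + c 2 * m 2) * hNw
  · linear_combination m 0 * a0 + m 1 * a1 + m 2 * a2

end Surf

end Blackfold

/-! ### The Codazzi equation for a minimal surface tangent to a linear field. -/

namespace Blackfold

open Matrix

theorem hasDerivAt_dot {u v : ℝ → Fin 3 → ℝ} {u' v' : Fin 3 → ℝ} {t : ℝ} (hu : HasDerivAt u u' t)
    (hv : HasDerivAt v v' t) : HasDerivAt (fun t => u t ⬝ᵥ v t) (u' ⬝ᵥ v t + u t ⬝ᵥ v') t := by
  simp_rw [dot3]
  have hu := hasDerivAt_pi.mp hu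
  have hv := hasDerivAt_pi.mp hv
  refine ((((hu 0).mul (hv 0)).add ((hu 1).mul (hv 1))).add ((hu 2).mul (hv 2))).congr_deriv ?_
  ring

theorem dot_mul_left (A u v : Fin 3 → ℝ) : (A * u) ⬝ᵥ v = u ⬝ᵥ (A * v) := by
  simp only [dot3, Pi.mul_apply]
  ring

/-- Three times the trace of `A` in the orthogonal frame `T`, `N × T`, `N`. -/
theorem trace_frame {N T : Fin 3 → ℝ} (A : Fin 3 → ℝ) (hN : N ⬝ᵥ N = 1) (hT : N ⬝ᵥ T = 0) :
    T ⬝ᵥ (A * T) + (N ⨯₃ T) ⬝ᵥ (A * (N ⨯₃ T)) + (T ⬝ᵥ T) * (N ⬝ᵥ (A * N)) =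
      (T ⬝ᵥ T) * (A 0 + A 1 + A 2) := by
  simp only [dot3, Pi.mul_apply, cross3_zero, cross3_one, cross3_two] at *
  -- The three identities are the diagonal entries of |T|² · 1 = T Tᵗ + (N × T)(N × T)ᵗ + |T|² N Nᵗ.
  have h0 : T 0 ^ 2 + (N 1 * T 2 - N 2 * T 1) ^ 2 + (T 0 * T 0 + T 1 * T 1 + T 2 * T 2) * N 0 ^ 2 =
      T 0 * T 0 + T 1 * T 1 + T 2 * T 2 := by
    linear_combination (T 0 * T 0 + T 1 * T 1 + T 2 * T 2 - T 0 ^ 2) * hN +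
      (T 0 * N 0 - N 1 * T 1 - N 2 * T 2) * hT
  have h1 : T 1 ^ 2 + (N 2 * T 0 - N 0 * T 2) ^ 2 + (T 0 * T 0 + T 1 * T 1 + T 2 * T 2) * N 1 ^ 2 =
      T 0 * T 0 + T 1 * T 1 + T 2 * T 2 := by
    linear_combination (T 0 * T 0 + T 1 * T 1 + T 2 * T 2 - T 1 ^ 2) * hN +
      (T 1 * N 1 - N 0 * T 0 - N 2 * T 2) * hT
  have h2 : T 2 ^ 2 + (N 0 * T 1 - N 1 * T 0) ^ 2 + (T 0 * T 0 + T 1 * T 1 + T 2 * T 2) * N 2 ^ 2 =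
      T 0 * T 0 + T 1 * T 1 + T 2 * T 2 := by
    linear_combination (T 0 * T 0 + T 1 * T 1 + T 2 * T 2 - T 2 ^ 2) * hN +
      (T 2 * N 2 - N 0 * T 0 - N 1 * T 1) * hT
  linear_combination A 0 * h0 + A 1 * h1 + A 2 * h2

/-- Expansion of a vector orthogonal to `N` in the frame `T`, `N × T`. -/
theorem frame_expand {N T w : Fin 3 → ℝ} (hN : N ⬝ᵥ N = 1) (hT : N ⬝ᵥ T = 0) (hw : N ⬝ᵥ w = 0) :
    (T ⬝ᵥ T) • w = (w ⬝ᵥ T) • T + (w ⬝ᵥ (N ⨯₃ T)) • (N ⨯₃ T) := by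
  by_cases hT0 : T = 0
  · simp [hT0]
  rw [← sub_eq_zero]
  apply eq_zero_of_dot hN hT0 hT <;>
    simp only [dot3, Pi.add_apply, Pi.sub_apply, Pi.smul_apply, smul_eq_mul, cross3_zero,
      cross3_one, cross3_two] at *
  · linear_combination (T 0 * T 0 + T 1 * T 1 + T 2 * T 2) * hw -
      (T 0 * w 0 + T 1 * w 1 + T 2 * w 2) * hT
  · ring
  · linear_combination -((w 0 * (N 1 * T 2 - N 2 * T 1) + w 1 * (N 2 * T 0 - N 0 * T 2)
      + w 2 * (N 0 * T 1 - N 1 * T 0)) * (T 0 * T 0 + T 1 * T 1 + T 2 * T 2)) * hN +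
      ((w 0 * (N 1 * T 2 - N 2 * T 1) + w 1 * (N 2 * T 0 - N 0 * T 2)
      + w 2 * (N 0 * T 1 - N 1 * T 0)) * (N 0 * T 0 + N 1 * T 1 + N 2 * T 2)) * hT

namespace Surf

variable {U : Set (Fin 2 → ℝ)} {Y N : (Fin 2 → ℝ) → Fin 3 → ℝ} {σ : Fin 2 → ℝ}

theorem vecY (h : Surf U Y N) (hσ : σ ∈ U) (k : Fin 2 → ℝ) :
    HasDerivAt (fun t : ℝ => Y (σ + t • k)) (fderiv ℝ Y σ k) 0 :=
  hasDerivAt_pi.mpr (h.lineY hσ k)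

theorem vecN (h : Surf U Y N) (hσ : σ ∈ U) (k : Fin 2 → ℝ) :
    HasDerivAt (fun t : ℝ => N (σ + t • k)) (fderiv ℝ N σ k) 0 :=
  hasDerivAt_pi.mpr (h.lineN hσ k)

theorem vecDY (h : Surf U Y N) (hσ : σ ∈ U) (k l : Fin 2 → ℝ) :
    HasDerivAt (fun t : ℝ => fderiv ℝ Y (σ + t • k) l) (fderiv ℝ (fderiv ℝ Y) σ k l) 0 :=
  hasDerivAt_pi.mpr (h.lineDY hσ k l)

theorem vecDN (h : Surf U Y N) (hσ : σ ∈ U) (k l : Fin 2 → ℝ) :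
    HasDerivAt (fun t : ℝ => fderiv ℝ N (σ + t • k) l) (fderiv ℝ (fderiv ℝ N) σ k l) 0 :=
  hasDerivAt_pi.mpr (h.lineDN hσ k l)

/-- A vector orthogonal to the normal and to all tangent vectors vanishes. -/
theorem ext_tangent (h : Surf U Y N) (hσ : σ ∈ U) {u : Fin 3 → ℝ} (h0 : N σ ⬝ᵥ u = 0)
    (ht : ∀ k, u ⬝ᵥ fderiv ℝ Y σ k = 0) : u = 0 := by
  obtain ⟨k, hk⟩ : ∃ k : Fin 2 → ℝ, k ≠ 0 := ⟨1, one_ne_zero⟩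
  obtain ⟨l, hl⟩ := h.exists_tangent hσ (w := N σ ⨯₃ fderiv ℝ Y σ k) (by simp)
  exact eq_zero_of_dot (h.unit σ hσ) (h.dY_ne_zero hσ hk) (h.normal σ hσ k) h0 (ht k)
    (hl ▸ ht l)

section Static

variable {A : Fin 3 → ℝ}

/-- The differential of `N · A Y = 0`. -/
theorem dN_dot_force (h : Surf U Y N) (hf : ∀ σ ∈ U, N σ ⬝ᵥ (A * Y σ) = 0) (hσ : σ ∈ U)
    (k : Fin 2 → ℝ) : fderiv ℝ N σ k ⬝ᵥ (A * Y σ) = -((A * N σ) ⬝ᵥ fderiv ℝ Y σ k) := by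
  have hd := hasDerivAt_dot (h.vecN hσ k) ((h.vecY hσ k).const_mul A)
  have := lineDeriv_eq_zero h.isOpen hf hσ hd
  simp only [zero_smul, add_zero] at this
  rw [dot_mul_left]
  linarith

/-- The derivative of the normal along `A Y`. -/
theorem dN_force (h : Surf U Y N) (hf : ∀ σ ∈ U, N σ ⬝ᵥ (A * Y σ) = 0) (hσ : σ ∈ U)
    {k : Fin 2 → ℝ} (hk : fderiv ℝ Y σ k = A * Y σ) :
    fderiv ℝ N σ k = -(A * N σ) + (N σ ⬝ᵥ (A * N σ)) • N σ := by
  rw [← sub_eq_zero]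
  apply h.ext_tangent hσ
  · rw [dotProduct_sub, h.normal_dot_dN hσ, dotProduct_add, dotProduct_smul, h.unit σ hσ,
      dotProduct_neg]
    simp
  · intro l
    rw [sub_dotProduct, h.dN_symm hσ, hk, h.dN_dot_force hf hσ, add_dotProduct, smul_dotProduct,
      h.normal σ hσ, neg_dotProduct]
    simp

/-- The shape operator anticommutes with N × ·, and the cross product with N drops the normal part
in `dN_force`. With `dN_force` this gives the shape operator on a whole tangent frame. -/
theorem dN_force_rot (h : Surf U Y N) (hf : ∀ σ ∈ U, N σ ⬝ᵥ (A * Y σ) = 0) (hσ : σ ∈ U)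
    {k : Fin 2 → ℝ} (hk : fderiv ℝ Y σ k = N σ ⨯₃ (A * Y σ)) :
    fderiv ℝ N σ k = N σ ⨯₃ (A * N σ) := by
  obtain ⟨l, hl⟩ := h.exists_tangent hσ (hf σ hσ)
  rw [← hl] at hk
  rw [h.dN_rot hσ hk, h.dN_force hf hσ hl]
  simp

/-- The shape operator is determined by its value on `A Y`. -/
theorem dN_formula (h : Surf U Y N) (hf : ∀ σ ∈ U, N σ ⬝ᵥ (A * Y σ) = 0) (hσ : σ ∈ U)
    (hT : A * Y σ ≠ 0) (k : Fin 2 → ℝ) :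
    ((A * Y σ) ⬝ᵥ (A * Y σ)) • fderiv ℝ N σ k + ((A * N σ) ⬝ᵥ fderiv ℝ Y σ k) • (A * Y σ)
      + ((A * Y σ) ⬝ᵥ fderiv ℝ Y σ k) • (A * N σ - (N σ ⬝ᵥ (A * N σ)) • N σ)
      - ((A * Y σ) ⬝ᵥ (A * N σ)) • fderiv ℝ Y σ k = 0 := by
  have hu := h.unit σ hσ
  have h1 := h.normal_dot_dN hσ k
  have h2 := h.normal σ hσ k
  have h3 := h.dN_dot_force hf hσ k
  have h4 := hf σ hσ
  -- Self-adjointness moves the known value on the rotated field N × A Y to an arbitrary direction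
  -- k, which is then expanded in the frame A Y, N × A Y.
  obtain ⟨l, hl⟩ := h.exists_tangent hσ (w := N σ ⨯₃ (A * Y σ)) (by simp)
  have h5 := h.dN_symm hσ k l
  rw [h.dN_force_rot hf hσ hl, hl] at h5
  have h6 := congrArg (fun v => (N σ ⨯₃ (A * N σ)) ⬝ᵥ v) (frame_expand hu h4 h2)
  simp only [dotProduct_add, dotProduct_smul, smul_eq_mul] at h6
  generalize fderiv ℝ N σ k = a at *
  generalize fderiv ℝ Y σ k = w at *
  generalize A * Y σ = T at *
  generalize A * N σ = b at *
  generalize N σ = m at *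
  have e1 : (m ⨯₃ b) ⬝ᵥ T = -(b ⬝ᵥ (m ⨯₃ T)) := by
    simp only [dot3, cross3_zero, cross3_one, cross3_two]; ring
  have e2 : (m ⨯₃ b) ⬝ᵥ (m ⨯₃ T) = b ⬝ᵥ T := by
    simp only [dot3, cross3_zero, cross3_one, cross3_two] at *
    linear_combination (b 0 * T 0 + b 1 * T 1 + b 2 * T 2) * hu -
      (m 0 * b 0 + m 1 * b 1 + m 2 * b 2) * h4
  rw [e1, e2] at h6
  have e3 : m ⬝ᵥ (m ⨯₃ T) = 0 := by simp
  apply eq_zero_of_dot hu hT h4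
  · simp only [dotProduct_add, dotProduct_sub, dotProduct_smul, smul_eq_mul, h1, h2, h4, hu]
    ring
  · simp only [add_dotProduct, sub_dotProduct, smul_dotProduct, smul_eq_mul, h3, h4]
    rw [dotProduct_comm w T, dotProduct_comm b T]
    ring
  · simp only [add_dotProduct, sub_dotProduct, smul_dotProduct, smul_eq_mul, e3, h5]
    have : T ⬝ᵥ (m ⨯₃ T) = 0 := by simp
    rw [this]
    rw [dotProduct_comm w T, dotProduct_comm b T] at h6
    linarith

/-- The Codazzi equation for a minimal surface tangent to the linear field `A x`. -/
theorem codazzi_force (h : Surf U Y N) (hf : ∀ σ ∈ U, N σ ⬝ᵥ (A * Y σ) = 0)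
    (hT : ∀ σ ∈ U, A * Y σ ≠ 0) (hσ : σ ∈ U) :
    2 * ((A * (A * Y σ)) ⬝ᵥ (A * N σ)) =
      (A * Y σ) ⬝ᵥ (A * N σ) * (A 0 + A 1 + A 2 + N σ ⬝ᵥ (A * N σ)) := by
  obtain ⟨k, hk⟩ := h.exists_tangent hσ (hf σ hσ)
  obtain ⟨l, hl⟩ := h.exists_tangent hσ (w := N σ ⨯₃ (A * Y σ)) (by simp)
  have hNk := h.dN_force hf hσ hk
  have hNl := h.dN_force_rot hf hσ hl
  -- The vector c is frozen at σ: only the component of `dN_formula` along it is differentiated, and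
  -- this component carries the whole Codazzi equation needed.
  set c := N σ ⨯₃ (A * Y σ) with hc
  have key : ∀ a b : Fin 2 → ℝ, ∀ d, HasLineDerivAt ℝ (fun σ =>
      ((A * Y σ) ⬝ᵥ (A * Y σ)) * (c ⬝ᵥ fderiv ℝ N σ a)
      + ((A * N σ) ⬝ᵥ fderiv ℝ Y σ a) * (c ⬝ᵥ (A * Y σ))
      + ((A * Y σ) ⬝ᵥ fderiv ℝ Y σ a) * (c ⬝ᵥ (A * N σ) - (N σ ⬝ᵥ (A * N σ)) * (c ⬝ᵥ N σ))
      - ((A * Y σ) ⬝ᵥ (A * N σ)) * (c ⬝ᵥ fderiv ℝ Y σ a)) d σ b → d = 0 := by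
    intro a b d hd
    refine lineDeriv_eq_zero h.isOpen (fun τ hτ => ?_) hσ hd
    have := congrArg (fun v => c ⬝ᵥ v) (h.dN_formula hf hτ (hT τ hτ) a)
    simpa only [dotProduct_add, dotProduct_sub, dotProduct_smul, smul_eq_mul, dotProduct_zero]
      using this
  have hder : ∀ a b : Fin 2 → ℝ, _ := fun a b =>
    let Tb := (h.vecY hσ b).const_mul A
    let Nb := h.vecN hσ b
    let ANb := Nb.const_mul A
    let cc := hasDerivAt_const (0 : ℝ) c
    key a b _ (((((hasDerivAt_dot Tb Tb).mul (hasDerivAt_dot cc (h.vecDN hσ b a))).add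
      ((hasDerivAt_dot ANb (h.vecDY hσ b a)).mul (hasDerivAt_dot cc Tb))).add
      ((hasDerivAt_dot Tb (h.vecDY hσ b a)).mul ((hasDerivAt_dot cc ANb).sub
        ((hasDerivAt_dot Nb ANb).mul (hasDerivAt_dot cc Nb))))).sub
      ((hasDerivAt_dot Tb ANb).mul (hasDerivAt_dot cc (h.vecDY hσ b a))))
  -- The formula for the shape operator in direction k is differentiated along l, and conversely. In
  -- the difference the second derivatives of Y and N cancel by symmetry, which leaves an algebraic
  -- relation between Y and N.
  have hkl := hder k l
  have hlk := hder l k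
  rw [h.second_symm hσ l k, h.second_symm_normal hσ l k] at hkl
  simp only [zero_smul, add_zero, zero_dotProduct, zero_add, hk, hl, hNk, hNl] at hkl hlk
  have hu := h.unit σ hσ
  have h4 := hf σ hσ
  generalize fderiv ℝ (fderiv ℝ Y) σ k l = y at *
  generalize fderiv ℝ (fderiv ℝ N) σ k l = z at *
  have hTc : (A * Y σ) ⬝ᵥ c = 0 := by simp only [hc]; simp
  have hcT : c ⬝ᵥ (A * Y σ) = 0 := by rw [dotProduct_comm, hTc]
  have hNc : N σ ⬝ᵥ c = 0 := by simp only [hc]; simp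
  have hcN : c ⬝ᵥ N σ = 0 := by rw [dotProduct_comm, hNc]
  have htr := trace_frame A hu h4
  rw [← hc] at htr
  have hT0 := (dot3_self_pos (hT σ hσ)).ne'
  have e1 := congrArg (fun v => v ⬝ᵥ (A * c))
    (frame_expand hu h4 (w := N σ ⨯₃ (A * N σ)) (by simp))
  have e2 := congrArg (fun v => v ⬝ᵥ (A * (A * Y σ)))
    (frame_expand hu h4 (w := A * N σ - (N σ ⬝ᵥ (A * N σ)) • N σ) (by
      rw [dotProduct_sub, dotProduct_smul, hu]; simp))
  rw [← hc] at e1 e2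
  have e3 : (N σ ⨯₃ (A * N σ)) ⬝ᵥ (A * Y σ) = -((A * N σ) ⬝ᵥ c) := by
    rw [hc]; simp only [dot3, cross3_zero, cross3_one, cross3_two]; ring
  have e4 : c ⬝ᵥ (N σ ⨯₃ (A * N σ)) = (A * Y σ) ⬝ᵥ (A * N σ) := by
    rw [hc]
    generalize A * Y σ = T at *
    generalize A * N σ = b at *
    simp only [dot3, cross3_zero, cross3_one, cross3_two] at hu h4 ⊢
    linear_combination (T 0 * b 0 + T 1 * b 1 + T 2 * b 2) * hu -
      (N σ 0 * b 0 + N σ 1 * b 1 + N σ 2 * b 2) * h4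
  have e5 : c ⬝ᵥ c = (A * Y σ) ⬝ᵥ (A * Y σ) := by
    rw [hc]
    generalize A * Y σ = T at *
    simp only [dot3, cross3_zero, cross3_one, cross3_two] at hu h4 ⊢
    linear_combination (T 0 * T 0 + T 1 * T 1 + T 2 * T 2) * hu -
      (N σ 0 * T 0 + N σ 1 * T 1 + N σ 2 * T 2) * h4
  have e6 := dotProduct_comm c (N σ ⨯₃ (A * N σ))
  have e7 : N σ ⬝ᵥ (A * (A * Y σ)) = (A * Y σ) ⬝ᵥ (A * N σ) := by
    rw [← dot_mul_left, dotProduct_comm]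
  have e8 := dot_mul_left A c (A * Y σ)
  have e9 := dotProduct_comm (A * c) (A * Y σ)
  have e10 := dotProduct_comm (A * N σ) c
  have e11 := dotProduct_comm (A * N σ) (A * Y σ)
  have e12 := dot_mul_left A (A * Y σ) (A * N σ)
  have e13 := dot_mul_left A (A * Y σ) (A * Y σ)
  have e14 := dotProduct_comm (A * N σ) (A * (A * Y σ))
  simp only [mul_add, mul_neg, mul_smul_comm, add_dotProduct, dotProduct_add, dotProduct_neg,
    sub_dotProduct, neg_dotProduct, Pi.sub_apply, Pi.mul_apply, zero_smul, add_zero,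
    smul_dotProduct, dotProduct_smul, smul_eq_mul, hcT, hTc, hcN] at hkl hlk e1 e2
  rw [← e6, e4, e3] at e1
  rw [e11, e7, e10, h4] at e2
  rw [e4] at hkl hlk
  rw [e5] at hlk
  have e15 := dot_mul_left A c (N σ ⨯₃ (A * N σ))
  have e16 := dotProduct_comm (A * c) (N σ ⨯₃ (A * N σ))
  have e17 := dot_mul_left A (A * Y σ) c
  rw [← e15, e16] at hkl
  rw [← e8, e9] at hlk e2
  rw [e11, e9] at hkl
  rw [e13, e10, e17, ← e12] at hlk
  rw [e14, hNc] at e2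
  rw [e10] at e1
  -- The frame expansions `e1`, `e2` and the trace identity carry a factor |A Y|², so the relation
  -- is proved after multiplication by 2 |A Y|².
  apply mul_left_cancel₀ hT0
  apply mul_left_cancel₀ (two_ne_zero (α := ℝ))
  linear_combination 4 * e2 - hkl + hlk + e1 + 2 * ((A * Y σ) ⬝ᵥ (A * N σ)) * htr

end Static

end Surf

end Blackfold

/-! ### Flatness of minimal surfaces tangent to a linear field. -/

namespace Blackfold

open Matrix

namespace Surf

variable {U : Set (Fin 2 → ℝ)} {Y N : (Fin 2 → ℝ) → Fin 3 → ℝ} {σ : Fin 2 → ℝ}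

theorem contDiffOn_fderiv (h : Surf U Y N) (k : Fin 2 → ℝ) :
    ContDiffOn ℝ ∞ (fun σ => fderiv ℝ Y σ k) U := fun _ hσ =>
  (((h.contDiffAt hσ).fderiv_right (m := ∞) le_rfl).clm_apply contDiffAt_const).contDiffWithinAt

theorem contDiffOn_fderiv_normal (h : Surf U Y N) (k : Fin 2 → ℝ) :
    ContDiffOn ℝ ∞ (fun σ => fderiv ℝ N σ k) U := fun _ hσ =>
  (((h.contDiffAt_normal hσ).fderiv_right (m := ∞) le_rfl).clm_apply
    contDiffAt_const).contDiffWithinAt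

theorem contY (h : Surf U Y N) (i : Fin 3) : ContDiffOn ℝ ∞ (fun σ => Y σ i) U :=
  contDiffOn_pi.mp h.smooth i

theorem contN (h : Surf U Y N) (i : Fin 3) : ContDiffOn ℝ ∞ (fun σ => N σ i) U :=
  contDiffOn_pi.mp h.smooth_normal i

theorem contDY (h : Surf U Y N) (k : Fin 2 → ℝ) (i : Fin 3) :
    ContDiffOn ℝ ∞ (fun σ => fderiv ℝ Y σ k i) U :=
  contDiffOn_pi.mp (h.contDiffOn_fderiv k) i

theorem contDN (h : Surf U Y N) (k : Fin 2 → ℝ) (i : Fin 3) :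
    ContDiffOn ℝ ∞ (fun σ => fderiv ℝ N σ k i) U :=
  contDiffOn_pi.mp (h.contDiffOn_fderiv_normal k) i

/-- The set where the shape operator does not vanish is open. -/
theorem isOpen_nonflat (h : Surf U Y N) : IsOpen {σ ∈ U | fderiv ℝ N σ ≠ 0} := by
  have hc : ContinuousOn (fderiv ℝ N) U := fun σ hσ =>
    ((h.contDiffAt_normal hσ).fderiv_right (m := ∞) le_rfl).continuousAt.continuousWithinAt
  exact hc.isOpen_inter_preimage h.isOpen isOpen_compl_singleton

theorem isOpen_ne (h : Surf U Y N) {F : (Fin 2 → ℝ) → ℝ} (hF : ContinuousOn F U) (c : ℝ) :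
    IsOpen {σ ∈ U | F σ ≠ c} :=
  hF.isOpen_inter_preimage h.isOpen isOpen_compl_singleton

/-- A surface on which a coordinate is constant has constant normal. -/
theorem dN_eq_zero_of_coord (h : Surf U Y N) {i : Fin 3} {c : ℝ} (hi : ∀ σ ∈ U, Y σ i = c)
    (hσ : σ ∈ U) : fderiv ℝ N σ = 0 := by
  obtain ⟨j, hj⟩ : ∃ j : Fin 3, j ≠ i := exists_ne i
  apply h.dN_eq_zero_of_const (c := Pi.single j 1) (by simp) (fun τ hτ => ?_) hσ
  have hd : ∀ k, fderiv ℝ Y τ k i = 0 := fun k =>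
    lineDeriv_eq_zero h.isOpen (F := fun σ => Y σ i - c) (fun ρ hρ => by rw [hi ρ hρ, sub_self]) hτ
      ((h.lineY hτ k i).sub_const c)
  -- The coordinate vector e_i is normal, so every other e_j is a constant tangent vector.
  have h0 : Pi.single i 1 - N τ i • N τ = 0 := by
    apply h.ext_tangent hτ
    · rw [dotProduct_sub, dotProduct_smul, h.unit τ hτ]
      simp
    · intro k
      rw [sub_dotProduct, smul_dotProduct, h.normal τ hτ]
      simp [hd]
  have h1 := congrFun h0 i
  have h2 := congrFun h0 j
  simp only [Pi.sub_apply, Pi.single_eq_same, Pi.smul_apply, smul_eq_mul, Pi.zero_apply,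
    Pi.single_eq_of_ne hj, zero_sub, neg_eq_zero] at h1 h2
  have hN : N τ i ≠ 0 := by
    intro h0
    rw [h0] at h1
    norm_num at h1
  simpa using (mul_eq_zero.mp h2).resolve_left hN

section Static

variable {A : Fin 3 → ℝ}

/-- Differentiating the Codazzi relation along A Y itself leaves (A Y · A N) |G|² = 0, where G is
the tangential part of A N, that is, minus the derivative of N along A Y. If G = 0 the shape
operator has a kernel and vanishes; if A Y · A N = 0 the Codazzi relation supplies the second
equation. -/
theorem force_dichotomy (h : Surf U Y N) (hf : ∀ σ ∈ U, N σ ⬝ᵥ (A * Y σ) = 0)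
    (hT : ∀ σ ∈ U, A * Y σ ≠ 0) (hσ : σ ∈ U) :
    fderiv ℝ N σ = 0 ∨
      (A * Y σ) ⬝ᵥ (A * N σ) = 0 ∧ (A * (A * Y σ)) ⬝ᵥ (A * N σ) = 0 := by
  obtain ⟨k, hk⟩ := h.exists_tangent hσ (hf σ hσ)
  have hNk := h.dN_force hf hσ hk
  have hk0 : k ≠ 0 := by
    rintro rfl
    exact hT σ hσ (by rw [← hk, map_zero])
  have hC := h.codazzi_force hf hT hσ
  have hY := h.vecY hσ k
  have hN := h.vecN hσ k
  have hd := lineDeriv_eq_zero h.isOpen (F := fun σ => 2 * ((A * (A * Y σ)) ⬝ᵥ (A * N σ)) -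
      (A * Y σ) ⬝ᵥ (A * N σ) * (A 0 + A 1 + A 2 + N σ ⬝ᵥ (A * N σ)))
    (fun τ hτ => by rw [h.codazzi_force hf hT hτ, sub_self]) hσ
    (((hasDerivAt_dot ((hY.const_mul A).const_mul A) (hN.const_mul A)).const_mul 2).sub
      ((hasDerivAt_dot (hY.const_mul A) (hN.const_mul A)).mul
        ((hasDerivAt_dot hN (hN.const_mul A)).const_add (A 0 + A 1 + A 2))))
  simp only [zero_smul, add_zero, hk, hNk] at hd
  have hu := h.unit σ hσ
  set G := A * N σ - (N σ ⬝ᵥ (A * N σ)) • N σ with hG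
  have hprod : ((A * Y σ) ⬝ᵥ (A * N σ)) * (G ⬝ᵥ G) = 0 := by
    rw [hG]
    simp only [dot3, Pi.mul_apply, Pi.add_apply, Pi.sub_apply, Pi.neg_apply, Pi.smul_apply,
      smul_eq_mul] at *
    linear_combination (1 / 2) * hd - (1 / 2) *
      (N σ 0 * (A 0 * N σ 0) + N σ 1 * (A 1 * N σ 1) + N σ 2 * (A 2 * N σ 2)) * hC +
      ((N σ 0 * (A 0 * N σ 0) + N σ 1 * (A 1 * N σ 1) + N σ 2 * (A 2 * N σ 2)) ^ 2 *
        (A 0 * Y σ 0 * (A 0 * N σ 0) + A 1 * Y σ 1 * (A 1 * N σ 1) +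
        A 2 * Y σ 2 * (A 2 * N σ 2))) * hu
  rcases mul_eq_zero.mp hprod with h0 | h0
  · right
    refine ⟨h0, ?_⟩
    rw [h0] at hC
    linarith
  · left
    have hG0 : G = 0 := by
      by_contra hne
      exact (dot3_self_pos hne).ne' h0
    apply h.dN_eq_zero hσ hk0
    rw [hNk]
    linear_combination (exp := 1) -hG0

/-- A minimal surface which is tangent to the linear field `A x`, where some non-zero diagonal
entry of `A` differs from the others, is flat. -/
theorem flat_of_force (h : Surf U Y N) (hf : ∀ σ ∈ U, N σ ⬝ᵥ (A * Y σ) = 0) {i : Fin 3}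
    (hi : A i ≠ 0) (hij : ∀ j, j ≠ i → A i ≠ A j) (hσ : σ ∈ U) : fderiv ℝ N σ = 0 := by
  by_contra hne
  have h1 := h.mono h.isOpen_nonflat (fun τ hτ => hτ.1)
  -- At non-flat points with A Y ≠ 0, the sums of A_jᵖ Y_j N_j vanish for p = 1, 2, 3. The
  -- combination used for each i isolates A_i ∏ (A_i − A_j) Y_i N_i; the other two entries may
  -- coincide, or vanish.
  have key : ∀ τ ∈ {σ ∈ U | fderiv ℝ N σ ≠ 0}, Y τ i * N τ i = 0 := by
    rintro τ ⟨hτ, hτ0⟩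
    by_cases hT : A * Y τ = 0
    · have := congrFun hT i
      simp only [Pi.mul_apply, Pi.zero_apply, mul_eq_zero, hi, false_or] at this
      rw [this, zero_mul]
    · have hV : IsOpen {τ ∈ U | A * Y τ ≠ 0} :=
        (ContinuousOn.mul continuousOn_const h.smooth.continuousOn).isOpen_inter_preimage h.isOpen
          isOpen_compl_singleton
      have h2 := h.mono hV (fun τ hτ => hτ.1)
      have h3 := h2.force_dichotomy (fun τ hτ => hf τ hτ.1) (fun τ hτ => hτ.2) ⟨hτ, hT⟩
      obtain ⟨h4, h5⟩ := h3.resolve_left hτ0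
      have h6 := hf τ hτ
      simp only [dot3, Pi.mul_apply] at h4 h5 h6
      fin_cases i
      · have a1 := sub_ne_zero.mpr (hij 1 (by decide))
        have a2 := sub_ne_zero.mpr (hij 2 (by decide))
        refine (mul_eq_zero.mp ?_).resolve_left (mul_ne_zero hi (mul_ne_zero a1 a2))
        simp only [Fin.zero_eta, Fin.isValue]
        linear_combination h5 - (A 1 + A 2) * h4 + A 1 * A 2 * h6
      · have a1 := sub_ne_zero.mpr (hij 0 (by decide))
        have a2 := sub_ne_zero.mpr (hij 2 (by decide))
        refine (mul_eq_zero.mp ?_).resolve_left (mul_ne_zero hi (mul_ne_zero a1 a2))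
        simp only [Fin.mk_one, Fin.isValue]
        linear_combination h5 - (A 0 + A 2) * h4 + A 0 * A 2 * h6
      · have a1 := sub_ne_zero.mpr (hij 0 (by decide))
        have a2 := sub_ne_zero.mpr (hij 1 (by decide))
        refine (mul_eq_zero.mp ?_).resolve_left (mul_ne_zero hi (mul_ne_zero a1 a2))
        simp only [Fin.reduceFinMk, Fin.isValue]
        linear_combination h5 - (A 0 + A 1) * h4 + A 0 * A 1 * h6
  -- Either e_i is tangent on the whole non-flat set, or the coordinate Y_i vanishes on an open part
  -- of it; both make that part flat.
  by_cases hN : ∀ τ ∈ {σ ∈ U | fderiv ℝ N σ ≠ 0}, N τ i = 0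
  · exact hne (h1.dN_eq_zero_of_const (c := Pi.single i 1) (by simp)
      (fun τ hτ => by simpa using hN τ hτ) ⟨hσ, hne⟩)
  · push Not at hN
    obtain ⟨τ, hτ, hτN⟩ := hN
    have h2 := h1.mono (h1.isOpen_ne (h1.contN i).continuousOn 0) (fun τ hτ => hτ.1)
    refine hτ.2 (h2.dN_eq_zero_of_coord (i := i) (c := 0) (fun ρ hρ => ?_) ⟨hτ, hτN⟩)
    exact (mul_eq_zero.mp (key ρ hρ.1)).resolve_right hρ.2

/-- A minimal cone is flat. -/
theorem flat_of_cone (h : Surf U Y N) (hf : ∀ σ ∈ U, N σ ⬝ᵥ Y σ = 0) (hσ : σ ∈ U) :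
    fderiv ℝ N σ = 0 := by
  by_contra hne
  have h1 := h.mono h.isOpen_nonflat (fun τ hτ => hτ.1)
  -- Away from the vertex the position vector lies in the kernel of the shape operator, so at
  -- non-flat points Y = 0. One coordinate suffices for the contradiction.
  refine hne (h1.dN_eq_zero_of_coord (i := 0) (c := 0) ?_ ⟨hσ, hne⟩)
  rintro τ ⟨hτ, hτ0⟩
  by_contra hY
  obtain ⟨k, hk⟩ := h.exists_tangent hτ (hf τ hτ)
  have hk0 : k ≠ 0 := by
    rintro rfl
    apply hY
    rw [← hk, map_zero]
    rfl
  apply hτ0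
  apply h.dN_eq_zero hτ hk0
  have := h.dN_force (A := 1) (fun τ hτ => by rw [one_mul]; exact hf τ hτ) hτ
    (by rw [one_mul]; exact hk)
  rw [this, one_mul, h.unit τ hτ, one_smul, neg_add_cancel]

end Static

end Surf

end Blackfold

/-! ### Minimal surfaces tangent to the horizontal radial field. -/

namespace Blackfold

open Matrix

namespace Surf

variable {U : Set (Fin 2 → ℝ)} {Y N : (Fin 2 → ℝ) → Fin 3 → ℝ} {σ : Fin 2 → ℝ}

/-- A continuous function on an immersed surface that vanishes off the `x_3`-axis vanishes. -/
theorem eq_zero_of_off_axis (h : Surf U Y N) {G : (Fin 2 → ℝ) → ℝ} (hG : ContinuousOn G U)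
    (h0 : ∀ σ ∈ U, Y σ 0 ^ 2 + Y σ 1 ^ 2 ≠ 0 → G σ = 0) (hσ : σ ∈ U) : G σ = 0 := by
  by_contra hne
  have h1 := h.mono (h.isOpen_ne hG 0) (fun τ hτ => hτ.1)
  have hax : ∀ τ ∈ {σ ∈ U | G σ ≠ 0}, Y τ 0 ^ 2 + Y τ 1 ^ 2 = 0 := by
    intro τ hτ
    by_contra hY
    exact hτ.2 (h0 τ hτ.1 hY)
  -- If an open piece were mapped into the axis, its differential would take values in a line.
  have hc : ∀ k, fderiv ℝ Y σ k ⨯₃ (Pi.single 2 1 : Fin 3 → ℝ) = 0 := by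
    intro k
    have e0 := lineDeriv_eq_zero h1.isOpen (F := fun σ => Y σ 0)
      (fun τ hτ => by nlinarith [hax τ hτ, sq_nonneg (Y τ 0), sq_nonneg (Y τ 1)]) ⟨hσ, hne⟩
      (h.lineY hσ k 0)
    have e1 := lineDeriv_eq_zero h1.isOpen (F := fun σ => Y σ 1)
      (fun τ hτ => by nlinarith [hax τ hτ, sq_nonneg (Y τ 0), sq_nonneg (Y τ 1)]) ⟨hσ, hne⟩
      (h.lineY hσ k 1)
    ext i
    fin_cases i
    · simpa [cross_apply] using e1
    · simpa [cross_apply] using e0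
    · simp [cross_apply]
  have := congrFun (h.not_line hσ hc) 2
  simp at this

section Radial

/-- The shape operator of a minimal surface tangent to the horizontal radial field. -/
theorem dN_radial (h : Surf U Y N) (hr : ∀ σ ∈ U, N σ 0 * Y σ 0 + N σ 1 * Y σ 1 = 0)
    (hσ : σ ∈ U) (hY : Y σ 0 ^ 2 + Y σ 1 ^ 2 ≠ 0) (k : Fin 2 → ℝ) :
    (Y σ 0 ^ 2 + Y σ 1 ^ 2) * fderiv ℝ N σ k 0 =
      -((N σ 0 * fderiv ℝ Y σ k 0 + N σ 1 * fderiv ℝ Y σ k 1) * Y σ 0)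
      - (Y σ 0 * fderiv ℝ Y σ k 0 + Y σ 1 * fderiv ℝ Y σ k 1) * (N σ 0 * N σ 2 ^ 2) ∧
    (Y σ 0 ^ 2 + Y σ 1 ^ 2) * fderiv ℝ N σ k 1 =
      -((N σ 0 * fderiv ℝ Y σ k 0 + N σ 1 * fderiv ℝ Y σ k 1) * Y σ 1)
      - (Y σ 0 * fderiv ℝ Y σ k 0 + Y σ 1 * fderiv ℝ Y σ k 1) * (N σ 1 * N σ 2 ^ 2) ∧
    (Y σ 0 ^ 2 + Y σ 1 ^ 2) * fderiv ℝ N σ k 2 =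
      (Y σ 0 * fderiv ℝ Y σ k 0 + Y σ 1 * fderiv ℝ Y σ k 1) * ((1 - N σ 2 ^ 2) * N σ 2) := by
  -- For the diagonal matrix (1, 1, 0) the linear field is the horizontal position, and `dN_formula`
  -- applies.
  have hf : ∀ σ ∈ U, N σ ⬝ᵥ (![1, 1, 0] * Y σ) = 0 := by
    intro τ hτ
    rw [dot3]
    simpa using hr τ hτ
  have hT : (![1, 1, 0] : Fin 3 → ℝ) * Y σ ≠ 0 := by
    intro h0
    have e0 := congrFun h0 0
    have e1 := congrFun h0 1
    simp at e0 e1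
    apply hY
    rw [e0, e1]
    simp
  have key := h.dN_formula hf hσ hT k
  have hu := h.unit σ hσ
  have hrσ := hr σ hσ
  have k0 := congrFun key 0
  have k1 := congrFun key 1
  have k2 := congrFun key 2
  simp [dot3] at k0 k1 k2
  rw [dot3] at hu
  refine ⟨?_, ?_, ?_⟩
  · linear_combination k0 + fderiv ℝ Y σ k 0 * hrσ +
      (Y σ 0 * fderiv ℝ Y σ k 0 + Y σ 1 * fderiv ℝ Y σ k 1) * N σ 0 * hu
  · linear_combination k1 + fderiv ℝ Y σ k 1 * hrσ +
      (Y σ 0 * fderiv ℝ Y σ k 0 + Y σ 1 * fderiv ℝ Y σ k 1) * N σ 1 * hu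
  · linear_combination k2 + fderiv ℝ Y σ k 2 * hrσ +
      (Y σ 0 * fderiv ℝ Y σ k 0 + Y σ 1 * fderiv ℝ Y σ k 1) * N σ 2 * hu

/-- The rotation rate of the rulings of a minimal surface that is tangent to the horizontal radial
field. -/
def twist (Y N : (Fin 2 → ℝ) → Fin 3 → ℝ) (σ : Fin 2 → ℝ) : ℝ :=
  -(fderiv ℝ Y σ (Pi.single 0 1) 2 * fderiv ℝ N σ (Pi.single 1 1) 2
    - fderiv ℝ Y σ (Pi.single 1 1) 2 * fderiv ℝ N σ (Pi.single 0 1) 2) /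
  (N σ ⬝ᵥ (fderiv ℝ Y σ (Pi.single 0 1) ⨯₃ fderiv ℝ Y σ (Pi.single 1 1)) * (1 - N σ 2 ^ 2) ^ 2)

theorem apply_eq_single {E : Type*} [NormedAddCommGroup E] [NormedSpace ℝ E]
    (L : (Fin 2 → ℝ) →L[ℝ] E) (k : Fin 2 → ℝ) :
    L k = k 0 • L (Pi.single 0 1) + k 1 • L (Pi.single 1 1) := by
  rw [← map_smul, ← map_smul, ← map_add]
  congr 1
  ext i
  fin_cases i <;> simp

/-- The area form scales by det(k, l), and on the orthogonal pair dY k, N × dY k its value is |dY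
k|². -/
theorem area_mul (h : Surf U Y N) (hσ : σ ∈ U) {k l : Fin 2 → ℝ}
    (hl : fderiv ℝ Y σ l = N σ ⨯₃ fderiv ℝ Y σ k) :
    (N σ ⬝ᵥ (fderiv ℝ Y σ (Pi.single 0 1) ⨯₃ fderiv ℝ Y σ (Pi.single 1 1))) *
      (k 0 * l 1 - k 1 * l 0) = fderiv ℝ Y σ k ⬝ᵥ fderiv ℝ Y σ k := by
  have e : N σ ⬝ᵥ (fderiv ℝ Y σ k ⨯₃ fderiv ℝ Y σ l) = fderiv ℝ Y σ k ⬝ᵥ fderiv ℝ Y σ k := by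
    have hu := h.unit σ hσ
    have hn := h.normal σ hσ k
    rw [hl]
    simp only [dot3, cross3_zero, cross3_one, cross3_two] at *
    generalize fderiv ℝ Y σ k = w at *
    linear_combination (w 0 * w 0 + w 1 * w 1 + w 2 * w 2) * hu
      - (N σ 0 * w 0 + N σ 1 * w 1 + N σ 2 * w 2) * hn
  rw [← e, apply_eq_single (fderiv ℝ Y σ) k, apply_eq_single (fderiv ℝ Y σ) l]
  simp only [dot3, cross3_zero, cross3_one, cross3_two, Pi.add_apply, Pi.smul_apply, smul_eq_mul]
  ring

theorem area_ne_zero (h : Surf U Y N) (hσ : σ ∈ U) :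
    N σ ⬝ᵥ (fderiv ℝ Y σ (Pi.single 0 1) ⨯₃ fderiv ℝ Y σ (Pi.single 1 1)) ≠ 0 := by
  have hk : (Pi.single 0 1 : Fin 2 → ℝ) ≠ 0 := by simp
  obtain ⟨l, hl⟩ := h.exists_tangent hσ (w := N σ ⨯₃ fderiv ℝ Y σ (Pi.single 0 1)) (by simp)
  intro h0
  have := h.area_mul hσ hl
  rw [h0, zero_mul] at this
  exact (dot3_self_pos (h.dY_ne_zero hσ hk)).ne this

/-- `twist` is defined as a ratio of 2-forms, built from dY ∧ dN in the third components and the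
area form, so that it is smooth across the axis. The closed form in `twist_eq` has a denominator
that vanishes there. -/
theorem contDiffOn_twist (h : Surf U Y N) (hN : ∀ σ ∈ U, N σ 2 ^ 2 ≠ 1) :
    ContDiffOn ℝ ∞ (twist Y N) U := by
  unfold twist
  simp only [dot3, cross3_zero, cross3_one, cross3_two]
  have a := fun i => h.contDY (Pi.single 0 1) i
  have b := fun i => h.contDY (Pi.single 1 1) i
  have c := fun i => h.contDN (Pi.single 0 1) i
  have d := fun i => h.contDN (Pi.single 1 1) i
  have m := fun i => h.contN i
  refine ContDiffOn.div ((((a 2).mul (d 2)).sub ((b 2).mul (c 2))).neg)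
    ((((m 0).mul (((a 1).mul (b 2)).sub ((a 2).mul (b 1)))).add
      ((m 1).mul (((a 2).mul (b 0)).sub ((a 0).mul (b 2))))).add
      ((m 2).mul (((a 0).mul (b 1)).sub ((a 1).mul (b 0)))) |>.mul
      ((contDiffOn_const.sub ((m 2).pow 2)).pow 2)) ?_
  intro σ hσ
  have := h.area_ne_zero hσ
  simp only [dot3, cross3_zero, cross3_one, cross3_two] at this
  exact mul_ne_zero this (pow_ne_zero 2 (sub_ne_zero.mpr (hN σ hσ).symm))

/-- Off the axis, the twist is determined by the normal. -/
theorem twist_eq (h : Surf U Y N) (hr : ∀ σ ∈ U, N σ 0 * Y σ 0 + N σ 1 * Y σ 1 = 0)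
    (hσ : σ ∈ U) (hY : Y σ 0 ^ 2 + Y σ 1 ^ 2 ≠ 0) (hN : N σ 2 ^ 2 ≠ 1) :
    N σ 1 * Y σ 0 - N σ 0 * Y σ 1 ≠ 0 ∧
      twist Y N σ = -(N σ 2 / (N σ 1 * Y σ 0 - N σ 0 * Y σ 1)) := by
  have hu := h.unit σ hσ
  have hrσ := hr σ hσ
  have hN' : 1 - N σ 2 ^ 2 ≠ 0 := sub_ne_zero.mpr hN.symm
  obtain ⟨k, hk⟩ := h.exists_tangent hσ (w := ![Y σ 0, Y σ 1, 0]) (by rw [dot3]; simpa using hrσ)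
  obtain ⟨l, hl⟩ := h.exists_tangent hσ (w := N σ ⨯₃ fderiv ℝ Y σ k) (by simp)
  have hW := h.area_mul hσ hl
  have hW0 := h.area_ne_zero hσ
  have dk := (h.dN_radial hr hσ hY k).2.2
  have dl := (h.dN_radial hr hσ hY l).2.2
  -- The 2-form is evaluated on the radial direction k and its rotation l; the factor det(k, l)
  -- cancels against the one in `area_mul`.
  have e1 : (fderiv ℝ Y σ (Pi.single 0 1) 2 * fderiv ℝ N σ (Pi.single 1 1) 2
    - fderiv ℝ Y σ (Pi.single 1 1) 2 * fderiv ℝ N σ (Pi.single 0 1) 2) *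
      (k 0 * l 1 - k 1 * l 0) = fderiv ℝ Y σ k 2 * fderiv ℝ N σ l 2
        - fderiv ℝ Y σ l 2 * fderiv ℝ N σ k 2 := by
    rw [apply_eq_single (fderiv ℝ Y σ) k, apply_eq_single (fderiv ℝ Y σ) l,
      apply_eq_single (fderiv ℝ N σ) k, apply_eq_single (fderiv ℝ N σ) l]
    simp only [Pi.add_apply, Pi.smul_apply, smul_eq_mul]
    ring
  have hl0 := congrFun hl 0
  have hl1 := congrFun hl 1
  have hl2 := congrFun hl 2
  rw [dot3] at hu
  rw [dot3 (fderiv ℝ Y σ k)] at hW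
  rw [cross3_zero] at hl0
  rw [cross3_one] at hl1
  rw [cross3_two] at hl2
  have hk0 : fderiv ℝ Y σ k 0 = Y σ 0 := by rw [hk]; simp
  have hk1 : fderiv ℝ Y σ k 1 = Y σ 1 := by rw [hk]; simp
  have hk2 : fderiv ℝ Y σ k 2 = 0 := by rw [hk]; simp
  rw [hl2, hk0, hk1, hk2] at e1
  rw [hk0, hk1] at dk
  rw [hk0, hk1, hk2] at hW
  have dk' : fderiv ℝ N σ k 2 = (1 - N σ 2 ^ 2) * N σ 2 := by
    apply mul_left_cancel₀ hY
    linear_combination dk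
  -- Lagrange's identity for the horizontal parts of N and Y, whose inner product is zero.
  have hsq : (N σ 1 * Y σ 0 - N σ 0 * Y σ 1) ^ 2 =
      (Y σ 0 ^ 2 + Y σ 1 ^ 2) * (1 - N σ 2 ^ 2) := by
    linear_combination (Y σ 0 ^ 2 + Y σ 1 ^ 2) * hu - (N σ 0 * Y σ 0 + N σ 1 * Y σ 1) * hrσ
  have ht : N σ 1 * Y σ 0 - N σ 0 * Y σ 1 ≠ 0 := by
    intro h0
    rw [h0] at hsq
    exact mul_ne_zero hY hN' (by linarith)
  refine ⟨ht, ?_⟩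
  have hD : k 0 * l 1 - k 1 * l 0 ≠ 0 := by
    intro h0
    rw [h0] at hW
    apply hY
    linear_combination -hW
  rw [twist, ← neg_div, div_eq_div_iff (mul_ne_zero hW0 (pow_ne_zero 2 hN')) ht]
  apply mul_left_cancel₀ hD
  rw [dk'] at e1
  linear_combination (-(N σ 1 * Y σ 0 - N σ 0 * Y σ 1)) * e1 + N σ 2 * (1 - N σ 2 ^ 2) ^ 2 * hW
    - N σ 2 * (1 - N σ 2 ^ 2) * hsq

/-- A minimal surface which is tangent to the horizontal radial field and nowhere horizontal has
constant twist. -/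
theorem twist_const (h : Surf U Y N) (hc : IsPreconnected U)
    (hr : ∀ σ ∈ U, N σ 0 * Y σ 0 + N σ 1 * Y σ 1 = 0) (hN : ∀ σ ∈ U, N σ 2 ^ 2 ≠ 1)
    {τ : Fin 2 → ℝ} (hσ : σ ∈ U) (hτ : τ ∈ U) : twist Y N σ = twist Y N τ := by
  have hsm := h.contDiffOn_twist hN
  have hdiff : DifferentiableOn ℝ (twist Y N) U := hsm.differentiableOn (by simp)
  refine const_of_lineDeriv h.isOpen hc hdiff (fun ρ hρ k => ?_) hσ hτ
  have hd : ∀ ρ ∈ U, HasLineDerivAt ℝ (twist Y N) (fderiv ℝ (twist Y N) ρ k) ρ k := fun ρ hρ =>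
    ((hdiff ρ hρ).differentiableAt (h.isOpen.mem_nhds hρ)).hasFDerivAt.hasLineDerivAt k
  suffices h0 : fderiv ℝ (twist Y N) ρ k = 0 by simpa [h0] using hd ρ hρ
  have hcont : ContinuousOn (fun ρ => fderiv ℝ (twist Y N) ρ k) U := fun ρ hρ =>
    (((hsm.contDiffAt (h.isOpen.mem_nhds hρ)).fderiv_right (m := ∞) le_rfl).continuousAt.clm_apply
      continuousAt_const).continuousWithinAt
  -- The derivative is continuous, so it is enough to kill it off the axis, where the closed form of
  -- `twist_eq` can be differentiated with `dN_radial`.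
  refine h.eq_zero_of_off_axis (G := fun ρ => fderiv ℝ (twist Y N) ρ k) hcont
    (fun ρ hρ hY => ?_) hρ
  have hV : IsOpen {σ ∈ U | Y σ 0 ^ 2 + Y σ 1 ^ 2 ≠ 0} :=
    h.isOpen_ne (((h.contY 0).continuousOn.pow 2).add ((h.contY 1).continuousOn.pow 2)) 0
  have ht := (h.twist_eq hr hρ hY (hN ρ hρ)).1
  have hYk := h.lineY hρ k
  have hNk := h.lineN hρ k
  have ht' : (fun t : ℝ => N (ρ + t • k) 1 * Y (ρ + t • k) 0 - N (ρ + t • k) 0 * Y (ρ + t • k) 1) 0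
      ≠ 0 := by simpa using ht
  have hz := lineDeriv_eq_zero hV
    (F := fun ρ => twist Y N ρ + N ρ 2 / (N ρ 1 * Y ρ 0 - N ρ 0 * Y ρ 1))
    (fun τ hτ => by rw [(h.twist_eq hr hτ.1 hτ.2 (hN τ hτ.1)).2, neg_add_cancel]) ⟨hρ, hY⟩
    (HasDerivAt.add (hd ρ hρ) ((hNk 2).div (((hNk 1).mul (hYk 0)).sub ((hNk 0).mul (hYk 1))) ht'))
  simp only [zero_smul, add_zero] at hz
  suffices hq : fderiv ℝ N ρ k 2 * (N ρ 1 * Y ρ 0 - N ρ 0 * Y ρ 1) -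
      N ρ 2 * (fderiv ℝ N ρ k 1 * Y ρ 0 + N ρ 1 * fderiv ℝ Y ρ k 0 -
        (fderiv ℝ N ρ k 0 * Y ρ 1 + N ρ 0 * fderiv ℝ Y ρ k 1)) = 0 by
    rw [hq, zero_div, add_zero] at hz
    exact hz
  obtain ⟨d0, d1, d2⟩ := h.dN_radial hr hρ hY k
  have hu := h.unit ρ hρ
  have hrρ := hr ρ hρ
  rw [dot3] at hu
  apply mul_left_cancel₀ hY
  rw [mul_zero]
  linear_combination (N ρ 1 * Y ρ 0 - N ρ 0 * Y ρ 1) * d2 - N ρ 2 * Y ρ 0 * d1 + N ρ 2 * Y ρ 1 * d0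
    + N ρ 2 * (Y ρ 0 * fderiv ℝ Y ρ k 1 - Y ρ 1 * fderiv ℝ Y ρ k 0) * hrρ

/-- The first-order characterisation of the helicoids with axis `x_3` and twist `ε`. -/
theorem twist_relation (h : Surf U Y N) (hr : ∀ σ ∈ U, N σ 0 * Y σ 0 + N σ 1 * Y σ 1 = 0)
    (hN : ∀ σ ∈ U, N σ 2 ^ 2 ≠ 1) {ε : ℝ} (hε : ∀ σ ∈ U, twist Y N σ = ε) (hσ : σ ∈ U) :
    N σ 2 + ε * (N σ 1 * Y σ 0 - N σ 0 * Y σ 1) = 0 := by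
  refine h.eq_zero_of_off_axis (G := fun σ => N σ 2 + ε * (N σ 1 * Y σ 0 - N σ 0 * Y σ 1))
    ?_ (fun σ hσ hY => ?_) hσ
  · exact ((h.contN 2).add (contDiffOn_const.mul
      (((h.contN 1).mul (h.contY 0)).sub ((h.contN 0).mul (h.contY 1))))).continuousOn
  · obtain ⟨ht, he⟩ := h.twist_eq hr hσ hY (hN σ hσ)
    rw [hε σ hσ] at he
    rw [he]
    field_simp
    ring

/-- In particular the horizontal part of the normal never vanishes, so its direction is defined
everywhere, also on the axis. -/
theorem horizontal_norm (h : Surf U Y N) (hr : ∀ σ ∈ U, N σ 0 * Y σ 0 + N σ 1 * Y σ 1 = 0)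
    {ε : ℝ} (hε : ∀ σ ∈ U, N σ 2 + ε * (N σ 1 * Y σ 0 - N σ 0 * Y σ 1) = 0) (hσ : σ ∈ U) :
    (N σ 0 ^ 2 + N σ 1 ^ 2) * (1 + ε ^ 2 * (Y σ 0 ^ 2 + Y σ 1 ^ 2)) = 1 := by
  have hu := h.unit σ hσ
  have hrσ := hr σ hσ
  have e := hε σ hσ
  rw [dot3] at hu
  linear_combination hu - (N σ 2 - ε * (N σ 1 * Y σ 0 - N σ 0 * Y σ 1)) * e +
    ε ^ 2 * (N σ 0 * Y σ 0 + N σ 1 * Y σ 1) * hrσ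

/-- The horizontal part of the normal rotates at the rate `ε` along the axis. -/
theorem normal_rotation (h : Surf U Y N) (hr : ∀ σ ∈ U, N σ 0 * Y σ 0 + N σ 1 * Y σ 1 = 0)
    {ε : ℝ} (hε : ∀ σ ∈ U, N σ 2 + ε * (N σ 1 * Y σ 0 - N σ 0 * Y σ 1) = 0) (hσ : σ ∈ U)
    (k : Fin 2 → ℝ) :
    N σ 0 * fderiv ℝ N σ k 1 - N σ 1 * fderiv ℝ N σ k 0 -
      ε * (N σ 0 ^ 2 + N σ 1 ^ 2) * fderiv ℝ Y σ k 2 = 0 := by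
  refine h.eq_zero_of_off_axis (G := fun σ => N σ 0 * fderiv ℝ N σ k 1 -
    N σ 1 * fderiv ℝ N σ k 0 - ε * (N σ 0 ^ 2 + N σ 1 ^ 2) * fderiv ℝ Y σ k 2)
    ?_ (fun σ hσ hY => ?_) hσ
  · exact ((((h.contN 0).mul (h.contDN k 1)).sub ((h.contN 1).mul (h.contDN k 0))).sub
      ((contDiffOn_const.mul (((h.contN 0).pow 2).add ((h.contN 1).pow 2))).mul
        (h.contDY k 2))).continuousOn
  · obtain ⟨d0, d1, d2⟩ := h.dN_radial hr hσ hY k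
    have hu := h.unit σ hσ
    have hrσ := hr σ hσ
    have hn := h.normal σ hσ k
    have e := hε σ hσ
    rw [dot3] at hu hn
    apply mul_left_cancel₀ hY
    rw [mul_zero]
    linear_combination N σ 0 * d1 - N σ 1 * d0 + (N σ 1 * Y σ 0 - N σ 0 * Y σ 1) * hn -
      (N σ 1 * Y σ 0 - N σ 0 * Y σ 1) * fderiv ℝ Y σ k 2 * e -
      ε * fderiv ℝ Y σ k 2 * (N σ 0 * Y σ 0 + N σ 1 * Y σ 1) * hrσ

/-- The direction of the horizontal part of the normal, in the frame rotating at the rate `ε` along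
the axis, is constant. -/
theorem frame_const (h : Surf U Y N) (hc : IsPreconnected U)
    (hr : ∀ σ ∈ U, N σ 0 * Y σ 0 + N σ 1 * Y σ 1 = 0)
    {ε : ℝ} (hε : ∀ σ ∈ U, N σ 2 + ε * (N σ 1 * Y σ 0 - N σ 0 * Y σ 1) = 0) {a b : ℝ}
    {τ : Fin 2 → ℝ} (hσ : σ ∈ U) (hτ : τ ∈ U)
    (h0 : a * (N σ 0 * Real.cos (ε * Y σ 2) + N σ 1 * Real.sin (ε * Y σ 2)) +
      b * (N σ 1 * Real.cos (ε * Y σ 2) - N σ 0 * Real.sin (ε * Y σ 2)) = 0) :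
    a * (N τ 0 * Real.cos (ε * Y τ 2) + N τ 1 * Real.sin (ε * Y τ 2)) +
      b * (N τ 1 * Real.cos (ε * Y τ 2) - N τ 0 * Real.sin (ε * Y τ 2)) = 0 := by
  have hpos : ∀ σ ∈ U, N σ 0 ^ 2 + N σ 1 ^ 2 ≠ 0 := by
    intro σ hσ h0
    have := h.horizontal_norm hr hε hσ
    rw [h0] at this
    simp at this
  -- Only the direction of the horizontal normal is constant in the turning frame, not its length.
  -- Hence the quotient; squaring avoids a square root in the denominator.
  set F : (Fin 2 → ℝ) → ℝ := fun σ =>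
    (a * (N σ 0 * Real.cos (ε * Y σ 2) + N σ 1 * Real.sin (ε * Y σ 2)) +
      b * (N σ 1 * Real.cos (ε * Y σ 2) - N σ 0 * Real.sin (ε * Y σ 2))) ^ 2 /
      (N σ 0 ^ 2 + N σ 1 ^ 2) with hF
  have hsm : ContDiffOn ℝ ∞ F U := by
    have c1 := (contDiffOn_const (c := ε)).mul (h.contY 2) |>.cos
    have c2 := (contDiffOn_const (c := ε)).mul (h.contY 2) |>.sin
    have m := fun i => h.contN i
    exact ContDiffOn.div (((contDiffOn_const.mul (((m 0).mul c1).add ((m 1).mul c2))).add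
      (contDiffOn_const.mul (((m 1).mul c1).sub ((m 0).mul c2)))).pow 2)
      (((m 0).pow 2).add ((m 1).pow 2)) hpos
  have key : F σ = F τ := by
    refine const_of_lineDeriv h.isOpen hc (hsm.differentiableOn (by simp)) (fun ρ hρ k => ?_) hσ hτ
    have hY := ((h.lineY hρ k 2).const_mul ε)
    have m := h.lineN hρ k
    have c1 := hY.cos
    have c2 := hY.sin
    have hp : (fun t : ℝ => N (ρ + t • k) 0 ^ 2 + N (ρ + t • k) 1 ^ 2) 0 ≠ 0 := by
      simpa using hpos ρ hρ
    refine ((((((m 0).mul c1).add ((m 1).mul c2)).const_mul a).add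
      ((((m 1).mul c1).sub ((m 0).mul c2)).const_mul b)).pow 2 |>.div
      (((m 0).pow 2).add ((m 1).pow 2)) hp).congr_deriv ?_
    have hω := h.normal_rotation hr hε hρ k
    simp only [Pi.add_apply, Pi.mul_apply, Pi.sub_apply, Pi.pow_apply, zero_smul, add_zero] at *
    rw [div_eq_zero_iff]
    left
    norm_num
    generalize Real.cos (ε * Y ρ 2) = c at *
    generalize Real.sin (ε * Y ρ 2) = s at *
    linear_combination 2 * (a * (N ρ 0 * c + N ρ 1 * s) + b * (N ρ 1 * c - N ρ 0 * s)) *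
      (b * (N ρ 0 * c + N ρ 1 * s) - a * (N ρ 1 * c - N ρ 0 * s)) * hω
  have hσ0 : F σ = 0 := by
    simp only [hF, h0]
    simp
  rw [hσ0, eq_comm, hF] at key
  simp only [div_eq_zero_iff, hpos τ hτ, or_false] at key
  exact pow_eq_zero_iff (two_ne_zero) |>.mp key

end Radial

end Surf

end Blackfold

/-! ### Rotating minimal surfaces and catenoids. -/

namespace Blackfold

open Matrix

/-- A catenary profile is not compatible with the force balance of a rotating surface in a wave
that acts along the axis. -/
theorem catenary_false {m la mu be C z : ℝ} (hm : m + 1 ≠ 0) (hmu : mu ≠ 0) (hC : C ≠ 0)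
    {s : ℝ → ℝ} {d : ℝ} (hs : HasDerivAt s d 0) (hd : d ≠ 0)
    (hrel : ∀ᶠ t in nhds (0 : ℝ),
      (la * ((m + 1) * (1 + la * (C * Real.cosh (s t)) ^ 2 + mu * (z + C * s t) ^ 2) -
          be ^ 2 * (C * Real.cosh (s t)) ^ 2)
        - m * be ^ 2 * (1 + la * (C * Real.cosh (s t)) ^ 2 + mu * (z + C * s t) ^ 2)) *
          (C * Real.cosh (s t))
      = Real.sinh (s t) * ((m + 1) * (1 + la * (C * Real.cosh (s t)) ^ 2 + mu * (z + C * s t) ^ 2) -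
          be ^ 2 * (C * Real.cosh (s t)) ^ 2) * (mu * (z + C * s t))) : False := by
  -- The relation extends to an entire function of the catenary parameter.
  set H : ℂ → ℂ := fun w =>
    (la * ((m + 1) * (1 + la * (C * Complex.cosh w) ^ 2 + mu * (z + C * w) ^ 2) -
          be ^ 2 * (C * Complex.cosh w) ^ 2)
        - m * be ^ 2 * (1 + la * (C * Complex.cosh w) ^ 2 + mu * (z + C * w) ^ 2)) *
          (C * Complex.cosh w)
      - Complex.sinh w * ((m + 1) * (1 + la * (C * Complex.cosh w) ^ 2 + mu * (z + C * w) ^ 2) -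
          be ^ 2 * (C * Complex.cosh w) ^ 2) * (mu * (z + C * w)) with hH
  have hdiff : Differentiable ℂ H := by
    have := Complex.differentiable_cosh
    have := Complex.differentiable_sinh
    rw [hH]
    fun_prop
  have han : AnalyticOnNhd ℂ H Set.univ := hdiff.differentiableOn.analyticOnNhd isOpen_univ
  have hz : ∀ᶠ t in nhds (0 : ℝ), H (s t) = 0 := by
    filter_upwards [hrel] with t ht
    have := congrArg (fun x : ℝ => (x : ℂ)) ht
    simp only [hH]
    rw [sub_eq_zero]
    push_cast at this
    exact this
  have hsC : HasDerivAt (fun t : ℝ => (s t : ℂ)) (d : ℂ) 0 := hs.ofReal_comp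
  -- As s has non-zero derivative at 0, its values accumulate at s 0 without being equal to it,
  -- which is what the identity theorem requires.
  have hne := hsC.tendsto_nhdsNE (by exact_mod_cast hd)
  have hfr : ∃ᶠ w in nhdsWithin (s 0 : ℂ) {(s 0 : ℂ)}ᶜ, H w = 0 :=
    hne.frequently (hz.filter_mono nhdsWithin_le_nhds).frequently
  have hall := han.eqOn_zero_of_preconnected_of_frequently_eq_zero isPreconnected_univ
    (Set.mem_univ _) hfr
  -- At the zeros iπ(k + 1/2) of cosh only sinh · (m + 1)(1 + μζ²) · μζ survives, with ζ = z + C w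
  -- non-real. Hence 1 + μζ² = 0, whose real part is recorded here.
  have key : ∀ k : ℕ, 1 + mu * (z ^ 2 - (C * (Real.pi * (k + 1 / 2))) ^ 2) = 0 := by
    intro k
    have hcosh : Complex.cosh ((Real.pi * (k + 1 / 2) : ℝ) * Complex.I) = 0 := by
      rw [Complex.cosh_mul_I, ← Complex.ofReal_cos]
      rw [Complex.ofReal_eq_zero, Real.cos_eq_zero_iff]
      exact ⟨k, by push_cast; ring⟩
    have hsinh : Complex.sinh ((Real.pi * (k + 1 / 2) : ℝ) * Complex.I) ≠ 0 := by
      intro h0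
      have := Complex.cosh_sq_sub_sinh_sq ((Real.pi * (k + 1 / 2) : ℝ) * Complex.I)
      rw [hcosh, h0] at this
      norm_num at this
    have h0 := hall (Set.mem_univ ((Real.pi * (k + 1 / 2) : ℝ) * Complex.I))
    simp only [hH, hcosh, Pi.zero_apply] at h0
    have hzz : (z : ℂ) + C * ((Real.pi * (k + 1 / 2) : ℝ) * Complex.I) ≠ 0 := by
      intro h1
      have := congrArg Complex.im h1
      simp [Complex.add_im, Complex.mul_im] at this
      rcases this with h | h
      · exact hC h
      · have : (0 : ℝ) ≤ k := Nat.cast_nonneg k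
        linarith
    have hm' : (m : ℂ) + 1 ≠ 0 := by exact_mod_cast hm
    have hmu' : (mu : ℂ) ≠ 0 := by exact_mod_cast hmu
    have h1 : (1 : ℂ) + mu * (z + C * ((Real.pi * (k + 1 / 2) : ℝ) * Complex.I)) ^ 2 = 0 := by
      have h2 : Complex.sinh ((Real.pi * (k + 1 / 2) : ℝ) * Complex.I) *
        (((m : ℂ) + 1) * ((mu : ℂ) * ((z : ℂ) + C * ((Real.pi * (k + 1 / 2) : ℝ) * Complex.I)))) *
        ((1 : ℂ) + mu * (z + C * ((Real.pi * (k + 1 / 2) : ℝ) * Complex.I)) ^ 2) = 0 := by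
        linear_combination -h0
      exact (mul_eq_zero.mp h2).resolve_left
        (mul_ne_zero hsinh (mul_ne_zero hm' (mul_ne_zero hmu' hzz)))
    have h2 := congrArg Complex.re h1
    have h3 : (1 : ℂ) + mu * (z + C * ((Real.pi * (k + 1 / 2) : ℝ) * Complex.I)) ^ 2 =
        ((1 + mu * (z ^ 2 - (C * (Real.pi * (k + 1 / 2))) ^ 2) : ℝ) : ℂ) +
        ((2 * mu * z * C * (Real.pi * (k + 1 / 2)) : ℝ) : ℂ) * Complex.I := by
      push_cast
      linear_combination (mu * (C * (Real.pi * (k + 1 / 2))) ^ 2 : ℂ) * Complex.I_sq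
    rw [h3, Complex.add_re, Complex.re_ofReal_mul, Complex.ofReal_re] at h2
    simpa using h2
  -- Two values of k already disagree: their difference is 2μC²π².
  have k0 := key 0
  have k1 := key 1
  push_cast at k0 k1
  have hp := mul_ne_zero (mul_ne_zero hmu (pow_ne_zero 2 hC)) (pow_ne_zero 2 Real.pi_ne_zero)
  apply hp
  linear_combination (k0 - k1) / 2

namespace Surf

variable {U : Set (Fin 2 → ℝ)} {Y N : (Fin 2 → ℝ) → Fin 3 → ℝ} {σ : Fin 2 → ℝ}

/-- The squared horizontal distance of an immersed minimal surface from the axis is not constant,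
unless the normal is orthogonal to the radial direction. -/
theorem not_cylinder (h : Surf U Y N) {r : ℝ} (hr : ∀ σ ∈ U, Y σ 0 ^ 2 + Y σ 1 ^ 2 = r)
    (hg : ∀ σ ∈ U, N σ 0 * Y σ 0 + N σ 1 * Y σ 1 ≠ 0) (hσ : σ ∈ U) : False := by
  have hd : ∀ σ ∈ U, ∀ k, Y σ 0 * fderiv ℝ Y σ k 0 + Y σ 1 * fderiv ℝ Y σ k 1 = 0 := by
    intro σ hσ k
    have := lineDeriv_eq_zero h.isOpen (F := fun σ => Y σ 0 * Y σ 0 + Y σ 1 * Y σ 1 - r)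
      (fun τ hτ => by linear_combination hr τ hτ) hσ
      ((((h.lineY hσ k 0).mul (h.lineY hσ k 0)).add
        ((h.lineY hσ k 1).mul (h.lineY hσ k 1))).sub_const r)
    simp at this
    linarith
  -- On a cylinder about the axis the horizontal position is orthogonal to all tangent vectors,
  -- hence a multiple of N. So N is horizontal and the axis direction is tangent.
  have hy : ∀ σ ∈ U, ![Y σ 0, Y σ 1, 0] - (N σ 0 * Y σ 0 + N σ 1 * Y σ 1) • N σ = 0 := by
    intro σ hσ
    apply h.ext_tangent hσ
    · rw [dotProduct_sub, dotProduct_smul, h.unit σ hσ, dot3]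
      simp
    · intro k
      rw [sub_dotProduct, smul_dotProduct, h.normal σ hσ, dot3]
      simpa using hd σ hσ k
  have hN2 : ∀ σ ∈ U, N σ 2 = 0 := by
    intro σ hσ
    have := congrFun (hy σ hσ) 2
    simpa [hg σ hσ] using this
  have hflat : fderiv ℝ N σ = 0 :=
    h.dN_eq_zero_of_const (c := Pi.single 2 1) (by simp) (fun τ hτ => by simpa using hN2 τ hτ) hσ
  -- With N locally constant, the horizontal position, being its own projection to N, has zero
  -- derivative; only vertical tangent vectors would be left.
  have hc : ∀ k, fderiv ℝ Y σ k ⨯₃ (Pi.single 2 1 : Fin 3 → ℝ) = 0 := by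
    intro k
    have hY := h.lineY hσ k
    have hN := h.lineN hσ k
    have hn := h.normal σ hσ k
    rw [dot3, hN2 σ hσ] at hn
    have e : ∀ i : Fin 3, (∀ σ ∈ U, Y σ i - (N σ 0 * Y σ 0 + N σ 1 * Y σ 1) * N σ i = 0) →
        fderiv ℝ Y σ k i = 0 := by
      intro i hi
      have := lineDeriv_eq_zero h.isOpen
        (F := fun σ => Y σ i - (N σ 0 * Y σ 0 + N σ 1 * Y σ 1) * N σ i) hi hσ
        ((hY i).sub ((((hN 0).mul (hY 0)).add ((hN 1).mul (hY 1))).mul (hN i)))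
      simp only [zero_smul, add_zero, hflat, _root_.zero_apply, Pi.zero_apply] at this
      linear_combination this + N σ i * hn
    have e0 := e 0 (fun σ hσ => by simpa using congrFun (hy σ hσ) 0)
    have e1 := e 1 (fun σ hσ => by simpa using congrFun (hy σ hσ) 1)
    ext i
    fin_cases i
    · simpa [cross_apply] using e1
    · simpa [cross_apply] using e0
    · simp [cross_apply]
  have := congrFun (h.not_line hσ hc) 2
  simp at this

section Rotating

variable {m la mu be al : ℝ}

/-- A rotating or screwing minimal surface in a wave that does not act along the axis is tangent to
the horizontal radial field. -/
theorem radial_of_screw (h : Surf U Y N) (hm : 0 < m) (hbe : be ≠ 0)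
    (hk : ∀ σ ∈ U, 0 < 1 + la * (Y σ 0 ^ 2 + Y σ 1 ^ 2) - al ^ 2 - be ^ 2 * (Y σ 0 ^ 2 + Y σ 1 ^ 2))
    (hf : ∀ σ ∈ U, ((1 + (1 + la * (Y σ 0 ^ 2 + Y σ 1 ^ 2) - al ^ 2 -
      be ^ 2 * (Y σ 0 ^ 2 + Y σ 1 ^ 2)) / (m * (1 + la * (Y σ 0 ^ 2 + Y σ 1 ^ 2)))) * la - be ^ 2) *
      (N σ 0 * Y σ 0 + N σ 1 * Y σ 1) = 0) (hσ : σ ∈ U) : N σ 0 * Y σ 0 + N σ 1 * Y σ 1 = 0 := by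
  by_contra hne
  have h1 := h.mono (h.isOpen_ne (((h.contN 0).mul (h.contY 0)).add
    ((h.contN 1).mul (h.contY 1))).continuousOn 0) (fun τ hτ => hτ.1)
  -- Where the radial component of N is non-zero the scalar factor must vanish. Cleared of
  -- denominators this is affine in the squared distance from the axis.
  have key : ∀ τ ∈ {σ ∈ U | N σ 0 * Y σ 0 + N σ 1 * Y σ 1 ≠ 0},
      la * (m + 1) * (la - be ^ 2) * (Y τ 0 ^ 2 + Y τ 1 ^ 2) +
        (m * (la - be ^ 2) + la * (1 - al ^ 2)) = 0 := by
    rintro τ ⟨hτ, hτ0⟩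
    have e := (mul_eq_zero.mp (hf τ hτ)).resolve_right hτ0
    have hp := hk τ hτ
    have hq : 1 + la * (Y τ 0 ^ 2 + Y τ 1 ^ 2) ≠ 0 := by
      have : 0 ≤ be ^ 2 * (Y τ 0 ^ 2 + Y τ 1 ^ 2) := by positivity
      nlinarith [sq_nonneg al]
    field_simp at e
    linear_combination e
  -- If the slope vanishes, λ = 0 contradicts β ≠ 0, and λ = β² forces α² = 1 and so 𝐤² = 0.
  -- Otherwise the distance is constant and the piece lies in a cylinder.
  by_cases hc : la * (m + 1) * (la - be ^ 2) = 0
  · have e := key σ ⟨hσ, hne⟩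
    rw [hc, zero_mul, zero_add] at e
    have hm1 : m + 1 ≠ 0 := by positivity
    rcases mul_eq_zero.mp hc with h0 | h0
    · have hla := (mul_eq_zero.mp h0).resolve_right hm1
      rw [hla] at e
      have : m * be ^ 2 = 0 := by linear_combination -e
      exact mul_ne_zero hm.ne' (pow_ne_zero 2 hbe) this
    · have hp := hk σ hσ
      rw [h0, mul_zero, zero_add] at e
      have hla : la ≠ 0 := by
        rw [sub_eq_zero.mp h0]
        exact pow_ne_zero 2 hbe
      have hal := (mul_eq_zero.mp e).resolve_left hla
      have : 1 + la * (Y σ 0 ^ 2 + Y σ 1 ^ 2) - al ^ 2 - be ^ 2 * (Y σ 0 ^ 2 + Y σ 1 ^ 2) = 0 := by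
        linear_combination hal + (Y σ 0 ^ 2 + Y σ 1 ^ 2) * h0
      linarith
  · refine h1.not_cylinder
      (r := -(m * (la - be ^ 2) + la * (1 - al ^ 2)) / (la * (m + 1) * (la - be ^ 2)))
      (fun τ hτ => ?_) (fun τ hτ => hτ.2) ⟨hσ, hne⟩
    rw [eq_div_iff hc]
    linear_combination key τ hτ

/-- A surface which is tangent both to the horizontal radial field and to the rotation field is
horizontal. -/
theorem horizontal_of_radial_rotation (h : Surf U Y N)
    (hr : ∀ σ ∈ U, N σ 0 * Y σ 0 + N σ 1 * Y σ 1 = 0)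
    (ht : ∀ σ ∈ U, N σ 1 * Y σ 0 - N σ 0 * Y σ 1 = 0) (hσ : σ ∈ U) : N σ 0 = 0 ∧ N σ 1 = 0 := by
  constructor
  · refine h.eq_zero_of_off_axis (h.contN 0).continuousOn (fun τ hτ hY => ?_) hσ
    apply mul_left_cancel₀ hY
    linear_combination Y τ 0 * hr τ hτ - Y τ 1 * ht τ hτ
  · refine h.eq_zero_of_off_axis (h.contN 1).continuousOn (fun τ hτ hY => ?_) hσ
    apply mul_left_cancel₀ hY
    linear_combination Y τ 1 * hr τ hτ + Y τ 0 * ht τ hτ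

/-- The shape operator of a minimal surface of revolution. -/
theorem dN_rotation (h : Surf U Y N) (ht : ∀ σ ∈ U, N σ 1 * Y σ 0 - N σ 0 * Y σ 1 = 0)
    (hσ : σ ∈ U) (k : Fin 2 → ℝ) :
    (Y σ 0 ^ 2 + Y σ 1 ^ 2) ^ 2 • fderiv ℝ N σ k = (N σ 0 * Y σ 0 + N σ 1 * Y σ 1) •
      ((2 * (Y σ 0 * fderiv ℝ Y σ k 1 - Y σ 1 * fderiv ℝ Y σ k 0)) • ![-Y σ 1, Y σ 0, 0]
        - (Y σ 0 ^ 2 + Y σ 1 ^ 2) • fderiv ℝ Y σ k) := by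
  have hu := h.unit σ hσ
  have htσ := ht σ hσ
  have hv : N σ ⬝ᵥ ![-Y σ 1, Y σ 0, 0] = 0 := by
    rw [dot3]
    simp
    linear_combination htσ
  obtain ⟨kv, hkv⟩ := h.exists_tangent hσ hv
  obtain ⟨kJ, hkJ⟩ := h.exists_tangent hσ (w := N σ ⨯₃ fderiv ℝ Y σ kv) (by simp)
  -- Differentiating the tangency of the rotation field shows that, along it, N is rotated as well.
  have e1 : fderiv ℝ N σ kv - ![-N σ 1, N σ 0, 0] = 0 := by
    apply h.ext_tangent hσ
    · rw [dotProduct_sub, h.normal_dot_dN hσ, dot3]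
      simp
      ring
    · intro l
      rw [sub_dotProduct, h.dN_symm hσ, hkv]
      have := lineDeriv_eq_zero h.isOpen (F := fun σ => N σ 1 * Y σ 0 - N σ 0 * Y σ 1) ht hσ
        (((h.lineN hσ l 1).mul (h.lineY hσ l 0)).sub ((h.lineN hσ l 0).mul (h.lineY hσ l 1)))
      simp only [zero_smul, add_zero] at this
      rw [dot3, dot3]
      simp
      linear_combination this
  -- The parallels are therefore principal directions; since the shape operator is trace-free, the
  -- meridians have the opposite principal value (`e7`).
  have e2 : (Y σ 0 ^ 2 + Y σ 1 ^ 2) • fderiv ℝ N σ kv =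
      (N σ 0 * Y σ 0 + N σ 1 * Y σ 1) • ![-Y σ 1, Y σ 0, 0] := by
    rw [sub_eq_zero.mp e1]
    ext i
    fin_cases i
    · simp
      linear_combination Y σ 0 * htσ
    · simp
      linear_combination -Y σ 1 * htσ
    · simp
  have e3 := h.dN_rot hσ hkJ
  have e4 := frame_expand hu hv (h.normal σ hσ k)
  have evv : ![-Y σ 1, Y σ 0, 0] ⬝ᵥ ![-Y σ 1, Y σ 0, 0] = Y σ 0 ^ 2 + Y σ 1 ^ 2 := by
    rw [dot3]
    simp
    ring
  have ewv : fderiv ℝ Y σ k ⬝ᵥ ![-Y σ 1, Y σ 0, 0] =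
      Y σ 0 * fderiv ℝ Y σ k 1 - Y σ 1 * fderiv ℝ Y σ k 0 := by
    rw [dot3]
    simp
    ring
  rw [evv, ewv] at e4
  rw [← hkv, ← hkJ] at e4
  have e6 := e4
  rw [← map_smul, ← map_smul, ← map_smul, ← map_add] at e4
  have e5 := congrArg (fderiv ℝ N σ) (h.injective σ hσ e4)
  rw [map_smul, map_add, map_smul, map_smul] at e5
  rw [hkv] at e6 hkJ
  generalize hc : fderiv ℝ Y σ k ⬝ᵥ fderiv ℝ Y σ kJ = c at *
  replace e6 : c • fderiv ℝ Y σ kJ = (Y σ 0 ^ 2 + Y σ 1 ^ 2) • fderiv ℝ Y σ k -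
      (Y σ 0 * fderiv ℝ Y σ k 1 - Y σ 1 * fderiv ℝ Y σ k 0) • ![-Y σ 1, Y σ 0, 0] := by
    rw [e6]
    abel
  have e7 : (Y σ 0 ^ 2 + Y σ 1 ^ 2) • fderiv ℝ N σ kJ =
      -((N σ 0 * Y σ 0 + N σ 1 * Y σ 1) • fderiv ℝ Y σ kJ) := by
    rw [e3, smul_neg, ← map_smul, e2, map_smul, hkJ]
  calc (Y σ 0 ^ 2 + Y σ 1 ^ 2) ^ 2 • fderiv ℝ N σ k
      = (Y σ 0 ^ 2 + Y σ 1 ^ 2) • ((Y σ 0 ^ 2 + Y σ 1 ^ 2) • fderiv ℝ N σ k) := by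
        rw [smul_smul, sq]
    _ = (Y σ 0 * fderiv ℝ Y σ k 1 - Y σ 1 * fderiv ℝ Y σ k 0) •
          ((Y σ 0 ^ 2 + Y σ 1 ^ 2) • fderiv ℝ N σ kv) +
          c • ((Y σ 0 ^ 2 + Y σ 1 ^ 2) • fderiv ℝ N σ kJ) := by
        rw [e5, smul_add, smul_comm _ (Y σ 0 ^ 2 + Y σ 1 ^ 2), smul_comm c]
    _ = (Y σ 0 * fderiv ℝ Y σ k 1 - Y σ 1 * fderiv ℝ Y σ k 0) •
          ((N σ 0 * Y σ 0 + N σ 1 * Y σ 1) • ![-Y σ 1, Y σ 0, 0]) -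
          (N σ 0 * Y σ 0 + N σ 1 * Y σ 1) • (c • fderiv ℝ Y σ kJ) := by
        rw [e2, e7, smul_neg, smul_comm c, ← sub_eq_add_neg]
    _ = _ := by
        rw [e6]
        module

/-- Along a minimal surface of revolution `N ⬝ y` is locally constant, `y` being the horizontal
position. -/
theorem lineDeriv_radial (h : Surf U Y N) (ht : ∀ σ ∈ U, N σ 1 * Y σ 0 - N σ 0 * Y σ 1 = 0)
    (hσ : σ ∈ U) (hY : Y σ 0 ^ 2 + Y σ 1 ^ 2 ≠ 0) (k : Fin 2 → ℝ) :
    fderiv ℝ N σ k 0 * Y σ 0 + N σ 0 * fderiv ℝ Y σ k 0 +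
      (fderiv ℝ N σ k 1 * Y σ 1 + N σ 1 * fderiv ℝ Y σ k 1) = 0 := by
  have e := h.dN_rotation ht hσ k
  have e0 := congrFun e 0
  have e1 := congrFun e 1
  simp only [Pi.smul_apply, Pi.sub_apply, smul_eq_mul] at e0 e1
  simp at e0 e1
  have htσ := ht σ hσ
  apply mul_left_cancel₀ (pow_ne_zero 2 hY)
  linear_combination Y σ 0 * e0 + Y σ 1 * e1 + (Y σ 0 ^ 2 + Y σ 1 ^ 2) *
    (Y σ 0 * fderiv ℝ Y σ k 1 - Y σ 1 * fderiv ℝ Y σ k 0) * htσ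

/-- A minimal surface of revolution is, locally, a catenoid. -/
theorem catenary (h : Surf U Y N) (hc : IsPreconnected U)
    (ht : ∀ σ ∈ U, N σ 1 * Y σ 0 - N σ 0 * Y σ 1 = 0) (hY : ∀ σ ∈ U, Y σ 0 ^ 2 + Y σ 1 ^ 2 ≠ 0)
    (hσ : σ ∈ U) (hg : N σ 0 * Y σ 0 + N σ 1 * Y σ 1 ≠ 0) :
    ∃ c z : ℝ, c ≠ 0 ∧ ∀ τ ∈ U, N τ 0 * Y τ 0 + N τ 1 * Y τ 1 = c ∧
      √(Y τ 0 ^ 2 + Y τ 1 ^ 2) = |c| * Real.cosh ((Y τ 2 - z) / |c|) ∧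
      -(N τ 2 * √(Y τ 0 ^ 2 + Y τ 1 ^ 2)) / c = Real.sinh ((Y τ 2 - z) / |c|) := by
  have hpos : ∀ τ ∈ U, 0 < Y τ 0 ^ 2 + Y τ 1 ^ 2 := fun τ hτ =>
    lt_of_le_of_ne (by positivity) (hY τ hτ).symm
  have dY := fun i => (h.contY i).differentiableOn (by simp)
  have dN := fun i => (h.contN i).differentiableOn (by simp)
  obtain ⟨c, hcdef⟩ : ∃ c, N σ 0 * Y σ 0 + N σ 1 * Y σ 1 = c := ⟨_, rfl⟩
  rw [hcdef] at hg
  have hgc : ∀ τ ∈ U, N τ 0 * Y τ 0 + N τ 1 * Y τ 1 = c := by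
    intro τ hτ
    rw [← hcdef]
    refine const_of_lineDeriv h.isOpen hc
      (F := fun τ => N τ 0 * Y τ 0 + N τ 1 * Y τ 1)
      (((dN 0).mul (dY 0)).add ((dN 1).mul (dY 1))) (fun τ hτ k => ?_) hτ hσ
    have := ((h.lineN hτ k 0).mul (h.lineY hτ k 0)).add ((h.lineN hτ k 1).mul (h.lineY hτ k 1))
    simp only [zero_smul, add_zero] at this
    have e := h.lineDeriv_radial ht hτ (hY τ hτ) k
    rw [e] at this
    exact this
  have hunit : ∀ τ ∈ U, (Y τ 0 ^ 2 + Y τ 1 ^ 2) * N τ 2 ^ 2 = Y τ 0 ^ 2 + Y τ 1 ^ 2 - c ^ 2 := by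
    intro τ hτ
    have e := h.unit τ hτ
    rw [dot3] at e
    rw [← hgc τ hτ]
    linear_combination (Y τ 0 ^ 2 + Y τ 1 ^ 2) * e -
      (N τ 1 * Y τ 0 - N τ 0 * Y τ 1) * ht τ hτ
  set r : (Fin 2 → ℝ) → ℝ := fun τ => √(Y τ 0 ^ 2 + Y τ 1 ^ 2) with hr
  have hr2 : ∀ τ ∈ U, r τ ^ 2 = Y τ 0 ^ 2 + Y τ 1 ^ 2 := fun τ hτ => Real.sq_sqrt (hpos τ hτ).le
  have hr0 : ∀ τ ∈ U, 0 < r τ := fun τ hτ => Real.sqrt_pos.mpr (hpos τ hτ)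
  have hp : ∀ τ ∈ U, √(1 + (-(N τ 2 * r τ) / c) ^ 2) = r τ / |c| := by
    intro τ hτ
    rw [← Real.sqrt_sq (div_nonneg (hr0 τ hτ).le (abs_nonneg c)), div_pow, div_pow, sq_abs]
    congr 1
    field_simp
    rw [hr2 τ hτ]
    linear_combination hunit τ hτ
  -- The area hyperbolic sine of −N_2 r/c is the catenary parameter, and it advances with the height
  -- at rate 1/|c|. Unlike arcosh(r/|c|), it is smooth through the waist.
  have hK : ∀ τ ∈ U, Real.arsinh (-(N τ 2 * r τ) / c) - Y τ 2 / |c| =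
      Real.arsinh (-(N σ 2 * r σ) / c) - Y σ 2 / |c| := by
    intro τ hτ
    refine const_of_lineDeriv h.isOpen hc
      (F := fun τ => Real.arsinh (-(N τ 2 * r τ) / c) - Y τ 2 / |c|) ?_ (fun τ hτ k => ?_) hτ hσ
    · have dr : DifferentiableOn ℝ r U :=
        (((dY 0).pow 2).add ((dY 1).pow 2)).sqrt (fun τ hτ => hY τ hτ)
      have d2 := dY 2
      have d3 := dN 2
      intro τ hτ
      have := dr τ hτ
      have := d2 τ hτ
      have := d3 τ hτ
      fun_prop
    · have h1 := ((((h.lineY hτ k 0).pow 2).add ((h.lineY hτ k 1).pow 2)).sqrt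
        (by simpa using hY τ hτ))
      have h2 := ((((h.lineN hτ k 2).mul h1).neg.div_const c).arsinh).sub
        ((h.lineY hτ k 2).div_const |c|)
      refine h2.congr_deriv ?_
      simp only [Pi.mul_apply, Pi.add_apply, Pi.pow_apply, Pi.neg_apply, zero_smul, add_zero]
      have hpτ := hp τ hτ
      have hrr := hr2 τ hτ
      have hr00 := (hr0 τ hτ).ne'
      simp only [hr] at hpτ hrr hr00
      have hq : √(1 + (-(N τ 2 * √(Y τ 0 ^ 2 + Y τ 1 ^ 2)) / c) ^ 2) =
        √(Y τ 0 ^ 2 + Y τ 1 ^ 2) / |c| := hpτ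
      rw [hq]
      generalize √(Y τ 0 ^ 2 + Y τ 1 ^ 2) = q at *
      have hac : |c| ≠ 0 := abs_ne_zero.mpr hg
      have e2 := congrFun (h.dN_rotation ht hτ k) 2
      rw [hgc τ hτ, ← hrr] at e2
      simp only [Pi.smul_apply, Pi.sub_apply, smul_eq_mul] at e2
      simp at e2
      have e2' : q ^ 2 * fderiv ℝ N τ k 2 = - c * fderiv ℝ Y τ k 2 := by
        apply mul_left_cancel₀ (pow_ne_zero 2 hr00)
        linear_combination e2
      have e3 := h.normal τ hτ k
      rw [dot3] at e3
      have e4 : c * (Y τ 0 * fderiv ℝ Y τ k 0 + Y τ 1 * fderiv ℝ Y τ k 1) =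
          - q ^ 2 * (N τ 2 * fderiv ℝ Y τ k 2) := by
        rw [hrr, ← hgc τ hτ]
        linear_combination (Y τ 0 ^ 2 + Y τ 1 ^ 2) * e3 +
          (Y τ 1 * fderiv ℝ Y τ k 0 - Y τ 0 * fderiv ℝ Y τ k 1) * ht τ hτ
      have e5 := hunit τ hτ
      rw [← hrr] at e5
      have hcc := sq_abs c
      generalize |c| = C at *
      simp only [smul_eq_mul]
      push_cast
      field_simp
      rw [hcc]
      apply mul_left_cancel₀ hg
      linear_combination (-c ^ 3) * e2' - (c ^ 2 * N τ 2) * e4 + (c ^ 2 * fderiv ℝ Y τ k 2) * e5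
  refine ⟨c, Y σ 2 - |c| * Real.arsinh (-(N σ 2 * r σ) / c), hg, fun τ hτ => ⟨hgc τ hτ, ?_⟩⟩
  have hac : |c| ≠ 0 := abs_ne_zero.mpr hg
  have hs : (Y τ 2 - (Y σ 2 - |c| * Real.arsinh (-(N σ 2 * r σ) / c))) / |c| =
      Real.arsinh (-(N τ 2 * r τ) / c) := by
    have := hK τ hτ
    field_simp at this ⊢
    linear_combination -this
  rw [hs, Real.sinh_arsinh, Real.cosh_arsinh]
  refine ⟨?_, rfl⟩
  rw [hp τ hτ, mul_div_cancel₀ _ hac]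

/-- In a wave which acts along the axis, a rotating minimal surface of revolution is the plane
through the origin orthogonal to the axis. -/
theorem height_eq_zero (h : Surf U Y N) (hm : 0 < m) (hmu : mu ≠ 0)
    (ht : ∀ σ ∈ U, N σ 1 * Y σ 0 - N σ 0 * Y σ 1 = 0)
    (hk : ∀ σ ∈ U, 0 < 1 + (la * (Y σ 0 ^ 2 + Y σ 1 ^ 2) + mu * Y σ 2 ^ 2) -
      be ^ 2 * (Y σ 0 ^ 2 + Y σ 1 ^ 2))
    (hf : ∀ σ ∈ U, ((1 + (1 + (la * (Y σ 0 ^ 2 + Y σ 1 ^ 2) + mu * Y σ 2 ^ 2) -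
      be ^ 2 * (Y σ 0 ^ 2 + Y σ 1 ^ 2)) / (m * (1 + (la * (Y σ 0 ^ 2 + Y σ 1 ^ 2) +
        mu * Y σ 2 ^ 2)))) * la - be ^ 2) * (N σ 0 * Y σ 0 + N σ 1 * Y σ 1) +
      (1 + (1 + (la * (Y σ 0 ^ 2 + Y σ 1 ^ 2) + mu * Y σ 2 ^ 2) -
      be ^ 2 * (Y σ 0 ^ 2 + Y σ 1 ^ 2)) / (m * (1 + (la * (Y σ 0 ^ 2 + Y σ 1 ^ 2) +
        mu * Y σ 2 ^ 2)))) * mu * (N σ 2 * Y σ 2) = 0) (hσ : σ ∈ U) : Y σ 2 = 0 := by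
  refine h.eq_zero_of_off_axis (h.contY 2).continuousOn (fun σ hσ hY => ?_) hσ
  by_contra hz
  have hD : ∀ σ ∈ U, 0 < 1 + (la * (Y σ 0 ^ 2 + Y σ 1 ^ 2) + mu * Y σ 2 ^ 2) := by
    intro σ hσ
    have := hk σ hσ
    have : 0 ≤ be ^ 2 * (Y σ 0 ^ 2 + Y σ 1 ^ 2) := by positivity
    linarith
  have hO : IsOpen ({σ ∈ U | Y σ 2 ≠ 0} ∩ {σ ∈ U | Y σ 0 ^ 2 + Y σ 1 ^ 2 ≠ 0}) :=
    (h.isOpen_ne (h.contY 2).continuousOn 0).inter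
      (h.isOpen_ne ((((h.contY 0).pow 2).add ((h.contY 1).pow 2)).continuousOn) 0)
  obtain ⟨ε, hε, hB⟩ := Metric.isOpen_iff.mp hO σ ⟨⟨hσ, hz⟩, hσ, hY⟩
  have hB' : ∀ τ ∈ Metric.ball σ ε, τ ∈ U := fun τ hτ => (hB hτ).1.1
  have h1 := h.mono (V := Metric.ball σ ε) Metric.isOpen_ball hB'
  have hmem := Metric.mem_ball_self (x := σ) hε
  have hfs := hf σ hσ
  -- A vertical normal at non-zero height would leave a positive factor times μ N_2 Y_2 in the force
  -- balance.
  have hN01 : N σ 0 * Y σ 0 + N σ 1 * Y σ 1 ≠ 0 := by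
    intro hg
    have e0 : N σ 0 = 0 := by
      apply mul_left_cancel₀ hY
      linear_combination Y σ 0 * hg - Y σ 1 * ht σ hσ
    have e1 : N σ 1 = 0 := by
      apply mul_left_cancel₀ hY
      linear_combination Y σ 1 * hg + Y σ 0 * ht σ hσ
    have hN2 : N σ 2 ≠ 0 := by
      intro h2
      have := h.unit σ hσ
      rw [dot3, e0, e1, h2] at this
      norm_num at this
    rw [hg, mul_zero, zero_add] at hfs
    have hp : 0 < (1 + (1 + (la * (Y σ 0 ^ 2 + Y σ 1 ^ 2) + mu * Y σ 2 ^ 2) -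
      be ^ 2 * (Y σ 0 ^ 2 + Y σ 1 ^ 2)) / (m * (1 + (la * (Y σ 0 ^ 2 + Y σ 1 ^ 2) +
        mu * Y σ 2 ^ 2)))) := by
      have := hk σ hσ
      have := hD σ hσ
      positivity
    exact mul_ne_zero (mul_ne_zero hp.ne' hmu) (mul_ne_zero hN2 hz) hfs
  obtain ⟨c, z, hc, hcat⟩ := h1.catenary (convex_ball σ ε).isPreconnected
    (fun τ hτ => ht τ (hB' τ hτ)) (fun τ hτ => (hB hτ).2.2) hmem hN01
  -- The height must move in some direction k, since the normal is not vertical; this makes the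
  -- catenary parameter non-constant along that line.
  obtain ⟨k, hk2⟩ : ∃ k, fderiv ℝ Y σ k 2 ≠ 0 := by
    by_contra! hall
    have e : (Pi.single 2 1 : Fin 3 → ℝ) - N σ 2 • N σ = 0 := by
      apply h.ext_tangent hσ
      · rw [dotProduct_sub, dotProduct_smul, h.unit σ hσ]
        simp
      · intro k
        rw [sub_dotProduct, smul_dotProduct, h.normal σ hσ]
        simpa using hall k
    have e0 := congrFun e 0
    have e1 := congrFun e 1
    have e2 := congrFun e 2
    simp at e0 e1 e2
    have hN2 : N σ 2 ≠ 0 := by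
      intro h0
      rw [h0] at e2
      norm_num at e2
    rw [e0.resolve_left hN2, e1.resolve_left hN2] at hN01
    simp at hN01
  have hac : |c| ≠ 0 := abs_ne_zero.mpr hc
  have hm1 : m + 1 ≠ 0 := by positivity
  refine catenary_false (m := m) (la := la) (mu := mu) (be := be) (C := |c|) (z := z)
    (s := fun t => (Y (σ + t • k) 2 - z) / |c|) hm1 hmu hac
    (((h.lineY hσ k 2).sub_const z).div_const |c|) (div_ne_zero hk2 hac) ?_
  have hcont : Continuous fun t : ℝ => σ + t • k := by fun_prop
  have hev : ∀ᶠ t in nhds (0 : ℝ), σ + t • k ∈ Metric.ball σ ε :=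
    hcont.continuousAt.preimage_mem_nhds (Metric.isOpen_ball.mem_nhds (by simpa using hmem))
  filter_upwards [hev] with t htB
  generalize σ + t • k = τ at htB
  obtain ⟨e1, e2, e3⟩ := hcat τ htB
  have hr2 : √(Y τ 0 ^ 2 + Y τ 1 ^ 2) ^ 2 = Y τ 0 ^ 2 + Y τ 1 ^ 2 := Real.sq_sqrt (by positivity)
  have ez : z + |c| * ((Y τ 2 - z) / |c|) = Y τ 2 := by
    field_simp
    ring
  rw [ez, ← e2, ← e3, hr2]
  have hfτ := hf τ (hB' τ htB)
  have hDτ := (hD τ (hB' τ htB)).ne'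
  rw [e1] at hfτ
  field_simp at hfτ ⊢
  linear_combination √(Y τ 0 ^ 2 + Y τ 1 ^ 2) * hfτ

end Rotating

end Surf

end Blackfold

/-! ### Rigid motions and continuation of the twist relation. -/

namespace Blackfold

open Matrix

theorem mulVec_dot_mulVec {R : Matrix (Fin 3) (Fin 3) ℝ} (hR : R * Rᵀ = 1) (a b : Fin 3 → ℝ) :
    (R *ᵥ a) ⬝ᵥ (R *ᵥ b) = a ⬝ᵥ b := by
  rw [dotProduct_mulVec, vecMul_mulVec, mul_eq_one_comm.mp hR, vecMul_one]

/-- The factor `R.det` appears on both sides of the minimality condition of `Surf`, so reflections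
do no harm there. -/
theorem mulVec_triple (R : Matrix (Fin 3) (Fin 3) ℝ) (a b c : Fin 3 → ℝ) :
    (R *ᵥ a) ⬝ᵥ ((R *ᵥ b) ⨯₃ (R *ᵥ c)) = R.det * (a ⬝ᵥ (b ⨯₃ c)) := by
  have h1 : (of ![R *ᵥ a, R *ᵥ b, R *ᵥ c]) = of ![a, b, c] * Rᵀ := by
    ext i j
    fin_cases i <;> simp [Matrix.mul_apply, mulVec, dotProduct, mul_comm]
  have h2 := congrArg det h1
  rw [det_mul, det_transpose, mul_comm] at h2
  rw [triple_product_eq_det, triple_product_eq_det]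
  exact h2

theorem fderiv_mulVec_sub (R : Matrix (Fin 3) (Fin 3) ℝ) (x₀ : Fin 3 → ℝ)
    {Y : (Fin 2 → ℝ) → Fin 3 → ℝ} {σ : Fin 2 → ℝ} (hY : DifferentiableAt ℝ Y σ) (k : Fin 2 → ℝ) :
    fderiv ℝ (fun σ => R *ᵥ (Y σ - x₀)) σ k = R *ᵥ fderiv ℝ Y σ k := by
  have h1 := (R.mulVecLin.toContinuousLinearMap.hasFDerivAt (x := Y σ - x₀)).comp σ
    (hY.hasFDerivAt.sub_const x₀)
  have h2 : fderiv ℝ (fun σ => R *ᵥ (Y σ - x₀)) σ = _ := h1.fderiv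
  rw [h2]
  rfl

theorem contDiffOn_mulVec_sub (R : Matrix (Fin 3) (Fin 3) ℝ) (x₀ : Fin 3 → ℝ)
    {Y : (Fin 2 → ℝ) → Fin 3 → ℝ} {U : Set (Fin 2 → ℝ)} (hY : ContDiffOn ℝ ∞ Y U) :
    ContDiffOn ℝ ∞ (fun σ => R *ᵥ (Y σ - x₀)) U :=
  (R.mulVecLin.toContinuousLinearMap.contDiff).comp_contDiffOn (hY.sub contDiffOn_const)

namespace Surf

variable {U : Set (Fin 2 → ℝ)} {Y N : (Fin 2 → ℝ) → Fin 3 → ℝ} {σ : Fin 2 → ℝ}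

/-- Rigid motions preserve minimal surfaces. -/
theorem rigid (h : Surf U Y N) {R : Matrix (Fin 3) (Fin 3) ℝ} (hR : R * Rᵀ = 1)
    (x₀ : Fin 3 → ℝ) : Surf U (fun σ => R *ᵥ (Y σ - x₀)) (fun σ => R *ᵥ N σ) := by
  have eN : (fun σ => R *ᵥ N σ) = fun σ => R *ᵥ (N σ - 0) := by simp
  have hdY := fun σ hσ => fderiv_mulVec_sub R x₀ (h.differentiableAt (σ := σ) hσ)
  have hdN : ∀ σ ∈ U, ∀ k, fderiv ℝ (fun σ => R *ᵥ N σ) σ k = R *ᵥ fderiv ℝ N σ k := by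
    rw [eN]
    exact fun σ hσ => fderiv_mulVec_sub R 0 (h.differentiableAt_normal hσ)
  refine ⟨h.isOpen, contDiffOn_mulVec_sub R x₀ h.smooth, ?_, fun σ hσ => ?_, fun σ hσ k => ?_,
    fun σ hσ k l hkl => ?_, fun σ hσ k l => ?_⟩
  · rw [eN]
    exact contDiffOn_mulVec_sub R 0 h.smooth_normal
  · rw [mulVec_dot_mulVec hR, h.unit σ hσ]
  · rw [hdY σ hσ, mulVec_dot_mulVec hR, h.normal σ hσ]
  · rw [hdY σ hσ, hdY σ hσ] at hkl
    apply h.injective σ hσ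
    have := congrArg (fun v => Rᵀ *ᵥ v) hkl
    simpa [mulVec_mulVec, mul_eq_one_comm.mp hR] using this
  · rw [hdY σ hσ, hdY σ hσ, hdN σ hσ, hdN σ hσ, mulVec_triple, mulVec_triple, h.minimal σ hσ]

theorem normal_const (h : Surf U Y N) (hc : IsPreconnected U)
    (hf : ∀ σ ∈ U, fderiv ℝ N σ = 0) {τ : Fin 2 → ℝ} (hσ : σ ∈ U) (hτ : τ ∈ U) : N σ = N τ :=
  h.isOpen.is_const_of_fderiv_eq_zero hc (h.smooth_normal.differentiableOn (by simp)) hf hσ hτ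

theorem eq_smul_normal (h : Surf U Y N) (hσ : σ ∈ U) {ν : Fin 3 → ℝ}
    (hν : ∀ k, ν ⬝ᵥ fderiv ℝ Y σ k = 0) : ν = (N σ ⬝ᵥ ν) • N σ := by
  rw [← sub_eq_zero]
  apply h.ext_tangent hσ
  · rw [dotProduct_sub, dotProduct_smul, h.unit σ hσ]
    simp
  · intro k
    rw [sub_dotProduct, smul_dotProduct, h.normal σ hσ, hν]
    simp

theorem exists_twist (h : Surf U Y N) (hr : ∀ σ ∈ U, N σ 0 * Y σ 0 + N σ 1 * Y σ 1 = 0)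
    (hσ : σ ∈ U) (hN : N σ 2 ^ 2 ≠ 1) :
    ∃ ε : ℝ, ∀ᶠ τ in nhds σ, N τ 2 + ε * (N τ 1 * Y τ 0 - N τ 0 * Y τ 1) = 0 := by
  obtain ⟨δ, hδ, hB⟩ := Metric.isOpen_iff.mp
    (h.isOpen_ne ((h.contN 2).pow 2).continuousOn 1) σ ⟨hσ, hN⟩
  have h1 := h.mono (V := Metric.ball σ δ) Metric.isOpen_ball (fun τ hτ => (hB hτ).1)
  have hr1 : ∀ τ ∈ Metric.ball σ δ, N τ 0 * Y τ 0 + N τ 1 * Y τ 1 = 0 :=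
    fun τ hτ => hr τ (hB hτ).1
  have hN1 : ∀ τ ∈ Metric.ball σ δ, N τ 2 ^ 2 ≠ 1 := fun τ hτ => (hB hτ).2
  refine ⟨twist Y N σ, ?_⟩
  filter_upwards [Metric.ball_mem_nhds σ hδ] with τ hτ
  exact h1.twist_relation hr1 hN1 (fun ρ hρ => h1.twist_const (convex_ball σ δ).isPreconnected
    hr1 hN1 hρ (Metric.mem_ball_self hδ)) hτ

/-- The relation between the normal and the rotation about the axis propagates. -/
theorem twist_relation_extend (h : Surf U Y N) (hc : IsPreconnected U)
    (hr : ∀ σ ∈ U, N σ 0 * Y σ 0 + N σ 1 * Y σ 1 = 0) {ε : ℝ} (hσ : σ ∈ U)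
    (h0 : ∀ᶠ τ in nhds σ, N τ 2 + ε * (N τ 1 * Y τ 0 - N τ 0 * Y τ 1) = 0) {τ : Fin 2 → ℝ}
    (hτ : τ ∈ U) : N τ 2 + ε * (N τ 1 * Y τ 0 - N τ 0 * Y τ 1) = 0 := by
  set F : (Fin 2 → ℝ) → ℝ := fun τ => N τ 2 + ε * (N τ 1 * Y τ 0 - N τ 0 * Y τ 1) with hF
  have hcont : ContinuousOn F U := ((h.contN 2).add (contDiffOn_const.mul
      (((h.contN 1).mul (h.contY 0)).sub ((h.contN 0).mul (h.contY 1))))).continuousOn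
  -- The set where the relation holds on a neighbourhood is open; by connectedness it remains to
  -- show that it is closed in U.
  suffices hs : U ⊆ {σ | ∀ᶠ τ in nhds σ, F τ = 0} from (hs hτ).self_of_nhds
  refine hc.subset_of_closure_inter_subset isOpen_setOfPred_eventually_nhds ⟨σ, hσ, h0⟩ ?_
  rintro ρ ⟨hρ, hρU⟩
  have hρ0 : F ρ = 0 := by
    by_contra hne
    have h1 := (hcont.continuousAt (h.isOpen.mem_nhds hρU)).eventually_ne hne
    obtain ⟨τ, hτ, hτ'⟩ := (mem_closure_iff_frequently.mp hρ).and_eventually h1 |>.exists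
    exact hτ' hτ.self_of_nhds
  have hu := h.unit ρ hρU
  rw [dot3] at hu
  -- At a limit point the relation holds by continuity, and a vertical normal would contradict it.
  -- So a rate ε' exists near ρ.
  have hN : N ρ 2 ^ 2 ≠ 1 := by
    intro h2
    have e0 : N ρ 0 = 0 := by nlinarith [sq_nonneg (N ρ 0), sq_nonneg (N ρ 1)]
    have e1 : N ρ 1 = 0 := by nlinarith [sq_nonneg (N ρ 0), sq_nonneg (N ρ 1)]
    simp only [hF, e0, e1] at hρ0
    have : N ρ 2 = 0 := by linarith
    rw [this] at h2
    norm_num at h2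
  obtain ⟨ε', hε'⟩ := h.exists_twist hr hρU hN
  by_cases hee : ε' = ε
  · rw [hee] at hε'
    exact hε'
  -- Two different rates on a common open set make both the radial and the rotation field tangent,
  -- so N is vertical; the relation then gives N = 0.
  exfalso
  obtain ⟨τ, hτ, hτ', hτU⟩ := ((mem_closure_iff_frequently.mp hρ).and_eventually
    (hε'.eventually_nhds.and (h.isOpen.mem_nhds hρU))).exists
  obtain ⟨δ, hδ, hB⟩ := Metric.eventually_nhds_iff_ball.mp
    ((hτ.and hτ').and (h.isOpen.mem_nhds hτU))
  have h1 := h.mono (V := Metric.ball τ δ) Metric.isOpen_ball (fun τ hτ => (hB τ hτ).2)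
  have ht : ∀ ρ ∈ Metric.ball τ δ, N ρ 1 * Y ρ 0 - N ρ 0 * Y ρ 1 = 0 := by
    intro ρ hρ
    obtain ⟨⟨e1, e2⟩, -⟩ := hB ρ hρ
    apply mul_left_cancel₀ (sub_ne_zero.mpr hee)
    linear_combination e2 - e1
  have hτB := Metric.mem_ball_self (x := τ) hδ
  obtain ⟨e0, e1⟩ := h1.horizontal_of_radial_rotation (fun ρ hρ => hr ρ (hB ρ hρ).2) ht hτB
  have e2 := (hB τ hτB).1.2
  have hu' := h.unit τ hτU
  rw [e0, e1] at e2
  rw [dot3, e0, e1] at hu'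
  have : N τ 2 = 0 := by linarith
  rw [this] at hu'
  norm_num at hu'

end Surf

/-! ### Surfaces in the large -/

section Sheet

variable {M : Type*} [TopologicalSpace M] {X : M → Fin 3 → ℝ} {W : Set M}
  {P : M → (Fin 3 → ℝ) → Prop}

/-- A connected coordinate patch, contained in `W`, of a minimal surface `X` whose normal vectors
at `q` are the vectors `ν` with `P q ν`. -/
structure IsPatch (X : M → Fin 3 → ℝ) (W : Set M) (P : M → (Fin 3 → ℝ) → Prop)
    (e : OpenPartialHomeomorph M (Fin 2 → ℝ)) (N : (Fin 2 → ℝ) → Fin 3 → ℝ) : Prop where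
  subset : e.source ⊆ W
  preconnected : IsPreconnected e.target
  surf : Surf e.target (fun σ => X (e.symm σ)) N
  -- Normals enter through a predicate and not a vector field, because M need not be orientable and
  -- patches need not agree on the sign of N.
  normal_iff : ∀ q ∈ e.source, ∀ ν,
    P q ν ↔ ∀ k, ν ⬝ᵥ fderiv ℝ (fun σ => X (e.symm σ)) (e q) k = 0

/-- A connected minimal surface `X` over `W` whose normal vectors at `q` are the vectors `ν` with
`P q ν`. -/
structure Sheet (X : M → Fin 3 → ℝ) (W : Set M) (P : M → (Fin 3 → ℝ) → Prop) : Prop where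
  isConnected : IsConnected W
  patch : ∀ p ∈ W, ∃ e N, p ∈ e.source ∧ IsPatch X W P e N

namespace IsPatch

variable {e : OpenPartialHomeomorph M (Fin 2 → ℝ)} {N : (Fin 2 → ℝ) → Fin 3 → ℝ}

theorem normal (h : IsPatch X W P e N) {σ : Fin 2 → ℝ} (hσ : σ ∈ e.target) :
    P (e.symm σ) (N σ) := by
  rw [h.normal_iff _ (e.map_target hσ), e.right_inv hσ]
  exact h.surf.normal σ hσ

theorem mem (h : IsPatch X W P e N) {σ : Fin 2 → ℝ} (hσ : σ ∈ e.target) : e.symm σ ∈ W :=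
  h.subset (e.map_target hσ)

theorem eq_smul (h : IsPatch X W P e N) {q : M} (hq : q ∈ e.source) {ν : Fin 3 → ℝ}
    (hν : P q ν) : ν = (N (e q) ⬝ᵥ ν) • N (e q) :=
  h.surf.eq_smul_normal (e.map_source hq) ((h.normal_iff q hq ν).mp hν)

theorem normal' (h : IsPatch X W P e N) {q : M} (hq : q ∈ e.source) : P q (N (e q)) := by
  have := h.normal (e.map_source hq)
  rwa [e.left_inv hq] at this

theorem rigid (h : IsPatch X W P e N) {R : Matrix (Fin 3) (Fin 3) ℝ} (hR : R * Rᵀ = 1)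
    (x₀ : Fin 3 → ℝ) :
    IsPatch (fun q => R *ᵥ (X q - x₀)) W (fun q ν => P q (Rᵀ *ᵥ ν)) e (fun σ => R *ᵥ N σ) where
  subset := h.subset
  preconnected := h.preconnected
  surf := h.surf.rigid hR x₀
  normal_iff q hq ν := by
    rw [h.normal_iff q hq]
    refine forall_congr' fun k => ?_
    rw [fderiv_mulVec_sub R x₀ (h.surf.differentiableAt (e.map_source hq)), dotProduct_mulVec,
      mulVec_transpose]

end IsPatch

namespace Sheet

theorem rigid (h : Sheet X W P) {R : Matrix (Fin 3) (Fin 3) ℝ} (hR : R * Rᵀ = 1)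
    (x₀ : Fin 3 → ℝ) : Sheet (fun q => R *ᵥ (X q - x₀)) W (fun q ν => P q (Rᵀ *ᵥ ν)) where
  isConnected := h.isConnected
  patch p hp := by
    obtain ⟨e, N, hpe, he⟩ := h.patch p hp
    exact ⟨e, _, hpe, he.rigid hR x₀⟩

/-- A property which is constant on patches holds everywhere if it holds at one point. -/
theorem forall_of_patch (h : Sheet X W P) {Q : M → Prop}
    (hQ : ∀ e N, IsPatch X W P e N → ∀ q ∈ e.source, ∀ q' ∈ e.source, Q q → Q q') {p : M}
    (hp : p ∈ W) (hQp : Q p) {q : M} (hq : q ∈ W) : Q q := by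
  -- The patch hypothesis is symmetric in q and q', so it also serves the negation of Q. Both sets
  -- are open, and W is preconnected.
  have hopen : ∀ Q : M → Prop, (∀ e N, IsPatch X W P e N → ∀ q ∈ e.source, ∀ q' ∈ e.source,
      Q q → Q q') → IsOpen {q ∈ W | Q q} := by
    intro Q hQ
    rw [isOpen_iff_mem_nhds]
    rintro q ⟨hq, hQq⟩
    obtain ⟨e, N, hqe, he⟩ := h.patch q hq
    filter_upwards [e.open_source.mem_nhds hqe] with q' hq'
    exact ⟨he.subset hq', hQ e N he q hqe q' hq' hQq⟩
  by_contra hne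
  obtain ⟨x, -, hx1, hx2⟩ := h.isConnected.isPreconnected _ _ (hopen Q hQ)
    (hopen (fun q => ¬ Q q) fun e N he q hq q' hq' hn hQ' => hn (hQ e N he q' hq' q hq hQ'))
    (fun q hq => by by_cases hq' : Q q; exacts [Or.inl ⟨hq, hq'⟩, Or.inr ⟨hq, hq'⟩])
    ⟨p, hp, hp, hQp⟩ ⟨q, hq, hq, hne⟩
  exact hx2.2 hx1.2

/-- A connected surface with locally constant normal lies in a plane. -/
theorem plane_of_flat (h : Sheet X W P)
    (hf : ∀ e N, IsPatch X W P e N → ∀ σ ∈ e.target, fderiv ℝ N σ = 0) :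
    ∃ (N₀ : Fin 3 → ℝ) (d : ℝ), N₀ ⬝ᵥ N₀ = 1 ∧ ∀ q ∈ W, P q N₀ ∧ N₀ ⬝ᵥ X q = d := by
  obtain ⟨p, hp⟩ := h.isConnected.nonempty
  obtain ⟨e, N, hpe, he⟩ := h.patch p hp
  refine ⟨N (e p), N (e p) ⬝ᵥ X p, he.surf.unit _ (e.map_source hpe), fun q hq => ?_⟩
  -- That the fixed vector stays normal and that its product with X is constant have to be spread
  -- together.
  refine h.forall_of_patch (Q := fun q => P q (N (e p)) ∧ N (e p) ⬝ᵥ X q = N (e p) ⬝ᵥ X p)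
    ?_ hp ⟨he.normal' hpe, rfl⟩ hq
  rintro e' N' he' q hq q' hq' ⟨h1, h2⟩
  generalize N (e p) = N₀ at *
  have hc : ∀ σ ∈ e'.target, N' σ = N' (e' q) := fun σ hσ =>
    he'.surf.normal_const he'.preconnected (hf e' N' he') hσ (e'.map_source hq)
  have hN := he'.eq_smul hq h1
  have hdY : ∀ σ ∈ e'.target, ∀ k, N₀ ⬝ᵥ fderiv ℝ (fun σ => X (e'.symm σ)) σ k = 0 := by
    intro σ hσ k
    rw [hN, ← hc σ hσ, smul_dotProduct, he'.surf.normal σ hσ, smul_zero]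
  constructor
  · rw [he'.normal_iff q' hq']
    exact hdY _ (e'.map_source hq')
  · rw [← h2, ← e'.left_inv hq, ← e'.left_inv hq']
    refine const_of_lineDeriv he'.surf.isOpen he'.preconnected
      (F := fun σ => N₀ ⬝ᵥ X (e'.symm σ)) ?_ (fun σ hσ k => ?_) (e'.map_source hq')
      (e'.map_source hq)
    · simp only [dot3]
      have := fun i => (he'.surf.contY i).differentiableOn (by simp)
      exact (((this 0).const_mul _).add ((this 1).const_mul _)).add ((this 2).const_mul _)
    · have hl := he'.surf.lineY hσ k
      have := (((hl 0).const_mul (N₀ 0)).add ((hl 1).const_mul (N₀ 1))).add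
        ((hl 2).const_mul (N₀ 2))
      have e0 := hdY σ hσ k
      rw [dot3] at e0
      rw [e0] at this
      simp only [dot3]
      exact this

/-- A flat surface which is tangent to the force field lies in a plane whose normal is an
eigenvector of the profile. -/
theorem liesInPlane_of_flat (h : Sheet X W P) {A : Fin 3 → ℝ}
    (hf : ∀ e N, IsPatch X W P e N → ∀ σ ∈ e.target, fderiv ℝ N σ = 0)
    (hA : ∀ q ∈ W, ∀ ν, P q ν → ν ⬝ᵥ (A * X q) = 0) : LiesInPlane A (X '' W) := by
  obtain ⟨N₀, d, hu, hN₀⟩ := h.plane_of_flat hf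
  obtain ⟨p, hp⟩ := h.isConnected.nonempty
  obtain ⟨e, N, hpe, he⟩ := h.patch p hp
  have hσ := e.map_source hpe
  -- Differentiating N₀ · A X = 0 along the plane shows that A N₀ is normal too, hence a multiple m
  -- N₀.
  have hk : ∀ k, (A * N₀) ⬝ᵥ fderiv ℝ (fun σ => X (e.symm σ)) (e p) k = 0 := by
    intro k
    have hl := he.surf.lineY hσ k
    have := (((hl 0).const_mul ((A * N₀) 0)).add ((hl 1).const_mul ((A * N₀) 1))).add
        ((hl 2).const_mul ((A * N₀) 2))
    rw [dot3]
    refine lineDeriv_eq_zero he.surf.isOpen (F := fun σ => (A * N₀) 0 * X (e.symm σ) 0 +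
      (A * N₀) 1 * X (e.symm σ) 1 + (A * N₀) 2 * X (e.symm σ) 2) (fun σ hσ => ?_) hσ this
    have := hA _ (he.mem hσ) N₀ (hN₀ _ (he.mem hσ)).1
    rw [dot3] at this
    simp only [Pi.mul_apply] at this ⊢
    linear_combination this
  have h1 := he.surf.eq_smul_normal hσ hk
  have h2 := he.eq_smul hpe (hN₀ p hp).1
  have h3 : N (e p) ⬝ᵥ N₀ ≠ 0 := by
    intro h0
    rw [h0, zero_smul] at h2
    rw [h2] at hu
    simp at hu
  obtain ⟨m, hm⟩ : ∃ m : ℝ, A * N₀ = m • N₀ := by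
    refine ⟨(N (e p) ⬝ᵥ (A * N₀)) / (N (e p) ⬝ᵥ N₀), ?_⟩
    nth_rewrite 4 [h2]
    rw [smul_smul, div_mul_cancel₀ _ h3]
    exact h1
  refine ⟨N₀, d, m, ?_, ?_, fun i => congrFun hm i, ?_⟩
  · rintro rfl
    simp at hu
  · rintro _ ⟨q, hq, rfl⟩
    exact (hN₀ q hq).2
  · have e1 := hA p hp N₀ (hN₀ p hp).1
    have e2 := (hN₀ p hp).2
    have e3 : (m • N₀) ⬝ᵥ X p = 0 := by
      rw [← hm, ← e1, dot3, dot3]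
      simp only [Pi.mul_apply]
      ring
    rw [smul_dotProduct, e2] at e3
    exact e3

/-- A surface whose normal is radial-free and obeys the twist relation with `ε` is swept out by
horizontal rulings through the axis which turn at the rate `ε`. -/
theorem ruled (h : Sheet X W P) {ε : ℝ}
    (hr : ∀ q ∈ W, ∀ ν, P q ν → ν 0 * X q 0 + ν 1 * X q 1 = 0)
    (hε : ∀ q ∈ W, ∀ ν, P q ν → ν 2 + ε * (ν 1 * X q 0 - ν 0 * X q 1) = 0) :
    ∃ θ : ℝ, ∀ q ∈ W, ∃ r : ℝ, X q 0 = r * Real.cos (ε * X q 2 + θ) ∧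
      X q 1 = r * Real.sin (ε * X q 2 + θ) := by
  obtain ⟨p, hp⟩ := h.isConnected.nonempty
  obtain ⟨e, N, hpe, he⟩ := h.patch p hp
  have hne : ∀ e N, IsPatch X W P e N → ∀ q ∈ e.source, N (e q) 0 ^ 2 + N (e q) 1 ^ 2 ≠ 0 := by
    intro e N he q hq h0
    have := he.surf.horizontal_norm (fun σ hσ => hr _ (he.mem hσ) _ (he.normal hσ))
      (fun σ hσ => hε _ (he.mem hσ) _ (he.normal hσ)) (e.map_source hq)
    rw [h0] at this
    norm_num at this
  have hnp := hne e N he p hpe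
  -- The pair (a, b) is the direction of the ruling in the turning frame: orthogonal to the
  -- horizontal normal at p.
  set a : ℝ := -(N (e p) 1 * Real.cos (ε * X p 2) - N (e p) 0 * Real.sin (ε * X p 2)) with ha
  set b : ℝ := N (e p) 0 * Real.cos (ε * X p 2) + N (e p) 1 * Real.sin (ε * X p 2) with hb
  have hab : a ^ 2 + b ^ 2 ≠ 0 := by
    have : a ^ 2 + b ^ 2 = N (e p) 0 ^ 2 + N (e p) 1 ^ 2 := by
      rw [ha, hb]
      linear_combination (N (e p) 0 ^ 2 + N (e p) 1 ^ 2) * Real.sin_sq_add_cos_sq (ε * X p 2)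
    rwa [this]
  have key : ∀ q ∈ W, ∀ ν, P q ν → a * (ν 0 * Real.cos (ε * X q 2) + ν 1 * Real.sin (ε * X q 2)) +
      b * (ν 1 * Real.cos (ε * X q 2) - ν 0 * Real.sin (ε * X q 2)) = 0 := by
    intro q hq
    refine h.forall_of_patch (Q := fun q => ∀ ν, P q ν →
      a * (ν 0 * Real.cos (ε * X q 2) + ν 1 * Real.sin (ε * X q 2)) +
      b * (ν 1 * Real.cos (ε * X q 2) - ν 0 * Real.sin (ε * X q 2)) = 0) ?_ hp ?_ hq
    · intro e' N' he' q hq q' hq' hQ ν hν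
      have := he'.surf.frame_const he'.preconnected
        (fun σ hσ => hr _ (he'.mem hσ) _ (he'.normal hσ))
        (fun σ hσ => hε _ (he'.mem hσ) _ (he'.normal hσ)) (a := a) (b := b)
        (e'.map_source hq) (e'.map_source hq')
        (by simpa only [e'.left_inv hq] using hQ _ (he'.normal' hq))
      rw [e'.left_inv hq'] at this
      rw [he'.eq_smul hq' hν]
      simp only [Pi.smul_apply, smul_eq_mul]
      linear_combination (N' (e' q') ⬝ᵥ ν) * this
    · intro ν hν
      rw [he.eq_smul hpe hν]
      simp only [Pi.smul_apply, smul_eq_mul]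
      rw [ha, hb]
      ring
  -- The phase θ of the rulings is the polar angle of (a, b).
  set z : ℂ := ⟨a, b⟩ with hz
  have hz0 : ‖z‖ ≠ 0 := by
    rw [norm_ne_zero_iff]
    intro h0
    have h1 := congrArg Complex.re h0
    have h2 := congrArg Complex.im h0
    simp only [hz, Complex.zero_re, Complex.zero_im] at h1 h2
    rw [h1, h2] at hab
    norm_num at hab
  have hza : a = ‖z‖ * Real.cos z.arg := (Complex.norm_mul_cos_arg z).symm
  have hzb : b = ‖z‖ * Real.sin z.arg := (Complex.norm_mul_sin_arg z).symm
  refine ⟨z.arg, fun q hq => ?_⟩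
  obtain ⟨e', N', hqe, he'⟩ := h.patch q hq
  have k1 := key q hq _ (he'.normal' hqe)
  have k2 := hr q hq _ (he'.normal' hqe)
  have k3 := hne e' N' he' q hqe
  generalize N' (e' q) = ν at *
  rw [hza, hzb] at k1
  rw [Real.cos_add, Real.sin_add]
  have hC := Real.sin_sq_add_cos_sq (ε * X q 2)
  have hT := Real.sin_sq_add_cos_sq z.arg
  generalize Real.cos (ε * X q 2) = c at *
  generalize Real.sin (ε * X q 2) = s at *
  generalize Real.cos z.arg = C at *
  generalize Real.sin z.arg = S at *
  have k4 : C * (ν 0 * c + ν 1 * s) + S * (ν 1 * c - ν 0 * s) = 0 := by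
    apply mul_left_cancel₀ hz0
    linear_combination k1
  -- The horizontal position and the ruling direction are both orthogonal to the same non-zero
  -- horizontal vector, so they are parallel; r is the coordinate along the ruling.
  have k5 : C * (X q 1 * c - X q 0 * s) - S * (X q 0 * c + X q 1 * s) = 0 := by
    apply mul_left_cancel₀ k3
    linear_combination (ν 1 * C * c - ν 0 * C * s - ν 0 * S * c - ν 1 * S * s) * k2 +
      (ν 0 * X q 1 - ν 1 * X q 0) * k4
  refine ⟨C * (X q 0 * c + X q 1 * s) + S * (X q 1 * c - X q 0 * s), ?_, ?_⟩
  · linear_combination (-X q 0) * hC - X q 0 * (c ^ 2 + s ^ 2) * hT - (c * S + s * C) * k5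
  · linear_combination (-X q 1) * hC - X q 1 * (c ^ 2 + s ^ 2) * hT + (c * C - s * S) * k5

/-- A surface tangent to the horizontal radial field either has vertical normals only, or obeys
the twist relation for some `ε`. -/
theorem exists_twist (h : Sheet X W P)
    (hr : ∀ q ∈ W, ∀ ν, P q ν → ν 0 * X q 0 + ν 1 * X q 1 = 0) :
    (∀ q ∈ W, ∀ ν, P q ν → ν 0 = 0 ∧ ν 1 = 0) ∨
      ∃ ε : ℝ, ∀ q ∈ W, ∀ ν, P q ν → ν 2 + ε * (ν 1 * X q 0 - ν 0 * X q 1) = 0 := by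
  by_cases hh : ∀ q ∈ W, ∀ ν, P q ν → ν 0 = 0 ∧ ν 1 = 0
  · exact Or.inl hh
  push Not at hh
  obtain ⟨p, hp, ν, hν, hν0⟩ := hh
  obtain ⟨e, N, hpe, he⟩ := h.patch p hp
  have hN : N (e p) 2 ^ 2 ≠ 1 := by
    intro h2
    have hu := he.surf.unit _ (e.map_source hpe)
    rw [dot3] at hu
    have e0 : N (e p) 0 = 0 := by nlinarith [sq_nonneg (N (e p) 0), sq_nonneg (N (e p) 1)]
    have e1 : N (e p) 1 = 0 := by nlinarith [sq_nonneg (N (e p) 0), sq_nonneg (N (e p) 1)]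
    have hs := he.eq_smul hpe hν
    have s0 := congrFun hs 0
    have s1 := congrFun hs 1
    rw [Pi.smul_apply, e0, smul_zero] at s0
    rw [Pi.smul_apply, e1, smul_zero] at s1
    exact hν0 s0 s1
  obtain ⟨ε, hε⟩ := he.surf.exists_twist (fun σ hσ => hr _ (he.mem hσ) _ (he.normal hσ))
    (e.map_source hpe) hN
  have hext : ∀ e N, IsPatch X W P e N → ∀ q ∈ e.source, (∀ᶠ σ in nhds (e q),
      N σ 2 + ε * (N σ 1 * X (e.symm σ) 0 - N σ 0 * X (e.symm σ) 1) = 0) → ∀ q' ∈ e.source,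
      ∀ ν, P q' ν → ν 2 + ε * (ν 1 * X q' 0 - ν 0 * X q' 1) = 0 := by
    intro e N he q hq hev q' hq' ν hν
    have := he.surf.twist_relation_extend he.preconnected
      (fun σ hσ => hr _ (he.mem hσ) _ (he.normal hσ)) (e.map_source hq) hev (e.map_source hq')
    rw [e.left_inv hq'] at this
    rw [he.eq_smul hq' hν]
    simp only [Pi.smul_apply, smul_eq_mul]
    linear_combination (N (e q') ⬝ᵥ ν) * this
  refine Or.inr ⟨ε, fun q hq => ?_⟩
  -- The property is stated on neighbourhoods, since continuation within a patch starts from an open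
  -- set.
  have := h.forall_of_patch (Q := fun q => ∀ᶠ q' in nhds q, ∀ ν, P q' ν →
    ν 2 + ε * (ν 1 * X q' 0 - ν 0 * X q' 1) = 0) ?_ hp ?_ hq
  · exact this.self_of_nhds
  · intro e N he q hq q' hq' hQ
    filter_upwards [e.open_source.mem_nhds hq'] with q'' hq''
    refine hext e N he q hq ?_ q'' hq''
    have hcont : ContinuousAt e.symm (e q) := e.continuousAt_symm (e.map_source hq)
    rw [ContinuousAt, e.left_inv hq] at hcont
    filter_upwards [hcont.eventually hQ, e.open_target.mem_nhds (e.map_source hq)] with σ h1 h2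
    exact h1 _ (he.normal h2)
  · filter_upwards [e.open_source.mem_nhds hpe] with q hq
    exact hext e N he p hpe hε q hq

end Sheet

end Sheet

end Blackfold

namespace Blackfold

open Matrix

/-! ### Surfaces in Euclidean space, in coordinates -/

section Euclid

variable {U : Set (Fin 2 → ℝ)} {Y : (Fin 2 → ℝ) → Fin 3 → ℝ} {σ : Fin 2 → ℝ}

theorem tangent_eq (hY : DifferentiableAt ℝ Y σ) (i : Fin 3) (b : Fin 2) :
    tangent Y σ i b = fderiv ℝ Y σ (Pi.single b 1) i := by
  have h := (hasFDerivAt_pi'.mp hY.hasFDerivAt i).fderiv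
  rw [tangent, pd, h]
  rfl

theorem pd_tangent_eq (hU : IsOpen U) (hY : ContDiffOn ℝ ∞ Y U) (hσ : σ ∈ U) (i : Fin 3)
    (a b : Fin 2) : pd (fun z => tangent Y z i b) a σ =
      fderiv ℝ (fderiv ℝ Y) σ (Pi.single a 1) (Pi.single b 1) i := by
  have hd : ∀ τ ∈ U, DifferentiableAt ℝ Y τ := fun τ hτ =>
    (hY.contDiffAt (hU.mem_nhds hτ)).differentiableAt (by simp)
  have he : (fun z => tangent Y z i b) =ᶠ[nhds σ] fun z => fderiv ℝ Y z (Pi.single b 1) i := by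
    filter_upwards [hU.mem_nhds hσ] with z hz
    exact tangent_eq (hd z hz) i b
  have h1 : DifferentiableAt ℝ (fderiv ℝ Y) σ :=
    ((hY.contDiffAt (hU.mem_nhds hσ)).fderiv_right (m := ∞) le_rfl).differentiableAt (by simp)
  have h2 := (hasFDerivAt_pi'.mp
    (h1.hasFDerivAt.clm_apply (hasFDerivAt_const (Pi.single b 1 : Fin 2 → ℝ) σ)) i).fderiv
  rw [pd, he.fderiv_eq, h2]
  simp

theorem isConormal_iff (hY : DifferentiableAt ℝ Y σ) (N : Fin 3 → ℝ) :
    IsConormal Y σ N ↔ ∀ k, N ⬝ᵥ fderiv ℝ Y σ k = 0 := by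
  simp only [IsConormal, tangent_eq hY]
  constructor
  · intro h k
    have h0 := h 0
    have h1 := h 1
    rw [Fin.sum_univ_three, ← dot3] at h0 h1
    rw [Surf.apply_eq_single, dotProduct_add, dotProduct_smul, dotProduct_smul, h0, h1]
    simp
  · intro h a
    rw [Fin.sum_univ_three, ← dot3]
    exact h _

theorem inducedMetric_euclid (hY : DifferentiableAt ℝ Y σ) (a b : Fin 2) :
    inducedMetric (fun _ => 1) Y σ a b =
      fderiv ℝ Y σ (Pi.single a 1) ⬝ᵥ fderiv ℝ Y σ (Pi.single b 1) := by
  simp [inducedMetric, tangent_eq hY, dotProduct, Matrix.one_apply]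

theorem extrinsicCurvature_eq (hU : IsOpen U) (hY : ContDiffOn ℝ ∞ Y U) (hσ : σ ∈ U)
    (N : Fin 3 → ℝ) (a b : Fin 2) : extrinsicCurvature (fun _ => 1) Y σ N a b =
      N ⬝ᵥ fderiv ℝ (fderiv ℝ Y) σ (Pi.single a 1) (Pi.single b 1) := by
  simp [extrinsicCurvature_euclid, pd_tangent_eq hU hY hσ, dotProduct]

theorem det_inducedMetric (hY : DifferentiableAt ℝ Y σ) : (inducedMetric (fun _ => 1) Y σ).det =
    (fderiv ℝ Y σ (Pi.single 0 1) ⨯₃ fderiv ℝ Y σ (Pi.single 1 1)) ⬝ᵥ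
      (fderiv ℝ Y σ (Pi.single 0 1) ⨯₃ fderiv ℝ Y σ (Pi.single 1 1)) := by
  rw [det_fin_two, cross_dot_cross]
  simp only [inducedMetric_euclid hY]

/-- The mean curvature of a surface in `ℝ³`. -/
theorem meanCurvature_euclid (hU : IsOpen U) (hY : ContDiffOn ℝ ∞ Y U) (hσ : σ ∈ U)
    (N : Fin 3 → ℝ) : meanCurvature (fun _ => 1) Y σ N =
      ((inducedMetric (fun _ => 1) Y σ).det)⁻¹ *
      ((fderiv ℝ Y σ (Pi.single 1 1) ⬝ᵥ fderiv ℝ Y σ (Pi.single 1 1)) *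
          (N ⬝ᵥ fderiv ℝ (fderiv ℝ Y) σ (Pi.single 0 1) (Pi.single 0 1))
        - 2 * (fderiv ℝ Y σ (Pi.single 0 1) ⬝ᵥ fderiv ℝ Y σ (Pi.single 1 1)) *
          (N ⬝ᵥ fderiv ℝ (fderiv ℝ Y) σ (Pi.single 0 1) (Pi.single 1 1))
        + (fderiv ℝ Y σ (Pi.single 0 1) ⬝ᵥ fderiv ℝ Y σ (Pi.single 0 1)) *
          (N ⬝ᵥ fderiv ℝ (fderiv ℝ Y) σ (Pi.single 1 1) (Pi.single 1 1))) := by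
  have hd : DifferentiableAt ℝ Y σ := (hY.contDiffAt (hU.mem_nhds hσ)).differentiableAt (by simp)
  have hs : fderiv ℝ (fderiv ℝ Y) σ (Pi.single 1 1) (Pi.single 0 1) =
      fderiv ℝ (fderiv ℝ Y) σ (Pi.single 0 1) (Pi.single 1 1) :=
    ((hY.contDiffAt (hU.mem_nhds hσ)).isSymmSndFDerivAt (by
      simp only [minSmoothness_of_isRCLikeNormedField]; exact two_le_infty)).eq _ _
  rw [meanCurvature, Matrix.inv_def, adjugate_fin_two, Ring.inverse_eq_inv']
  simp only [Fin.sum_univ_two, extrinsicCurvature_eq hU hY hσ, Matrix.smul_apply, smul_eq_mul,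
    Matrix.of_apply, Matrix.cons_val_zero, Matrix.cons_val_one, inducedMetric_euclid hd, hs,
    Matrix.cons_val', Matrix.cons_val_fin_one]
  rw [dotProduct_comm (fderiv ℝ Y σ (Pi.single 1 1)) (fderiv ℝ Y σ (Pi.single 0 1))]
  ring

theorem cross_ne_zero (hi : Function.Injective (fderiv ℝ Y σ)) :
    fderiv ℝ Y σ (Pi.single 0 1) ⨯₃ fderiv ℝ Y σ (Pi.single 1 1) ≠ 0 := by
  intro h0
  set u := fderiv ℝ Y σ (Pi.single 0 1) with hu
  set w := fderiv ℝ Y σ (Pi.single 1 1) with hw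
  -- By the identity u × (u × w) = (u·w) u − (u·u) w this vector is in the kernel. Injectivity gives
  -- u = 0, which contradicts injectivity again.
  have key : fderiv ℝ Y σ ![u ⬝ᵥ w, -(u ⬝ᵥ u)] = 0 := by
    rw [Surf.apply_eq_single, ← hu, ← hw]
    have h1 := cross_cross_eq_smul_sub_smul' u u w
    rw [h0, map_zero] at h1
    simp only [cons_val_zero, cons_val_one, cons_val_fin_one, neg_smul]
    rw [← sub_eq_add_neg, ← h1]
  have h2 := congrFun (hi (key.trans (map_zero _).symm)) 1
  simp at h2
  have h3 : (Pi.single 0 1 : Fin 2 → ℝ) = 0 := by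
    apply hi
    rw [map_zero, ← hu, h2]
  simpa using congrFun h3 0

/-- The unit normal of an immersed surface. -/
def unitNormal (Y : (Fin 2 → ℝ) → Fin 3 → ℝ) (σ : Fin 2 → ℝ) : Fin 3 → ℝ :=
  (√((fderiv ℝ Y σ (Pi.single 0 1) ⨯₃ fderiv ℝ Y σ (Pi.single 1 1)) ⬝ᵥ
    (fderiv ℝ Y σ (Pi.single 0 1) ⨯₃ fderiv ℝ Y σ (Pi.single 1 1))))⁻¹ •
      (fderiv ℝ Y σ (Pi.single 0 1) ⨯₃ fderiv ℝ Y σ (Pi.single 1 1))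

theorem unitNormal_dot_fderiv (k : Fin 2 → ℝ) : unitNormal Y σ ⬝ᵥ fderiv ℝ Y σ k = 0 := by
  rw [unitNormal, smul_dotProduct, Surf.apply_eq_single (fderiv ℝ Y σ) k, dotProduct_add,
    dotProduct_smul, dotProduct_smul, dotProduct_comm _ (fderiv ℝ Y σ (Pi.single 0 1)),
    dotProduct_comm _ (fderiv ℝ Y σ (Pi.single 1 1)), dot_self_cross, dot_cross_self]
  simp

theorem contDiffOn_unitNormal (hU : IsOpen U) (hY : ContDiffOn ℝ ∞ Y U)
    (hi : ∀ σ ∈ U, Function.Injective (fderiv ℝ Y σ)) : ContDiffOn ℝ ∞ (unitNormal Y) U := by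
  have h1 : ∀ k : Fin 2 → ℝ, ContDiffOn ℝ ∞ (fun σ => fderiv ℝ Y σ k) U := fun k _ hσ =>
    (((hY.contDiffAt (hU.mem_nhds hσ)).fderiv_right (m := ∞) le_rfl).clm_apply
      contDiffAt_const).contDiffWithinAt
  have h2 := fun k => contDiffOn_pi.mp (h1 k)
  have h3 : ContDiffOn ℝ ∞ (fun σ => fderiv ℝ Y σ (Pi.single 0 1) ⨯₃
      fderiv ℝ Y σ (Pi.single 1 1)) U := by
    rw [contDiffOn_pi]
    intro i
    fin_cases i
    · simp only [Fin.zero_eta, cross3_zero]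
      exact ((h2 _ 1).mul (h2 _ 2)).sub ((h2 _ 2).mul (h2 _ 1))
    · simp only [Fin.mk_one, cross3_one]
      exact ((h2 _ 2).mul (h2 _ 0)).sub ((h2 _ 0).mul (h2 _ 2))
    · simp only [Fin.reduceFinMk, cross3_two]
      exact ((h2 _ 0).mul (h2 _ 1)).sub ((h2 _ 1).mul (h2 _ 0))
  have h4 := contDiffOn_pi.mp h3
  have h5 : ContDiffOn ℝ ∞ (fun σ => (fderiv ℝ Y σ (Pi.single 0 1) ⨯₃
      fderiv ℝ Y σ (Pi.single 1 1)) ⬝ᵥ (fderiv ℝ Y σ (Pi.single 0 1) ⨯₃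
      fderiv ℝ Y σ (Pi.single 1 1))) U := by
    simp only [dot3]
    exact (((h4 0).mul (h4 0)).add ((h4 1).mul (h4 1))).add ((h4 2).mul (h4 2))
  have h6 := fun σ hσ => dot3_self_pos (cross_ne_zero (hi σ hσ))
  exact ((h5.sqrt fun σ hσ => (h6 σ hσ).ne').inv fun σ hσ =>
    (Real.sqrt_pos.mpr (h6 σ hσ)).ne').smul h3

/-- An immersion with vanishing mean curvature is minimal. -/
theorem Surf.of_meanCurvature (hU : IsOpen U) (hY : ContDiffOn ℝ ∞ Y U)
    (hi : ∀ σ ∈ U, Function.Injective (fderiv ℝ Y σ))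
    (hm : ∀ σ ∈ U, ∀ N, IsConormal Y σ N → meanCurvature (fun _ => 1) Y σ N = 0) :
    Surf U Y (unitNormal Y) := by
  have hsm := contDiffOn_unitNormal hU hY hi
  refine ⟨hU, hY, hsm, fun σ hσ => ?_, fun σ _ k => unitNormal_dot_fderiv k, hi,
    fun σ hσ k l => ?_⟩
  · have hp := dot3_self_pos (cross_ne_zero (hi σ hσ))
    rw [unitNormal, smul_dotProduct, dotProduct_smul, smul_eq_mul, smul_eq_mul, ← mul_assoc,
      ← mul_inv, Real.mul_self_sqrt hp.le, inv_mul_cancel₀ hp.ne']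
  have hd : DifferentiableAt ℝ Y σ := (hY.contDiffAt (hU.mem_nhds hσ)).differentiableAt (by simp)
  have hp := dot3_self_pos (cross_ne_zero (hi σ hσ))
  have h1 := hm σ hσ (unitNormal Y σ) ((isConormal_iff hd _).mpr fun k => unitNormal_dot_fderiv k)
  rw [meanCurvature_euclid hU hY hσ, det_inducedMetric hd] at h1
  have h2 := (mul_eq_zero.mp h1).resolve_left (inv_ne_zero hp.ne')
  have hlN := fun k => hasDerivAt_pi.mp ((((hsm.contDiffAt (hU.mem_nhds hσ)).differentiableAt
    (by simp)).hasFDerivAt).hasLineDerivAt k)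
  have hlY : ∀ k l : Fin 2 → ℝ, ∀ i, HasDerivAt (fun t : ℝ => fderiv ℝ Y (σ + t • k) l i)
      (fderiv ℝ (fderiv ℝ Y) σ k l i) 0 := by
    intro k l i
    have h1 : DifferentiableAt ℝ (fderiv ℝ Y) σ :=
      ((hY.contDiffAt (hU.mem_nhds hσ)).fderiv_right (m := ∞) le_rfl).differentiableAt (by simp)
    have h2 := h1.hasFDerivAt.clm_apply (hasFDerivAt_const l σ)
    have h3 := hasDerivAt_pi.mp (h2.hasLineDerivAt k) i
    simpa using h3
  have hW : ∀ k l, unitNormal Y σ ⬝ᵥ fderiv ℝ (fderiv ℝ Y) σ k l =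
      -(fderiv ℝ (unitNormal Y) σ k ⬝ᵥ fderiv ℝ Y σ l) := by
    intro k l
    have hN := hlN k
    have hY := hlY k l
    have hd := ((((hN 0).mul (hY 0)).add ((hN 1).mul (hY 1))).add ((hN 2).mul (hY 2)))
    have := lineDeriv_eq_zero hU
      (F := fun σ => unitNormal Y σ 0 * fderiv ℝ Y σ l 0 + unitNormal Y σ 1 * fderiv ℝ Y σ l 1 +
        unitNormal Y σ 2 * fderiv ℝ Y σ l 2)
      (fun τ _ => by have := unitNormal_dot_fderiv (Y := Y) (σ := τ) l; rwa [dot3] at this) hσ hd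
    simp only [zero_smul, add_zero] at this
    rw [dot3, dot3]
    linear_combination this
  have hs : fderiv ℝ (fderiv ℝ Y) σ (Pi.single 1 1) (Pi.single 0 1) =
      fderiv ℝ (fderiv ℝ Y) σ (Pi.single 0 1) (Pi.single 1 1) :=
    ((hY.contDiffAt (hU.mem_nhds hσ)).isSymmSndFDerivAt (by
      simp only [minSmoothness_of_isRCLikeNormedField]; exact two_le_infty)).eq _ _
  have hs' := hW (Pi.single 1 1) (Pi.single 0 1)
  rw [hs, hW] at hs'
  rw [hW, hW, hW] at h2
  rw [Surf.apply_eq_single (fderiv ℝ Y σ) k, Surf.apply_eq_single (fderiv ℝ Y σ) l,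
    Surf.apply_eq_single (fderiv ℝ (unitNormal Y) σ) k, Surf.apply_eq_single (fderiv ℝ (unitNormal Y) σ) l]
  generalize fderiv ℝ (unitNormal Y) σ (Pi.single 0 1) = n0 at *
  generalize fderiv ℝ (unitNormal Y) σ (Pi.single 1 1) = n1 at *
  rw [unitNormal]
  generalize fderiv ℝ Y σ (Pi.single 0 1) = y0 at *
  generalize fderiv ℝ Y σ (Pi.single 1 1) = y1 at *
  rw [smul_dotProduct, smul_dotProduct]
  congr 1
  simp only [map_add, map_smul, LinearMap.add_apply, LinearMap.smul_apply, dotProduct_add,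
    dotProduct_smul, smul_eq_mul, cross_dot_cross]
  rw [dotProduct_comm y0 n0, dotProduct_comm y0 n1, dotProduct_comm y1 n0, dotProduct_comm y1 n1,
    dotProduct_comm y1 y0]
  -- The difference of the two sides is alternating in k and l; its coefficient is the numerator of
  -- the mean curvature, up to the symmetry `hs'`.
  linear_combination (k 0 * l 1 - k 1 * l 0) * (-h2 - (y0 ⬝ᵥ y1) * hs')

end Euclid

end Blackfold

namespace Blackfold

open Matrix

/-! ### Killing fields -/

section Killing

variable {n : ℕ} {A : Fin 3 ⊕ Fin n → ℝ} {V : (Fin 3 ⊕ Fin n → ℝ) → Fin 3 ⊕ Fin n → ℝ}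

theorem pd_stationaryField_t (i : Fin 2) (μ : Idx n) (x : Idx n → ℝ) :
    pd (fun z => stationaryField V z (Sum.inl i)) μ x = 0 := by
  simp only [stationaryField, Sum.elim_inl]
  exact pd_const _ _ _

theorem fderiv_stationaryField (hV : Differentiable ℝ V) (q : Fin 3 ⊕ Fin n) (x v : Idx n → ℝ) :
    fderiv ℝ (fun z => stationaryField V z (Sum.inr q)) x v =
      fderiv ℝ V (fun p => x (Sum.inr p)) (fun p => v (Sum.inr p)) q := by
  have h1 : HasFDerivAt (fun z : Idx n → ℝ => fun p => z (Sum.inr p))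
      (ContinuousLinearMap.pi fun p => ContinuousLinearMap.proj (R := ℝ)
        (φ := fun _ : Idx n => ℝ) (Sum.inr p)) x := by
    rw [hasFDerivAt_pi]
    exact fun p => hasFDerivAt_apply (𝕜 := ℝ) (Sum.inr p) x
  have h2 := (hasFDerivAt_pi'.mp (((hV _).hasFDerivAt).comp x h1) q).fderiv
  simp only [stationaryField, Sum.elim_inr]
  have h3 : fderiv ℝ (fun z : Idx n → ℝ => V (fun p => z (Sum.inr p)) q) x = _ := h2
  rw [h3]
  rfl

theorem pd_stationaryField_inl (hV : Differentiable ℝ V) (q : Fin 3 ⊕ Fin n) (i : Fin 2)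
    (x : Idx n → ℝ) : pd (fun z => stationaryField V z (Sum.inr q)) (Sum.inl i) x = 0 := by
  rw [pd, fderiv_stationaryField hV]
  have : (fun p => (Pi.single (Sum.inl i) 1 : Idx n → ℝ) (Sum.inr p)) = 0 := by
    ext p
    simp
  rw [this]
  simp

theorem pd_stationaryField_inr (hV : Differentiable ℝ V) (q p : Fin 3 ⊕ Fin n) (x : Idx n → ℝ) :
    pd (fun z => stationaryField V z (Sum.inr q)) (Sum.inr p) x =
      fderiv ℝ V (fun p => x (Sum.inr p)) (Pi.single p 1) q := by
  rw [pd, fderiv_stationaryField hV]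
  have : (fun r => (Pi.single (Sum.inr p) 1 : Idx n → ℝ) (Sum.inr r)) = Pi.single p 1 := by
    ext r
    simp [Pi.single_apply]
  rw [this]

/-- The Killing equation for `∂_t + V` in a plane wave. -/
theorem isKilling_iff (hV : Differentiable ℝ V) :
    IsKilling (planeWave A) (stationaryField V) ↔ (∀ x, ∑ q, A q * x q * V x q = 0) ∧
      ∀ x p q, fderiv ℝ V x (Pi.single p 1) q + fderiv ℝ V x (Pi.single q 1) p = 0 := by
  have hcoord : ∀ x : Fin 3 ⊕ Fin n → ℝ,
      x = fun p => (Sum.elim 0 x : Idx n → ℝ) (Sum.inr p) := fun x => rfl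
  constructor
  · intro h
    refine ⟨fun x => ?_, fun x p q => ?_⟩
    -- The tt-component says that V preserves the profile; the transverse components say that V is
    -- Killing in flat space.
    · have := h (Sum.elim 0 x) (Sum.inl 0) (Sum.inl 0)
      rw [Fintype.sum_sum_type] at this
      simp only [pd_planeWave_inl_inl, pd_profile_inl, pd_profile_inr, planeWave_inr_inl,
        planeWave_inl_inr, pd_stationaryField_t] at this
      simp only [neg_zero, mul_zero, add_zero, Finset.sum_const_zero, zero_mul, zero_add,
        stationaryField, Sum.elim_inr] at this
      rw [← mul_right_inj' (show (-2 : ℝ) ≠ 0 by norm_num), mul_zero, Finset.mul_sum, ← this]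
      refine Finset.sum_congr rfl fun q _ => ?_
      ring
    · have := h (Sum.elim 0 x) (Sum.inr p) (Sum.inr q)
      rw [Fintype.sum_sum_type] at this
      simp only [planeWave_inr_inl,
        planeWave_inl_inr, pd_stationaryField_t, planeWave_inr_inr,
        pd_stationaryField_inr hV] at this
      simp only [pd_const, mul_zero, add_zero, Finset.sum_const_zero, zero_mul, zero_add,
        Finset.sum_add_distrib, ite_mul, one_mul, Finset.sum_ite_eq', Finset.sum_ite_eq,
        Finset.mem_univ, if_true, Sum.elim_inr] at this
      exact this
  · rintro ⟨h1, h2⟩ x μ ν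
    rw [Fintype.sum_sum_type]
    rcases μ with i | p <;> rcases ν with j | q
    · simp only [pd_planeWave_inl_inl, pd_profile_inl, pd_profile_inr, planeWave_inr_inl,
        planeWave_inl_inr, pd_stationaryField_t]
      simp only [neg_zero, mul_zero, add_zero, Finset.sum_const_zero, zero_mul, zero_add,
        stationaryField, Sum.elim_inr]
      rw [← mul_zero (-2 : ℝ), ← h1 (fun q => x (Sum.inr q)), Finset.mul_sum]
      refine Finset.sum_congr rfl fun q _ => ?_
      ring
    · simp [pd_const, planeWave_inl_inr, pd_stationaryField_t,
        pd_stationaryField_inl hV, -Fintype.sum_sum_type]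
    · simp [pd_const, planeWave_inr_inl, pd_stationaryField_t,
        pd_stationaryField_inl hV, -Fintype.sum_sum_type]
    · simp only [planeWave_inr_inl,
        planeWave_inl_inr, pd_stationaryField_t, planeWave_inr_inr,
        pd_stationaryField_inr hV]
      simp only [pd_const, mul_zero, add_zero, Finset.sum_const_zero, zero_mul, zero_add,
        Finset.sum_add_distrib, ite_mul, one_mul, Finset.sum_ite_eq', Finset.sum_ite_eq,
        Finset.mem_univ, if_true]
      exact h2 _ p q

/-- The restriction to `ℝ³` of a transverse vector field. -/
def velocity (V : (Fin 3 ⊕ Fin n → ℝ) → Fin 3 ⊕ Fin n → ℝ) (x : Fin 3 → ℝ) : Fin 3 → ℝ :=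
  fun i => V (transverse n x) (Sum.inl i)

theorem hasFDerivAt_transverse (x : Fin 3 → ℝ) : HasFDerivAt (transverse n)
    (ContinuousLinearMap.pi fun p => Sum.elim (fun i => ContinuousLinearMap.proj (R := ℝ)
        (φ := fun _ : Fin 3 => ℝ) i) (fun _ => 0) p) x := by
  rw [hasFDerivAt_pi]
  rintro (i | j)
  · exact hasFDerivAt_apply i x
  · exact hasFDerivAt_const 0 x

theorem fderiv_velocity (hV : Differentiable ℝ V) (x : Fin 3 → ℝ) (i j : Fin 3) :
    fderiv ℝ (velocity V) x (Pi.single i 1) j =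
      fderiv ℝ V (transverse n x) (Pi.single (Sum.inl i) 1) (Sum.inl j) := by
  have h2 := hasFDerivAt_pi'.mp (((hV _).hasFDerivAt).comp x (hasFDerivAt_transverse x))
  have h3 : HasFDerivAt (velocity V) (ContinuousLinearMap.pi fun i : Fin 3 => _) x :=
    hasFDerivAt_pi.mpr fun i => h2 (Sum.inl i)
  rw [h3.fderiv]
  refine congrArg (fun w => fderiv ℝ V (transverse n x) w (Sum.inl j)) (funext fun p => ?_)
  rcases p with p | p <;> simp [Pi.single_apply]

theorem apply_eq_single_three {E : Type*} [NormedAddCommGroup E] [NormedSpace ℝ E]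
    (L : (Fin 3 → ℝ) →L[ℝ] E) (k : Fin 3 → ℝ) :
    L k = k 0 • L (Pi.single 0 1) + k 1 • L (Pi.single 1 1) + k 2 • L (Pi.single 2 1) := by
  rw [← map_smul, ← map_smul, ← map_smul, ← map_add, ← map_add]
  congr 1
  ext i
  fin_cases i <;> simp

/-- A vector field with antisymmetric gradient is an infinitesimal rigid motion. -/
theorem eq_add_cross_of_antisymm {v : (Fin 3 → ℝ) → Fin 3 → ℝ} (hv : ContDiff ℝ ∞ v)
    (h : ∀ x i j, fderiv ℝ v x (Pi.single i 1) j + fderiv ℝ v x (Pi.single j 1) i = 0) :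
    ∃ a b : Fin 3 → ℝ, ∀ x, v x = a + b ⨯₃ x := by
  have hd : Differentiable ℝ v := hv.differentiable (by simp)
  have hd2 : Differentiable ℝ (fderiv ℝ v) :=
    (hv.fderiv_right (m := ∞) le_rfl).differentiable (by simp)
  set T : (Fin 3 → ℝ) → Fin 3 → Fin 3 → Fin 3 → ℝ := fun x i j k =>
    fderiv ℝ (fderiv ℝ v) x (Pi.single i 1) (Pi.single j 1) k with hT
  have hsymm : ∀ x i j k, T x i j k = T x j i k := fun x i j k => congrFun
    ((hv.contDiffAt.isSymmSndFDerivAt (x := x) (by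
      simp only [minSmoothness_of_isRCLikeNormedField]; exact two_le_infty)).eq _ _) k
  have hanti : ∀ x i j k, T x i j k = -T x i k j := by
    intro x i j k
    have h1 : ∀ l m : Fin 3, HasFDerivAt (fun x => fderiv ℝ v x (Pi.single l 1) m) _ x :=
      fun l m => hasFDerivAt_pi'.mp (((hd2 x).hasFDerivAt).clm_apply
        (hasFDerivAt_const (Pi.single l 1 : Fin 3 → ℝ) x)) m
    have h2 := (h1 j k).add (h1 k j)
    have h3 : (fun x => fderiv ℝ v x (Pi.single j 1) k) + (fun x => fderiv ℝ v x (Pi.single k 1) j)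
      = fun _ => 0 := by
      ext x
      exact h x j k
    rw [h3] at h2
    have h4 := congrArg (fun L => L (Pi.single i 1)) (h2.unique (hasFDerivAt_const 0 x))
    simp at h4
    simp only [hT]
    linarith
  -- A tensor symmetric in its first two indices and antisymmetric in its last two vanishes.
  have hzero : ∀ x i j k, T x i j k = 0 := by
    intro x i j k
    have e1 := hanti x i j k
    have e2 := hsymm x i k j
    have e3 := hanti x k i j
    have e4 := hsymm x k j i
    have e5 := hanti x j k i
    have e6 := hsymm x j i k
    linarith
  have hconst : ∀ x, fderiv ℝ v x = fderiv ℝ v 0 := by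
    intro x
    refine is_const_of_fderiv_eq_zero hd2 (fun x => ?_) x 0
    ext u w k
    have hz : ∀ i j : Fin 3, fderiv ℝ (fderiv ℝ v) x (Pi.single i 1) (Pi.single j 1) = 0 :=
      fun i j => funext fun k => hzero x i j k
    rw [apply_eq_single_three (fderiv ℝ (fderiv ℝ v) x) u]
    simp only [_root_.add_apply, _root_.smul_apply]
    rw [apply_eq_single_three _ w, apply_eq_single_three (fderiv ℝ (fderiv ℝ v) x _) w,
      apply_eq_single_three (fderiv ℝ (fderiv ℝ v) x (Pi.single 2 1)) w]
    simp [hz]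
  have haff : ∀ x, v x = v 0 + fderiv ℝ v 0 x := by
    intro x
    have h1 : Differentiable ℝ fun x => v x - fderiv ℝ v 0 x :=
      hd.sub (fderiv ℝ v 0).differentiable
    have h2 := is_const_of_fderiv_eq_zero h1 (fun x => by
      rw [fderiv_fun_sub (hd x) (fderiv ℝ v 0).differentiableAt, ContinuousLinearMap.fderiv,
        hconst x, sub_self]) x 0
    simp only [map_zero, sub_zero] at h2
    rw [← h2]
    abel
  refine ⟨v 0, ![fderiv ℝ v 0 (Pi.single 1 1) 2, fderiv ℝ v 0 (Pi.single 2 1) 0,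
    fderiv ℝ v 0 (Pi.single 0 1) 1], fun x => ?_⟩
  rw [haff x]
  congr 1
  rw [apply_eq_single_three (fderiv ℝ v 0) x]
  have e := h 0
  ext i
  fin_cases i
  · simp [cross_apply]
    linear_combination x 0 / 2 * e 0 0 + x 1 * e 0 1
  · simp [cross_apply]
    linear_combination x 1 / 2 * e 1 1 + x 2 * e 1 2
  · simp [cross_apply]
    linear_combination x 2 / 2 * e 2 2 + x 0 * e 2 0

/-- The restriction to `ℝ³` of the field `V` of a Killing field `∂_t + V`. -/
theorem exists_rigid_motion (hV : ContDiff ℝ ∞ V)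
    (hK : IsKilling (planeWave A) (stationaryField V)) :
    ∃ a b : Fin 3 → ℝ, (∀ x, velocity V x = a + b ⨯₃ x) ∧ (∀ i, A (Sum.inl i) * a i = 0) ∧
      (A (Sum.inl 0) - A (Sum.inl 1)) * b 2 = 0 ∧ (A (Sum.inl 1) - A (Sum.inl 2)) * b 0 = 0 ∧
      (A (Sum.inl 2) - A (Sum.inl 0)) * b 1 = 0 := by
  have hd : Differentiable ℝ V := hV.differentiable (by simp)
  obtain ⟨h1, h2⟩ := (isKilling_iff hd).mp hK
  have hv : ContDiff ℝ ∞ (velocity V) := by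
    have ht : ContDiff ℝ ∞ (transverse n) := by
      rw [contDiff_pi]
      rintro (i | j)
      · exact contDiff_apply ℝ ℝ i
      · exact contDiff_const
    have := contDiff_pi.mp (hV.comp ht)
    exact contDiff_pi.mpr fun i => this (Sum.inl i)
  obtain ⟨a, b, hab⟩ := eq_add_cross_of_antisymm hv fun x i j => by
    rw [fderiv_velocity hd, fderiv_velocity hd]
    exact h2 _ _ _
  -- This polynomial is half the derivative of the profile along v. Evaluating it at e_i and at e_i
  -- + e_j reads off its coefficients.
  have key : ∀ x : Fin 3 → ℝ, A (Sum.inl 0) * x 0 * (a 0 + (b 1 * x 2 - b 2 * x 1)) +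
      A (Sum.inl 1) * x 1 * (a 1 + (b 2 * x 0 - b 0 * x 2)) +
      A (Sum.inl 2) * x 2 * (a 2 + (b 0 * x 1 - b 1 * x 0)) = 0 := by
    intro x
    have := h1 (transverse n x)
    rw [Fintype.sum_sum_type, Fin.sum_univ_three] at this
    have e := fun i => congrFun (hab x) i
    simp only [velocity, Pi.add_apply] at e
    rw [e, e, e] at this
    simp [transverse, cross_apply] at this
    linarith
  have hA : ∀ i, A (Sum.inl i) * a i = 0 := by
    intro i
    have := key (Pi.single i 1)
    fin_cases i <;> simpa using this
  have a0 := hA 0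
  have a1 := hA 1
  have a2 := hA 2
  refine ⟨a, b, hab, hA, ?_, ?_, ?_⟩
  · have := key ![1, 1, 0]
    simp at this
    linarith
  · have := key ![0, 1, 1]
    simp at this
    linarith
  · have := key ![1, 0, 1]
    simp at this
    linarith

end Killing

end Blackfold

namespace Blackfold

open Matrix

/-! ### From geometries to sheets -/

/-- The acceleration of the integral curves of an infinitesimal rigid motion tangent to a
surface. -/
theorem Surf.acceleration {U : Set (Fin 2 → ℝ)} {Y N : (Fin 2 → ℝ) → Fin 3 → ℝ} {σ : Fin 2 → ℝ}
    (h : Surf U Y N) {a b : Fin 3 → ℝ} (ht : ∀ σ ∈ U, N σ ⬝ᵥ (a + b ⨯₃ Y σ) = 0) (hσ : σ ∈ U)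
    {k : Fin 2 → ℝ} (hk : fderiv ℝ Y σ k = a + b ⨯₃ Y σ) :
    N σ ⬝ᵥ fderiv ℝ (fderiv ℝ Y) σ k k = N σ ⬝ᵥ (b ⨯₃ (a + b ⨯₃ Y σ)) := by
  have hN := h.lineN hσ k
  have hY := h.lineY hσ k
  have c0 := (((hY 2).const_mul (b 1)).sub ((hY 1).const_mul (b 2))).const_add (a 0)
  have c1 := (((hY 0).const_mul (b 2)).sub ((hY 2).const_mul (b 0))).const_add (a 1)
  have c2 := (((hY 1).const_mul (b 0)).sub ((hY 0).const_mul (b 1))).const_add (a 2)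
  have hd := (((hN 0).mul c0).add ((hN 1).mul c1)).add ((hN 2).mul c2)
  -- Differentiating N · v = 0 in the single direction k suffices; no extension of k to a field is
  -- needed.
  have := lineDeriv_eq_zero h.isOpen (F := fun σ =>
    N σ 0 * (a 0 + (b 1 * Y σ 2 - b 2 * Y σ 1)) + N σ 1 * (a 1 + (b 2 * Y σ 0 - b 0 * Y σ 2)) +
      N σ 2 * (a 2 + (b 0 * Y σ 1 - b 1 * Y σ 0))) (fun τ hτ => by
        have := ht τ hτ
        simp only [dot3, Pi.add_apply, cross3_zero, cross3_one, cross3_two] at this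
        exact this) hσ hd
  rw [h.normal_dot_second hσ, ← hk]
  simp only [zero_smul, add_zero, Pi.sub_apply] at this
  have e0 := congrFun hk 0
  have e1 := congrFun hk 1
  have e2 := congrFun hk 2
  simp only [dot3, Pi.add_apply, cross3_zero, cross3_one, cross3_two] at *
  linear_combination -this - fderiv ℝ N σ k 0 * e0 - fderiv ℝ N σ k 1 * e1 - fderiv ℝ N σ k 2 * e2

section Geometry

variable {n : ℕ} {A : Fin 3 ⊕ Fin n → ℝ} {V : (Fin 3 ⊕ Fin n → ℝ) → Fin 3 ⊕ Fin n → ℝ}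
  {M : Type*} [TopologicalSpace M] [ChartedSpace (Fin 2 → ℝ) M]
  {X : M → Fin 3 → ℝ} {W : Set M}

/-- `ν` is normal to the surface `X` at `q`. -/
def IsNormalAt (X : M → Fin 3 → ℝ) (q : M) (ν : Fin 3 → ℝ) : Prop :=
  ∀ e ∈ atlas (Fin 2 → ℝ) M, q ∈ e.source → ∀ k, ν ⬝ᵥ fderiv ℝ (X ∘ e.symm) (e q) k = 0

section Smooth

variable [IsManifold 𝓘(ℝ, Fin 2 → ℝ) ∞ M]

theorem contDiffOn_comp_symm (hX : ContMDiff 𝓘(ℝ, Fin 2 → ℝ) 𝓘(ℝ, Fin 3 → ℝ) ∞ X)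
    {e : OpenPartialHomeomorph M (Fin 2 → ℝ)} (he : e ∈ atlas (Fin 2 → ℝ) M) :
    ContDiffOn ℝ ∞ (X ∘ e.symm) e.target :=
  contMDiffOn_iff_contDiffOn.mp (hX.comp_contMDiffOn (contMDiffOn_symm_of_mem_maximalAtlas
    (IsManifold.subset_maximalAtlas he)))

/-- Transition maps are differentiable, so by the chain rule orthogonality in one chart gives it in
all. -/
theorem isNormalAt_iff (hX : ContMDiff 𝓘(ℝ, Fin 2 → ℝ) 𝓘(ℝ, Fin 3 → ℝ) ∞ X)
    {e : OpenPartialHomeomorph M (Fin 2 → ℝ)} (he : e ∈ atlas (Fin 2 → ℝ) M) {q : M}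
    (hq : q ∈ e.source) (ν : Fin 3 → ℝ) :
    IsNormalAt X q ν ↔ ∀ k, ν ⬝ᵥ fderiv ℝ (X ∘ e.symm) (e q) k = 0 := by
  refine ⟨fun h => h e he hq, fun h e' he' hq' k => ?_⟩
  have h1 : DifferentiableAt ℝ (X ∘ e.symm) (e q) :=
    ((contDiffOn_comp_symm hX he).contDiffAt (e.open_target.mem_nhds (e.map_source hq))).differentiableAt
      (by simp)
  have ho : IsOpen (e'.target ∩ e'.symm ⁻¹' e.source) :=
    e'.isOpen_inter_preimage_symm e.open_source
  have hm : e' q ∈ e'.target ∩ e'.symm ⁻¹' e.source :=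
    ⟨e'.map_source hq', by rwa [Set.mem_preimage, e'.left_inv hq']⟩
  have h2 : ContDiffOn ℝ ∞ (e ∘ e'.symm) (e'.target ∩ e'.symm ⁻¹' e.source) :=
    contMDiffOn_iff_contDiffOn.mp ((contMDiffOn_of_mem_maximalAtlas
      (IsManifold.subset_maximalAtlas he)).comp ((contMDiffOn_symm_of_mem_maximalAtlas
      (IsManifold.subset_maximalAtlas he')).mono Set.inter_subset_left) fun z hz => hz.2)
  have h3 : DifferentiableAt ℝ (e ∘ e'.symm) (e' q) :=
    (h2.contDiffAt (ho.mem_nhds hm)).differentiableAt (by simp)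
  have h4 : X ∘ e'.symm =ᶠ[nhds (e' q)] (X ∘ e.symm) ∘ (e ∘ e'.symm) := by
    filter_upwards [ho.mem_nhds hm] with z hz
    simp [e.left_inv hz.2]
  have h5 : (e ∘ e'.symm) (e' q) = e q := by simp [e'.left_inv hq']
  rw [← h5] at h1 h
  rw [h4.fderiv_eq, fderiv_comp _ h1 h3]
  exact h _

namespace IsStationaryTypeI

/-- Every point of a stationary Type I geometry has a patch inside a chart of the atlas. -/
theorem exists_patch (h : IsStationaryTypeI A V X W) {p : M} (hp : p ∈ W) :
    ∃ e₀ ∈ atlas (Fin 2 → ℝ) M, ∃ e : OpenPartialHomeomorph M (Fin 2 → ℝ), p ∈ e.source ∧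
      e.source ⊆ e₀.source ∧ (e : M → Fin 2 → ℝ) = e₀ ∧ (e.symm : (Fin 2 → ℝ) → M) = e₀.symm ∧
      IsPatch X W (IsNormalAt X) e (unitNormal (X ∘ e₀.symm)) := by
  have he₀ := chart_mem_atlas (Fin 2 → ℝ) p
  have hpe := mem_chart_source (Fin 2 → ℝ) p
  generalize chartAt (Fin 2 → ℝ) p = e₀ at *
  have ho : IsOpen (e₀.target ∩ e₀.symm ⁻¹' W) := e₀.isOpen_inter_preimage_symm h.isOpen
  obtain ⟨δ, hδ, hB⟩ := Metric.isOpen_iff.mp ho (e₀ p)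
    ⟨e₀.map_source hpe, by rwa [Set.mem_preimage, e₀.left_inv hpe]⟩
  -- Restricting on the coordinate side makes the target a ball, hence connected. The restricted
  -- chart need not belong to the atlas, so `e₀` is kept for the hypotheses on atlas charts.
  set e := (e₀.symm.restr (Metric.ball (e₀ p) δ)).symm with he
  have ht : e.target = Metric.ball (e₀ p) δ := by
    simp only [he, OpenPartialHomeomorph.symm_target, OpenPartialHomeomorph.restr_source,
      Metric.isOpen_ball.interior_eq, OpenPartialHomeomorph.symm_source]
    exact Set.inter_eq_right.mpr fun σ hσ => (hB hσ).1
  have hs : e.source = e₀.source ∩ e₀ ⁻¹' Metric.ball (e₀ p) δ := by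
    simp only [he, OpenPartialHomeomorph.symm_source, OpenPartialHomeomorph.restr_target,
      Metric.isOpen_ball.interior_eq, OpenPartialHomeomorph.symm_target,
      OpenPartialHomeomorph.symm_symm]
  have h1 : (e : M → Fin 2 → ℝ) = e₀ := rfl
  have h2 : (e.symm : (Fin 2 → ℝ) → M) = e₀.symm := rfl
  refine ⟨e₀, he₀, e, ?_, ?_, h1, h2, ?_, ?_, ?_, ?_⟩
  · rw [hs]
    exact ⟨hpe, Metric.mem_ball_self hδ⟩
  · rw [hs]
    exact Set.inter_subset_left
  · intro q hq
    rw [hs] at hq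
    have := (hB hq.2).2
    rwa [Set.mem_preimage, e₀.left_inv hq.1] at this
  · rw [ht]
    exact (convex_ball _ _).isPreconnected
  · rw [ht]
    refine Surf.of_meanCurvature Metric.isOpen_ball
      ((contDiffOn_comp_symm h.smooth he₀).mono fun σ hσ => (hB hσ).1) (fun σ hσ => ?_)
      (fun σ hσ N hN => ?_)
    · have := h.immersion e₀ he₀ (e₀.symm σ) (e₀.map_target (hB hσ).1)
      rwa [e₀.right_inv (hB hσ).1] at this
    · have := h.minimal e₀ he₀ (e₀.symm σ) ⟨e₀.map_target (hB hσ).1, (hB hσ).2⟩ N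
      rw [e₀.right_inv (hB hσ).1] at this
      exact this hN
  · intro q hq ν
    rw [hs] at hq
    exact isNormalAt_iff h.smooth he₀ hq.1 ν

theorem sheet (h : IsStationaryTypeI A V X W) : Sheet X W (IsNormalAt X) where
  isConnected := h.isConnected
  patch p hp := by
    obtain ⟨e₀, -, e, hpe, -, -, -, he⟩ := h.exists_patch hp
    exact ⟨e, _, hpe, he⟩

end IsStationaryTypeI

end Smooth

/-- The velocity field is tangent to the surface. -/
theorem IsStationaryTypeI.exists_fderiv (h : IsStationaryTypeI A V X W)
    {e : OpenPartialHomeomorph M (Fin 2 → ℝ)} (he : e ∈ atlas (Fin 2 → ℝ) M) {q : M}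
    (hq : q ∈ e.source ∩ W) (hd : DifferentiableAt ℝ (X ∘ e.symm) (e q)) :
    (∃ k, fderiv ℝ (X ∘ e.symm) (e q) k = velocity V (X q)) ∧
      ∀ j, V (transverse n (X q)) (Sum.inr j) = 0 := by
  obtain ⟨k, hk⟩ := h.tangency e he q hq 0
  rw [mapsToField_iff] at hk
  obtain ⟨-, hk, hk'⟩ := hk
  have hq' : (X ∘ e.symm) (e q) = X q := by simp [e.left_inv hq.1]
  rw [Fin.tail_cons] at hk hk'
  rw [hq'] at hk hk'
  refine ⟨⟨fun b => k b.succ, ?_⟩, hk'⟩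
  ext i
  have := hk i
  simp only [tangent_eq hd, Fin.sum_univ_two] at this
  rw [Surf.apply_eq_single]
  simp only [Pi.add_apply, Pi.smul_apply, smul_eq_mul]
  rw [velocity, ← this]
  ring

theorem modulusSq_velocity {x : Fin 3 → ℝ} (h0 : ∀ j, V (transverse n x) (Sum.inr j) = 0) : modulusSq A V x =
    1 + x ⬝ᵥ ((fun i => A (Sum.inl i)) * x) - velocity V x ⬝ᵥ velocity V x := by
  rw [modulusSq_eq]
  simp only [h0, dotProduct, velocity, Pi.mul_apply, Fin.sum_univ_three]
  simp
  ring

end Geometry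

end Blackfold

/-! ### The extrinsic equation as a vector equation in ℝ³. -/

namespace Blackfold

open Matrix

section Equation

variable {n : ℕ} {A : Fin 3 ⊕ Fin n → ℝ} {V : (Fin 3 ⊕ Fin n → ℝ) → Fin 3 ⊕ Fin n → ℝ}

theorem forceDot_eq (N x : Fin 3 → ℝ) :
    forceDot A N x = N ⬝ᵥ ((fun i => A (Sum.inl i)) * x) := rfl

theorem sum_profile_eq (x : Fin 3 → ℝ) :
    ∑ i, A (Sum.inl i) * x i ^ 2 = x ⬝ᵥ ((fun i => A (Sum.inl i)) * x) := by
  simp only [dotProduct, Pi.mul_apply]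
  exact Finset.sum_congr rfl fun i _ => by ring

/-- Timelikeness of ∂_t + V implies timelikeness of ∂_t, which makes the induced metric invertible.
-/
theorem one_add_profile_pos {x : Fin 3 → ℝ} (h : 0 < modulusSq A V x) :
    0 < 1 + x ⬝ᵥ ((fun i => A (Sum.inl i)) * x) := by
  rw [modulusSq_eq, sum_profile_eq] at h
  have h1 : 0 ≤ ∑ i, V (transverse n x) (Sum.inl i) ^ 2 := Finset.sum_nonneg fun _ _ => sq_nonneg _
  have h2 : 0 ≤ ∑ j, V (transverse n x) (Sum.inr j) ^ 2 := Finset.sum_nonneg fun _ _ => sq_nonneg _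
  linarith

theorem sum_extrinsicCurvature_euclid {U : Set (Fin 2 → ℝ)} {Y : (Fin 2 → ℝ) → Fin 3 → ℝ}
    {σ : Fin 2 → ℝ} (hU : IsOpen U) (hY : ContDiffOn ℝ ∞ Y U) (hσ : σ ∈ U) (N : Fin 3 → ℝ)
    (k : Fin 2 → ℝ) : ∑ a, ∑ b, k a * k b * extrinsicCurvature (fun _ => 1) Y σ N a b =
      N ⬝ᵥ fderiv ℝ (fderiv ℝ Y) σ k k := by
  simp only [extrinsicCurvature_eq hU hY hσ, Fin.sum_univ_two]
  rw [Surf.apply_eq_single (fderiv ℝ (fderiv ℝ Y) σ) k]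
  simp only [_root_.add_apply, _root_.smul_apply]
  rw [Surf.apply_eq_single (fderiv ℝ (fderiv ℝ Y) σ (Pi.single 0 1)) k,
    Surf.apply_eq_single (fderiv ℝ (fderiv ℝ Y) σ (Pi.single 1 1)) k]
  simp only [dotProduct_add, dotProduct_smul, smul_eq_mul]
  ring

variable {M : Type*} [TopologicalSpace M] [ChartedSpace (Fin 2 → ℝ) M]
  [IsManifold 𝓘(ℝ, Fin 2 → ℝ) ∞ M] {X : M → Fin 3 → ℝ} {W : Set M}

/-- The extrinsic equation as an equation between vectors of `ℝ³`. -/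
theorem extrinsicEquation_vector (hn : 1 ≤ n) (h : IsStationaryTypeI A V X W)
    (hE : ExtrinsicEquation A V X W) {a b : Fin 3 → ℝ} (hv : ∀ x, velocity V x = a + b ⨯₃ x)
    {q : M} (hq : q ∈ W) {ν : Fin 3 → ℝ} (hν : IsNormalAt X q ν) :
    ν ⬝ᵥ (a + b ⨯₃ X q) = 0 ∧
    0 < 1 + X q ⬝ᵥ ((fun i => A (Sum.inl i)) * X q) - (a + b ⨯₃ X q) ⬝ᵥ (a + b ⨯₃ X q) ∧
    ν ⬝ᵥ (b ⨯₃ (a + b ⨯₃ X q)) +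
      (1 + (1 + X q ⬝ᵥ ((fun i => A (Sum.inl i)) * X q) -
        (a + b ⨯₃ X q) ⬝ᵥ (a + b ⨯₃ X q)) /
          (n * (1 + X q ⬝ᵥ ((fun i => A (Sum.inl i)) * X q)))) *
        (ν ⬝ᵥ ((fun i => A (Sum.inl i)) * X q)) = 0 := by
  obtain ⟨e₀, he₀, e, hqe, hsub, hee, hes, he⟩ := h.exists_patch hq
  have hqe₀ := hsub hqe
  have hsurf := he.surf
  have hσ := e.map_source hqe
  have hnormal := he.eq_smul hqe hν
  rw [hee] at hσ hnormal
  have hYeq : (fun σ => X (e.symm σ)) = X ∘ e₀.symm := by rw [hes]; rfl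
  have htarget : ∀ σ ∈ e.target, e₀.symm σ ∈ e₀.source ∩ W ∧ e₀ (e₀.symm σ) = σ := by
    intro σ hσ
    have h1 := e.map_target hσ
    have h2 := e.right_inv hσ
    rw [hes] at h1 h2
    rw [hee] at h2
    exact ⟨⟨hsub h1, he.subset h1⟩, h2⟩
  rw [hYeq] at hsurf
  set Y := X ∘ e₀.symm with hY
  set N := unitNormal Y with hN
  have hYq : Y (e₀ q) = X q := by simp [hY, e₀.left_inv hqe₀]
  have hd := fun σ hσ => hsurf.differentiableAt (σ := σ) hσ
  have htan : ∀ σ ∈ e.target, N σ ⬝ᵥ (a + b ⨯₃ Y σ) = 0 := by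
    intro σ hσ
    obtain ⟨h1, h2⟩ := htarget σ hσ
    obtain ⟨⟨k, hk⟩, -⟩ := h.exists_fderiv he₀ h1 (by rw [h2]; exact hd σ hσ)
    rw [h2, hv] at hk
    have := hsurf.normal σ hσ k
    rw [hk] at this
    exact this
  obtain ⟨-, hV0⟩ := h.exists_fderiv he₀ ⟨hqe₀, hq⟩ (hd _ hσ)
  have hpos := h.timelike q hq
  have hQ := one_add_profile_pos hpos
  rw [modulusSq_velocity hV0, hv] at hpos
  refine ⟨?_, hpos, ?_⟩
  · rw [hnormal, smul_dotProduct, ← hYq, htan _ hσ, smul_zero]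
  obtain ⟨k, hk, hEq⟩ := hE e₀ he₀ q ⟨hqe₀, hq⟩ 0
  -- A conormal with vanishing dy part removes the mixed curvature components.
  set L : Idx n → ℝ := Sum.elim 0 (Sum.elim (N (e₀ q)) 0) with hL
  have hsp : spatial L = N (e₀ q) := rfl
  have hL0 : L (Sum.inl 0) = 0 := rfl
  have hL1 : L (Sum.inl 1) = 0 := rfl
  have hcon : IsConormal Y (e₀ q) (N (e₀ q)) := (isConormal_iff (hd _ hσ) _).mpr (hsurf.normal _ hσ)
  have h1 := hEq L ((isConormal_typeI_iff _ _ _).mpr ⟨hL0, by rw [Fin.tail_cons, hsp]; exact hcon⟩)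
  rw [mapsToField_iff] at hk
  obtain ⟨hk0, hk1, -⟩ := hk
  simp only [Fin.tail_cons, ← hY, hYq] at hk1
  have hdet : IsUnit (inducedMetric (fun _ => 1) Y (e₀ q)).det := by
    rw [det_inducedMetric (hd _ hσ)]
    exact (dot3_self_pos (cross_ne_zero (hsurf.injective _ hσ))).ne'.isUnit
  rw [meanCurvature_typeI A _ _ _ (by rw [Fin.tail_cons, ← hY, hYq, sum_profile_eq]; exact hQ.ne')
    (by rw [Fin.tail_cons]; exact hdet) hL0, sum_extrinsicCurvature_typeI A _ _ _ hL0, hsp, hL1,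
    Fin.tail_cons, ← hY, hYq, sum_profile_eq, forceDot_eq,
    h.minimal e₀ he₀ q ⟨hqe₀, hq⟩ _ hcon] at h1
  have hkk : fderiv ℝ Y (e₀ q) (fun b => k b.succ) = a + b ⨯₃ X q := by
    rw [← hv]
    ext i
    have := hk1 i
    simp only [tangent_eq (hd _ hσ), Fin.sum_univ_two] at this
    rw [Surf.apply_eq_single]
    simp only [Pi.add_apply, Pi.smul_apply, smul_eq_mul]
    rw [velocity, ← this]
    ring
  -- The purely spatial part of the right-hand side is the normal acceleration of the rigid motion,
  -- divided by 𝐤².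
  have hacc := hsurf.acceleration htan hσ (by rw [hkk, hYq])
  rw [← sum_extrinsicCurvature_euclid hsurf.isOpen hsurf.smooth hσ, hYq] at hacc
  have hm : modulusSq A V (X q) = 1 + X q ⬝ᵥ ((fun i => A (Sum.inl i)) * X q) -
      (a + b ⨯₃ X q) ⬝ᵥ (a + b ⨯₃ X q) := by rw [modulusSq_velocity hV0, hv]
  have hsum : ∑ c : Fin 2, ∑ d : Fin 2, k c.succ / √(modulusSq A V (X q)) *
      (k d.succ / √(modulusSq A V (X q))) * extrinsicCurvature (fun _ => 1) Y (e₀ q) (N (e₀ q)) c d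
      = (modulusSq A V (X q))⁻¹ * (N (e₀ q) ⬝ᵥ (b ⨯₃ (a + b ⨯₃ X q))) := by
    rw [← hacc, Finset.mul_sum]
    refine Finset.sum_congr rfl fun c _ => ?_
    rw [Finset.mul_sum]
    refine Finset.sum_congr rfl fun d _ => ?_
    have := Real.mul_self_sqrt (hm ▸ hpos).le
    rw [div_mul_div_comm, this]
    ring
  rw [hsum, hk0, div_pow, Real.sq_sqrt (hm ▸ hpos).le, hm] at h1
  have hn' : (n : ℝ) ≠ 0 := by
    have : (1 : ℝ) ≤ n := by exact_mod_cast hn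
    linarith
  have hpos' := hpos.ne'
  have hQ' := hQ.ne'
  rw [hnormal]
  simp only [smul_dotProduct, smul_eq_mul]
  generalize (a + b ⨯₃ X q) ⬝ᵥ (a + b ⨯₃ X q) = vv at *
  generalize X q ⬝ᵥ ((fun i => A (Sum.inl i)) * X q) = Q at *
  generalize N (e₀ q) ⬝ᵥ (b ⨯₃ (a + b ⨯₃ X q)) = B at *
  generalize N (e₀ q) ⬝ᵥ ((fun i => A (Sum.inl i)) * X q) = F at *
  generalize N (e₀ q) ⬝ᵥ ν = c at *
  simp only [mul_zero, zero_mul, sub_zero, add_zero] at h1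
  field_simp at h1 ⊢
  linear_combination (-c) * h1

end Equation

end Blackfold

namespace Blackfold

open Matrix

/-! ### Frames -/

/-- The rows are u, e × u, e for a unit vector u orthogonal to e. Determinant 1, and not just
orthogonality, is needed for cross products to be preserved. -/
theorem exists_frame {e : Fin 3 → ℝ} (he : e ⬝ᵥ e = 1) :
    ∃ R : Matrix (Fin 3) (Fin 3) ℝ, R * Rᵀ = 1 ∧ R.det = 1 ∧ Rᵀ *ᵥ Pi.single 2 1 = e := by
  obtain ⟨w, hw⟩ : ∃ w : Fin 3 → ℝ, e ⨯₃ w ≠ 0 := by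
    by_contra! hall
    have h0 := congrFun (hall (Pi.single 0 1)) 2
    have h1 := congrFun (hall (Pi.single 1 1)) 0
    have h2 := congrFun (hall (Pi.single 1 1)) 2
    rw [cross3_two] at h0
    rw [cross3_zero] at h1
    rw [cross3_two] at h2
    simp at h0 h1 h2
    rw [dot3, h0, h1, h2] at he
    norm_num at he
  have hp := dot3_self_pos hw
  set s : ℝ := (√((e ⨯₃ w) ⬝ᵥ (e ⨯₃ w)))⁻¹ with hs
  set u : Fin 3 → ℝ := s • (e ⨯₃ w) with hu
  have huu : u ⬝ᵥ u = 1 := by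
    rw [hu, smul_dotProduct, dotProduct_smul, smul_eq_mul, smul_eq_mul, ← mul_assoc, hs,
      ← mul_inv, Real.mul_self_sqrt hp.le, inv_mul_cancel₀ hp.ne']
  have hue : u ⬝ᵥ e = 0 := by
    rw [hu, smul_dotProduct, dotProduct_comm, dot_self_cross, smul_zero]
  have hR : (of ![u, e ⨯₃ u, e]) * (of ![u, e ⨯₃ u, e])ᵀ = 1 := by
    rw [dot3] at huu hue he
    ext i j
    rw [Matrix.mul_apply, Fin.sum_univ_three]
    fin_cases i <;> fin_cases j <;>
      simp [cross_apply]
    · linear_combination huu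
    · ring
    · linear_combination hue
    · ring
    · linear_combination (u 0 * u 0 + u 1 * u 1 + u 2 * u 2) * he -
        (u 0 * e 0 + u 1 * e 1 + u 2 * e 2) * hue + huu
    · ring
    · linear_combination hue
    · ring
    · linear_combination he
  refine ⟨of ![u, e ⨯₃ u, e], hR, ?_, ?_⟩
  · have h1 := triple_product_eq_det u (e ⨯₃ u) e
    have h2 : (of ![u, e ⨯₃ u, e]).det = u ⬝ᵥ ((e ⨯₃ u) ⨯₃ e) := h1.symm
    rw [h2]
    simp only [dot3, cross3_zero, cross3_one, cross3_two] at *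
    linear_combination (u 0 * u 0 + u 1 * u 1 + u 2 * u 2) * he -
        (u 0 * e 0 + u 1 * e 1 + u 2 * e 2) * hue + huu
  · ext i
    simp [mulVec, dotProduct, Fin.sum_univ_three]

theorem mulVec_cross {R : Matrix (Fin 3) (Fin 3) ℝ} (hR : R * Rᵀ = 1) (hd : R.det = 1)
    (a b : Fin 3 → ℝ) : (R *ᵥ a) ⨯₃ (R *ᵥ b) = R *ᵥ (a ⨯₃ b) := by
  have h1 : ∀ c, c ⬝ᵥ ((R *ᵥ a) ⨯₃ (R *ᵥ b)) = c ⬝ᵥ (R *ᵥ (a ⨯₃ b)) := by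
    intro c
    have hc : c = R *ᵥ (Rᵀ *ᵥ c) := by rw [mulVec_mulVec, hR, one_mulVec]
    rw [hc, mulVec_triple, mulVec_dot_mulVec hR, hd, one_mul]
  ext i
  simpa using h1 (Pi.single i 1)

/-- A profile that commutes with the rotations about `e` is isotropic orthogonally to `e`. -/
theorem exists_axial_profile {A e : Fin 3 → ℝ} (he : e ⬝ᵥ e = 1) (h2 : (A 0 - A 1) * e 2 = 0)
    (h0 : (A 1 - A 2) * e 0 = 0) (h1 : (A 2 - A 0) * e 1 = 0) :
    ∃ la mu : ℝ, ((∀ i, A i = la) ∧ mu = la) ∨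
      ∃ k, (e = Pi.single k 1 ∨ e = -Pi.single k 1) ∧ A k = mu ∧ ∀ i, i ≠ k → A i = la := by
  rw [dot3] at he
  by_cases e01 : A 0 = A 1
  · by_cases e12 : A 1 = A 2
    · refine ⟨A 0, A 0, Or.inl ⟨fun i => ?_, rfl⟩⟩
      fin_cases i
      exacts [rfl, e01.symm, (e01.trans e12).symm]
    · have z0 := (mul_eq_zero.mp h0).resolve_left (sub_ne_zero.mpr e12)
      have z1 := (mul_eq_zero.mp h1).resolve_left (sub_ne_zero.mpr fun h => e12 (e01 ▸ h.symm))
      refine ⟨A 0, A 2, Or.inr ⟨2, ?_, rfl, fun i hi => ?_⟩⟩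
      · rw [z0, z1] at he
        rcases mul_self_eq_one_iff.mp (by linarith : e 2 * e 2 = 1) with h | h
        · left; ext i; fin_cases i <;> simp [z0, z1, h]
        · right; ext i; fin_cases i <;> simp [z0, z1, h]
      · fin_cases i
        exacts [rfl, e01.symm, (hi rfl).elim]
  · have z2 := (mul_eq_zero.mp h2).resolve_left (sub_ne_zero.mpr e01)
    by_cases e12 : A 1 = A 2
    · have z1 := (mul_eq_zero.mp h1).resolve_left (sub_ne_zero.mpr fun h => e01 (e12 ▸ h.symm))
      refine ⟨A 1, A 0, Or.inr ⟨0, ?_, rfl, fun i hi => ?_⟩⟩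
      · rw [z2, z1] at he
        rcases mul_self_eq_one_iff.mp (by linarith : e 0 * e 0 = 1) with h | h
        · left; ext i; fin_cases i <;> simp [z2, z1, h]
        · right; ext i; fin_cases i <;> simp [z2, z1, h]
      · fin_cases i
        exacts [(hi rfl).elim, rfl, e12.symm]
    · have z0 := (mul_eq_zero.mp h0).resolve_left (sub_ne_zero.mpr e12)
      by_cases e20 : A 2 = A 0
      · refine ⟨A 0, A 1, Or.inr ⟨1, ?_, rfl, fun i hi => ?_⟩⟩
        · rw [z2, z0] at he
          rcases mul_self_eq_one_iff.mp (by linarith : e 1 * e 1 = 1) with h | h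
          · left; ext i; fin_cases i <;> simp [z2, z0, h]
          · right; ext i; fin_cases i <;> simp [z2, z0, h]
        · fin_cases i
          exacts [rfl, (hi rfl).elim, e20]
      · have z1 := (mul_eq_zero.mp h1).resolve_left (sub_ne_zero.mpr e20)
        rw [z0, z1, z2] at he
        norm_num at he

/-- One formula serves both alternatives, since the second term drops out in the isotropic one; e
enters quadratically, so its sign is irrelevant. -/
theorem axial_profile_mul {A e : Fin 3 → ℝ} {la mu : ℝ}
    (h : ((∀ i, A i = la) ∧ mu = la) ∨
      ∃ k, (e = Pi.single k 1 ∨ e = -Pi.single k 1) ∧ A k = mu ∧ ∀ i, i ≠ k → A i = la)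
    (x : Fin 3 → ℝ) : A * x = la • x + ((mu - la) * (e ⬝ᵥ x)) • e := by
  rcases h with ⟨h1, h2⟩ | ⟨k, hk, hmu, hla⟩
  · ext i
    simp [h1, h2]
  · ext i
    by_cases hi : i = k
    · subst hi
      rcases hk with rfl | rfl <;> simp [hmu] <;> ring
    · rcases hk with rfl | rfl <;> simp [hla i hi, hi]

theorem eq_frame {R : Matrix (Fin 3) (Fin 3) ℝ} (hR : R * Rᵀ = 1) (x₀ x : Fin 3 → ℝ) :
    x = x₀ + Rᵀ *ᵥ (R *ᵥ (x - x₀)) := by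
  rw [mulVec_mulVec, mul_eq_one_comm.mp hR, one_mulVec, add_sub_cancel]

theorem transpose_frame {R : Matrix (Fin 3) (Fin 3) ℝ} (hR : R * Rᵀ = 1) : Rᵀ * (Rᵀ)ᵀ = 1 := by
  rw [transpose_transpose]
  exact mul_eq_one_comm.mp hR

/-- A surface ruled as in `Sheet.ruled` with `ε ≠ 0` lies in a helicoid. -/
theorem liesInHelicoid_of_ruled {M : Type*} {X : M → Fin 3 → ℝ} {W : Set M} {A e x₀ : Fin 3 → ℝ} {R : Matrix (Fin 3) (Fin 3) ℝ}
    (hR : R * Rᵀ = 1) (he : Rᵀ *ᵥ Pi.single 2 1 = e) {ε θ : ℝ} (hε : ε ≠ 0)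
    (hX : ∀ q ∈ W, ∃ r : ℝ, (R *ᵥ (X q - x₀)) 0 = r * Real.cos (ε * (R *ᵥ (X q - x₀)) 2 + θ) ∧
      (R *ᵥ (X q - x₀)) 1 = r * Real.sin (ε * (R *ᵥ (X q - x₀)) 2 + θ))
    (hk : ∃ k, A k = 0 ∧ (∀ i j, i ≠ k → j ≠ k → A i = A j) ∧
      ((∃ i, A i ≠ 0) → x₀ = 0 ∧ (e = Pi.single k 1 ∨ e = -Pi.single k 1))) :
    LiesInHelicoid A (X '' W) := by
  -- The phase θ is absorbed by a shift of −θ/ε along the axis, which leaves the axis itself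
  -- unchanged.
  refine ⟨Rᵀ, ?_, x₀ + (-(θ / ε)) • e, 1 / ε, one_div_ne_zero hε, ?_, ?_⟩
  · rw [mem_orthogonalGroup_iff]
    exact transpose_frame hR
  · rintro _ ⟨q, hq, rfl⟩
    obtain ⟨r, h0, h1⟩ := hX q hq
    set Z := R *ᵥ (X q - x₀) with hZ
    refine ⟨![r, ε * Z 2 + θ], ?_⟩
    have h2 : helicoid (1 / ε) ![r, ε * Z 2 + θ] = Z + (θ / ε) • Pi.single 2 1 := by
      ext i
      fin_cases i
      · simp [helicoid, h0]
      · simp [helicoid, h1]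
      · simp [helicoid]
        field_simp
    change _ + Rᵀ *ᵥ _ = _
    rw [h2, mulVec_add, mulVec_smul, he, hZ]
    nth_rewrite 2 [eq_frame hR x₀ (X q)]
    module
  · obtain ⟨k, hk0, hk1, hk2⟩ := hk
    refine ⟨k, hk0, hk1, fun hA => ?_⟩
    obtain ⟨rfl, hek⟩ := hk2 hA
    rw [he, zero_add]
    ext x
    constructor
    · rintro ⟨r, rfl⟩
      rcases hek with h | h
      · exact ⟨r - θ / ε, by simp only [h]; module⟩
      · exact ⟨θ / ε - r, by simp only [h]; module⟩
    · rintro ⟨r, rfl⟩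
      rcases hek with h | h
      · exact ⟨r + θ / ε, by simp only [h]; module⟩
      · exact ⟨θ / ε - r, by simp only [h]; module⟩

/-! ### Solutions that rotate about the x_3-axis. -/

section Classification

variable {M : Type*} [TopologicalSpace M] {X : M → Fin 3 → ℝ} {W : Set M}
  {P : M → (Fin 3 → ℝ) → Prop}

namespace Sheet

/-- Stationary solutions which rotate about the `x_3`-axis, in a wave that is isotropic about that
axis. -/
theorem rotating (h : Sheet X W P) {m la mu al be : ℝ} (hm : 0 < m) (hbe : be ≠ 0)
    (hal : mu ≠ 0 → al = 0)
    (ht : ∀ q ∈ W, ∀ ν, P q ν → be * (ν 1 * X q 0 - ν 0 * X q 1) + al * ν 2 = 0)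
    (hk : ∀ q ∈ W, 0 < 1 + (la * (X q 0 ^ 2 + X q 1 ^ 2) + mu * X q 2 ^ 2) -
      (be ^ 2 * (X q 0 ^ 2 + X q 1 ^ 2) + al ^ 2))
    (hf : ∀ q ∈ W, ∀ ν, P q ν → -be ^ 2 * (ν 0 * X q 0 + ν 1 * X q 1) +
      (1 + (1 + (la * (X q 0 ^ 2 + X q 1 ^ 2) + mu * X q 2 ^ 2) -
        (be ^ 2 * (X q 0 ^ 2 + X q 1 ^ 2) + al ^ 2)) /
        (m * (1 + (la * (X q 0 ^ 2 + X q 1 ^ 2) + mu * X q 2 ^ 2)))) *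
      (la * (ν 0 * X q 0 + ν 1 * X q 1) + mu * (ν 2 * X q 2)) = 0) :
    (∀ q ∈ W, X q 2 = 0) ∨ mu = 0 ∧ ((∀ q ∈ W, ∀ ν, P q ν → ν 0 = 0 ∧ ν 1 = 0) ∨
      al ≠ 0 ∧ (∀ q ∈ W, ∀ ν, P q ν → ν 0 * X q 0 + ν 1 * X q 1 = 0) ∧
      ∀ q ∈ W, ∀ ν, P q ν → ν 2 + be / al * (ν 1 * X q 0 - ν 0 * X q 1) = 0) := by
  by_cases hmu : mu = 0
  · refine Or.inr ⟨hmu, ?_⟩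
    subst hmu
    have hr : ∀ q ∈ W, ∀ ν, P q ν → ν 0 * X q 0 + ν 1 * X q 1 = 0 := by
      intro q hq ν hν
      obtain ⟨e, N, hqe, he⟩ := h.patch q hq
      have key := he.surf.radial_of_screw (m := m) (la := la) (be := be) (al := al) hm hbe
        (fun σ hσ => by have := hk _ (he.mem hσ); linarith)
        (fun σ hσ => by
          have := hf _ (he.mem hσ) _ (he.normal hσ)
          simp only [zero_mul, add_zero] at this
          rw [← this, sub_sub, add_comm (al ^ 2)]
          ring) (e.map_source hqe)
      rw [e.left_inv hqe] at key
      rw [he.eq_smul hqe hν]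
      simp only [Pi.smul_apply, smul_eq_mul]
      linear_combination (N (e q) ⬝ᵥ ν) * key
    by_cases hal0 : al = 0
    · left
      subst hal0
      intro q hq ν hν
      obtain ⟨e, N, hqe, he⟩ := h.patch q hq
      have key := he.surf.horizontal_of_radial_rotation
        (fun σ hσ => hr _ (he.mem hσ) _ (he.normal hσ))
        (fun σ hσ => by
          have := ht _ (he.mem hσ) _ (he.normal hσ)
          rw [zero_mul, add_zero] at this
          exact (mul_eq_zero.mp this).resolve_left hbe) (e.map_source hqe)
      rw [he.eq_smul hqe hν]
      simp [key.1, key.2]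
    · refine Or.inr ⟨hal0, hr, fun q hq ν hν => ?_⟩
      have := ht q hq ν hν
      field_simp
      linear_combination this
  · left
    have := hal hmu
    subst this
    intro q hq
    obtain ⟨e, N, hqe, he⟩ := h.patch q hq
    have key := he.surf.height_eq_zero (m := m) (la := la) (mu := mu) (be := be) hm hmu
      (fun σ hσ => by
          have := ht _ (he.mem hσ) _ (he.normal hσ)
          rw [zero_mul, add_zero] at this
          exact (mul_eq_zero.mp this).resolve_left hbe)
      (fun σ hσ => by have := hk _ (he.mem hσ); linarith)
      (fun σ hσ => by
          have := hf _ (he.mem hσ) _ (he.normal hσ)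
          rw [zero_pow two_ne_zero, add_zero] at this
          linear_combination this) (e.map_source hqe)
    rwa [e.left_inv hqe] at key

end Sheet

end Classification

end Blackfold

/-! ### Classification of static, translating and rotating solutions. -/

namespace Blackfold

open Matrix

namespace Sheet

variable {M : Type*} [TopologicalSpace M] {X : M → Fin 3 → ℝ} {W : Set M}
  {P : M → (Fin 3 → ℝ) → Prop}

theorem flat_of_const (h : Sheet X W P) {A c : Fin 3 → ℝ} (hc : c ≠ 0)
    (ht : ∀ q ∈ W, ∀ ν, P q ν → ν ⬝ᵥ c = 0)
    (hA : ∀ q ∈ W, ∀ ν, P q ν → ν ⬝ᵥ (A * X q) = 0) : LiesInPlane A (X '' W) :=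
  h.liesInPlane_of_flat (fun _ _ he _ hσ => he.surf.dN_eq_zero_of_const hc
    (fun _ hτ => ht _ (he.mem hτ) _ (he.normal hτ)) hσ) hA

theorem transpose_single_ne_zero {R : Matrix (Fin 3) (Fin 3) ℝ} (hR : R * Rᵀ = 1) (i : Fin 3) :
    Rᵀ *ᵥ Pi.single i 1 ≠ 0 := by
  intro h0
  have := congrArg (fun x => (R *ᵥ x) i) h0
  simp only [mulVec_mulVec, hR, one_mulVec, mulVec_zero] at this
  simp at this

theorem dot_transpose (R : Matrix (Fin 3) (Fin 3) ℝ) (a b : Fin 3 → ℝ) :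
    a ⬝ᵥ (Rᵀ *ᵥ b) = (R *ᵥ a) ⬝ᵥ b := by
  rw [dotProduct_mulVec, vecMul_transpose]

/-- The static solutions in a wave that acts orthogonally to an axis. -/
theorem static_axial (h : Sheet X W P) {A : Fin 3 → ℝ} {la : ℝ} {k : Fin 3} (hla : la ≠ 0)
    (hk : A k = 0) (hA : ∀ i, i ≠ k → A i = la)
    (hf : ∀ q ∈ W, ∀ ν, P q ν → ν ⬝ᵥ (A * X q) = 0) :
    LiesInPlane A (X '' W) ∨ LiesInHelicoid A (X '' W) := by
  have he : (Pi.single k 1 : Fin 3 → ℝ) ⬝ᵥ Pi.single k 1 = 1 := by simp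
  obtain ⟨R, hR, -, hRe⟩ := exists_frame he
  have hmul := axial_profile_mul (A := A) (e := Pi.single k 1) (la := la) (mu := 0)
    (Or.inr ⟨k, Or.inl rfl, hk, hA⟩)
  have hPR : ∀ q ν, P q ν → P q (Rᵀ *ᵥ (R *ᵥ ν)) := by
    intro q ν hν
    rwa [mulVec_mulVec, mul_eq_one_comm.mp hR, one_mulVec]
  have h' := h.rigid hR 0
  simp only [sub_zero] at h'
  have hX : ∀ q, X q = Rᵀ *ᵥ (R *ᵥ X q) := by
    intro q
    rw [mulVec_mulVec, mul_eq_one_comm.mp hR, one_mulVec]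
  have hr : ∀ q ∈ W, ∀ ν, P q (Rᵀ *ᵥ ν) → ν 0 * (R *ᵥ X q) 0 + ν 1 * (R *ᵥ X q) 1 = 0 := by
    intro q hq ν hν
    have h1 := hf q hq _ hν
    rw [hmul, dotProduct_add, dotProduct_smul, dotProduct_smul, ← hRe, hX q,
      mulVec_dot_mulVec (transpose_frame hR), mulVec_dot_mulVec (transpose_frame hR),
      mulVec_dot_mulVec (transpose_frame hR), dot3] at h1
    simp only [dotProduct_single_one, single_one_dotProduct, smul_eq_mul] at h1
    apply mul_left_cancel₀ hla
    linear_combination h1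
  rcases h'.exists_twist hr with hv | ⟨ε, hε⟩
  · left
    refine h.flat_of_const (c := Rᵀ *ᵥ Pi.single 0 1) (transpose_single_ne_zero hR 0)
      (fun q hq ν hν => ?_) hf
    rw [dot_transpose, dotProduct_single_one]
    exact (hv q hq _ (hPR q ν hν)).1
  · obtain ⟨θ, hθ⟩ := h'.ruled hr hε
    by_cases hε0 : ε = 0
    · left
      subst hε0
      simp only [zero_mul, zero_add] at hθ
      -- For ε = 0 all rulings are parallel and the surface lies in a plane through the axis, so d =
      -- 0 and the eigenvalue may be non-zero.
      refine ⟨Rᵀ *ᵥ ![-Real.sin θ, Real.cos θ, 0], 0, la, ?_, ?_, fun i => ?_, mul_zero _⟩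
      · intro h0
        have := congrArg (fun x => R *ᵥ x) h0
        simp only [mulVec_mulVec, hR, one_mulVec, mulVec_zero] at this
        have h1 := congrFun this 0
        have h2 := congrFun this 1
        simp at h1 h2
        have := Real.sin_sq_add_cos_sq θ
        rw [h1, h2] at this
        norm_num at this
      · rintro _ ⟨q, hq, rfl⟩
        obtain ⟨r, h0, h1⟩ := hθ q hq
        rw [dotProduct_comm, dot_transpose, dot3, h0, h1]
        simp
        ring
      · have := congrFun (hmul (Rᵀ *ᵥ ![-Real.sin θ, Real.cos θ, 0])) i
        rw [← hRe, mulVec_dot_mulVec (transpose_frame hR)] at this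
        simpa using this
    · right
      refine liesInHelicoid_of_ruled (x₀ := 0) hR hRe hε0 (θ := θ) (by simpa using hθ)
        ⟨k, hk, fun i j hi hj => by rw [hA i hi, hA j hj], fun _ => ⟨rfl, Or.inl rfl⟩⟩

/-- The static solutions. -/
theorem static (h : Sheet X W P) {A : Fin 3 → ℝ} (hA : ∃ i, A i ≠ 0)
    (hf : ∀ q ∈ W, ∀ ν, P q ν → ν ⬝ᵥ (A * X q) = 0) :
    LiesInPlane A (X '' W) ∨ LiesInHelicoid A (X '' W) := by
  -- If no non-zero entry differs from both others, then either one entry vanishes and the other two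
  -- are equal, or all three are equal and non-zero.
  by_cases h1 : ∃ i, A i ≠ 0 ∧ ∀ j, j ≠ i → A i ≠ A j
  · obtain ⟨i, hi, hij⟩ := h1
    exact Or.inl (h.liesInPlane_of_flat (fun _ _ he _ hσ => he.surf.flat_of_force
      (fun _ hτ => hf _ (he.mem hτ) _ (he.normal hτ)) hi hij hσ) hf)
  push Not at h1
  by_cases h2 : ∃ k, A k = 0
  · obtain ⟨k, hk⟩ := h2
    obtain ⟨i, hi⟩ := hA
    refine h.static_axial hi hk (fun j hj => ?_) hf
    obtain ⟨l, hl, hil⟩ := h1 i hi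
    by_cases hji : j = i
    · rw [hji]
    · have hlk : l ≠ k := by
        rintro rfl
        exact hi (hil.trans hk)
      have hik : i ≠ k := by
        rintro rfl
        exact hi hk
      have : j = l := by omega
      rw [this, hil]
  · push Not at h2
    left
    have hall : ∀ i, A i = A 0 := by
      obtain ⟨l0, hl0, e0⟩ := h1 0 (h2 0)
      obtain ⟨l1, hl1, e1⟩ := h1 1 (h2 1)
      obtain ⟨l2, hl2, e2⟩ := h1 2 (h2 2)
      have d0 : A 0 = A 1 ∨ A 0 = A 2 := by
        fin_cases l0
        exacts [(hl0 rfl).elim, Or.inl e0, Or.inr e0]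
      have d1 : A 1 = A 0 ∨ A 1 = A 2 := by
        fin_cases l1
        exacts [Or.inl e1, (hl1 rfl).elim, Or.inr e1]
      have d2 : A 2 = A 0 ∨ A 2 = A 1 := by
        fin_cases l2
        exacts [Or.inl e2, Or.inr e2, (hl2 rfl).elim]
      intro i
      fin_cases i
      · rfl
      · change A 1 = A 0
        rcases d0 with d | d <;> rcases d1 with d' | d' <;> rcases d2 with d'' | d'' <;> linarith
      · change A 2 = A 0
        rcases d0 with d | d <;> rcases d1 with d' | d' <;> rcases d2 with d'' | d'' <;> linarith
    refine h.liesInPlane_of_flat (fun _ _ he _ hσ => he.surf.flat_of_cone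
      (fun τ hτ => ?_) hσ) hf
    have := hf _ (he.mem hτ) _ (he.normal hτ)
    rw [dot3] at this ⊢
    simp only [Pi.mul_apply, hall] at this
    apply mul_left_cancel₀ (h2 0)
    linear_combination this

/-- The solutions which rotate. -/
theorem classification_of_rotation (h : Sheet X W P) {A a b : Fin 3 → ℝ} {m : ℝ} (hm : 0 < m)
    (ha : ∀ i, A i * a i = 0) (h2 : (A 0 - A 1) * b 2 = 0) (h0 : (A 1 - A 2) * b 0 = 0)
    (h1 : (A 2 - A 0) * b 1 = 0) (hb : b ≠ 0)
    (ht : ∀ q ∈ W, ∀ ν, P q ν → ν ⬝ᵥ (a + b ⨯₃ X q) = 0)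
    (hk : ∀ q ∈ W, 0 < 1 + X q ⬝ᵥ (A * X q) - (a + b ⨯₃ X q) ⬝ᵥ (a + b ⨯₃ X q))
    (hf : ∀ q ∈ W, ∀ ν, P q ν → ν ⬝ᵥ (b ⨯₃ (a + b ⨯₃ X q)) +
      (1 + (1 + X q ⬝ᵥ (A * X q) - (a + b ⨯₃ X q) ⬝ᵥ (a + b ⨯₃ X q)) /
        (m * (1 + X q ⬝ᵥ (A * X q)))) * (ν ⬝ᵥ (A * X q)) = 0) :
    LiesInPlane A (X '' W) ∨ LiesInHelicoid A (X '' W) := by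
  have hbb := dot3_self_pos hb
  set be : ℝ := √(b ⬝ᵥ b) with hbe
  have hbe0 : be ≠ 0 := (Real.sqrt_pos.mpr hbb).ne'
  have hbe2 : be * be = b ⬝ᵥ b := Real.mul_self_sqrt hbb.le
  obtain ⟨e, hbe'⟩ : ∃ e, b = be • e := ⟨be⁻¹ • b, by rw [smul_smul, mul_inv_cancel₀ hbe0, one_smul]⟩
  have he : e ⬝ᵥ e = 1 := by
    have h3 := hbe2
    rw [hbe', smul_dotProduct, dotProduct_smul, smul_eq_mul, smul_eq_mul] at h3
    apply mul_left_cancel₀ (mul_ne_zero hbe0 hbe0)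
    linear_combination -h3
  clear_value be
  subst hbe'
  simp only [Pi.smul_apply, smul_eq_mul] at h0 h1 h2
  simp only [map_smul, LinearMap.smul_apply] at ht hk hf
  obtain ⟨la, mu, hax⟩ := exists_axial_profile he
    (mul_left_cancel₀ hbe0 (by linear_combination h2) : (A 0 - A 1) * e 2 = 0)
    (mul_left_cancel₀ hbe0 (by linear_combination h0) : (A 1 - A 2) * e 0 = 0)
    (mul_left_cancel₀ hbe0 (by linear_combination h1) : (A 2 - A 0) * e 1 = 0)
  have hmul := axial_profile_mul hax
  obtain ⟨R, hR, hdet, hRe⟩ := exists_frame he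
  have hRT := transpose_frame hR
  have hdT : (Rᵀ).det = 1 := by rw [det_transpose, hdet]
  set al : ℝ := e ⬝ᵥ a with hal
  -- The point x₀ lies on the screw axis: there the velocity is parallel to e.
  set x₀ : Fin 3 → ℝ := be⁻¹ • (e ⨯₃ a) with hx₀
  have hex₀ : e ⬝ᵥ x₀ = 0 := by rw [hx₀, dotProduct_smul, dot_self_cross, smul_zero]
  have hax₀ : a + be • e ⨯₃ x₀ = al • e := by
    rw [hx₀, map_smul, smul_smul, mul_inv_cancel₀ hbe0, one_smul, cross_cross_eq_smul_sub_smul',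
      he, hal]
    module
  have haA : A * a = 0 := funext ha
  have hlaa : la • (e ⨯₃ a) = 0 := by
    have h3 := hmul a
    rw [haA] at h3
    have h4 := congrArg (fun x => e ⨯₃ x) h3
    simp only [map_zero, map_add, map_smul, cross_self, smul_zero, add_zero] at h4
    exact h4.symm
  -- From A a = 0: the axis passes through the origin unless λ = 0, so moving the origin to x₀ does
  -- not change A X. Likewise a wave acting along the axis excludes a translation (`hmual`).
  have hlax₀ : la • x₀ = 0 := by rw [hx₀, smul_comm, hlaa, smul_zero]
  have hmual : mu * al = 0 := by
    have h3 := congrArg (fun x => e ⬝ᵥ x) (hmul a)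
    simp only [haA, dotProduct_zero, dotProduct_add, dotProduct_smul, he, smul_eq_mul] at h3
    rw [hal]
    linear_combination -h3
  set Z : M → Fin 3 → ℝ := fun q => R *ᵥ (X q - x₀) with hZ
  have hX : ∀ q, X q = x₀ + Rᵀ *ᵥ Z q := fun q => eq_frame hR x₀ (X q)
  have h' : Sheet Z W (fun q ν => P q (Rᵀ *ᵥ ν)) := h.rigid hR x₀
  clear_value Z
  have heX : ∀ q, e ⬝ᵥ X q = Z q 2 := by
    intro q
    rw [hX q, dotProduct_add, hex₀, zero_add]
    nth_rewrite 1 [← hRe]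
    rw [mulVec_dot_mulVec hRT, single_one_dotProduct]
  have hlaX : ∀ q, la • X q = Rᵀ *ᵥ (la • Z q) := by
    intro q
    rw [hX q, smul_add, hlax₀, zero_add, mulVec_smul]
  have hAX : ∀ q, A * X q = Rᵀ *ᵥ ![la * Z q 0, la * Z q 1, mu * Z q 2] := by
    intro q
    rw [hmul, hlaX, heX]
    nth_rewrite 1 [← hRe]
    rw [← mulVec_smul, ← mulVec_add]
    congr 1
    ext i
    fin_cases i
    · simp
    · simp
    · simp
      ring
  have hXAX : ∀ q, X q ⬝ᵥ (A * X q) = la * (Z q 0 ^ 2 + Z q 1 ^ 2) + mu * Z q 2 ^ 2 := by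
    intro q
    rw [hmul, dotProduct_add, dotProduct_smul, dotProduct_smul, dotProduct_comm (X q) e, heX,
      ← smul_dotProduct, hlaX, mulVec_smul, smul_dotProduct, hX q, dotProduct_add,
      mulVec_dot_mulVec hRT, smul_add, dotProduct_comm _ x₀, ← smul_dotProduct, hlax₀,
      zero_dotProduct, dot3]
    simp only [smul_eq_mul]
    ring
  have hv : ∀ q, a + be • e ⨯₃ X q = Rᵀ *ᵥ ![-(be * Z q 1), be * Z q 0, al] := by
    intro q
    rw [hX q, map_add, smul_add, ← add_assoc, hax₀]
    nth_rewrite 1 2 [← hRe]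
    rw [mulVec_cross hRT hdT, ← mulVec_smul, ← mulVec_smul, ← mulVec_add]
    congr 1
    ext i
    fin_cases i <;> simp [cross_apply]
  have hbv : ∀ q, be • e ⨯₃ (a + be • e ⨯₃ X q) =
      Rᵀ *ᵥ ![-(be ^ 2 * Z q 0), -(be ^ 2 * Z q 1), 0] := by
    intro q
    rw [hv]
    nth_rewrite 1 [← hRe]
    rw [mulVec_cross hRT hdT, ← mulVec_smul]
    congr 1
    ext i
    fin_cases i <;> simp [cross_apply] <;> ring
  have hvv : ∀ q, (a + be • e ⨯₃ X q) ⬝ᵥ (a + be • e ⨯₃ X q) =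
      be ^ 2 * (Z q 0 ^ 2 + Z q 1 ^ 2) + al ^ 2 := by
    intro q
    rw [hv, mulVec_dot_mulVec hRT, dot3]
    simp
    ring
  have hPR : ∀ q ν, P q ν → P q (Rᵀ *ᵥ (R *ᵥ ν)) := by
    intro q ν hν
    rwa [mulVec_mulVec, mul_eq_one_comm.mp hR, one_mulVec]
  rcases h'.rotating (m := m) (la := la) (mu := mu) (al := al) (be := be) hm hbe0
    (fun hmu => (mul_eq_zero.mp hmual).resolve_left hmu)
    (fun q hq ν hν => by
      have h3 := ht q hq _ hν
      rw [hv, mulVec_dot_mulVec hRT, dot3] at h3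
      simp at h3
      linear_combination h3)
    (fun q hq => by
      have h3 := hk q hq
      rwa [hXAX, hvv] at h3)
    (fun q hq ν hν => by
      have h3 := hf q hq _ hν
      rw [hXAX, hvv, hbv, hAX, mulVec_dot_mulVec hRT, mulVec_dot_mulVec hRT, dot3, dot3] at h3
      simp only [cons_val_zero, cons_val_one, cons_val] at h3
      linear_combination h3) with h3 | ⟨rfl, h3 | ⟨hal0, hr, hε⟩⟩
  · left
    refine ⟨e, 0, mu, ?_, ?_, fun i => ?_, mul_zero _⟩
    · rintro rfl
      simp at he
    · rintro _ ⟨q, hq, rfl⟩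
      rw [heX, h3 q hq]
    · have h4 := congrFun (hmul e) i
      rw [he] at h4
      simp only [Pi.mul_apply, Pi.add_apply, Pi.smul_apply, smul_eq_mul] at h4
      linear_combination h4
  · left
    refine h.flat_of_const (c := Rᵀ *ᵥ Pi.single 0 1) (transpose_single_ne_zero hR 0)
      (fun q hq ν hν => ?_) (fun q hq ν hν => ?_)
    · rw [dot_transpose, dotProduct_single_one]
      exact (h3 q hq _ (hPR q ν hν)).1
    · obtain ⟨h4, h5⟩ := h3 q hq _ (hPR q ν hν)
      rw [hAX, dot_transpose, dot3, h4, h5]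
      simp
  · right
    obtain ⟨θ, hθ⟩ := h'.ruled hr hε
    rw [hZ] at hθ
    refine liesInHelicoid_of_ruled (x₀ := x₀) hR hRe (div_ne_zero hbe0 hal0) hθ ?_
    rcases hax with ⟨hl, hl0⟩ | ⟨k, hek, hk0, hkl⟩
    · refine ⟨0, by rw [hl, ← hl0], fun i j _ _ => by rw [hl, hl], ?_⟩
      rintro ⟨i, hi⟩
      exact (hi (by rw [hl, ← hl0])).elim
    · refine ⟨k, hk0, fun i j hi hj => by rw [hkl i hi, hkl j hj], ?_⟩
      rintro ⟨i, hi⟩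
      refine ⟨?_, hek⟩
      have hik : i ≠ k := by
        rintro rfl
        exact hi hk0
      rw [hkl i hik] at hi
      exact (smul_eq_zero.mp hlax₀).resolve_left hi

/-- The classification of the surfaces that solve the extrinsic equation. -/
theorem classification (h : Sheet X W P) {A a b : Fin 3 → ℝ} {m : ℝ} (hm : 0 < m)
    (ha : ∀ i, A i * a i = 0) (h2 : (A 0 - A 1) * b 2 = 0) (h0 : (A 1 - A 2) * b 0 = 0)
    (h1 : (A 2 - A 0) * b 1 = 0) (hne : a ≠ 0 ∨ b ≠ 0 ∨ ∃ i, A i ≠ 0)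
    (ht : ∀ q ∈ W, ∀ ν, P q ν → ν ⬝ᵥ (a + b ⨯₃ X q) = 0)
    (hk : ∀ q ∈ W, 0 < 1 + X q ⬝ᵥ (A * X q) - (a + b ⨯₃ X q) ⬝ᵥ (a + b ⨯₃ X q))
    (hf : ∀ q ∈ W, ∀ ν, P q ν → ν ⬝ᵥ (b ⨯₃ (a + b ⨯₃ X q)) +
      (1 + (1 + X q ⬝ᵥ (A * X q) - (a + b ⨯₃ X q) ⬝ᵥ (a + b ⨯₃ X q)) /
        (m * (1 + X q ⬝ᵥ (A * X q)))) * (ν ⬝ᵥ (A * X q)) = 0) :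
    LiesInPlane A (X '' W) ∨ LiesInHelicoid A (X '' W) := by
  by_cases hb : b = 0
  · subst hb
    simp only [map_zero, LinearMap.zero_apply, add_zero, dotProduct_zero, zero_add] at ht hk hf
    have hf' : ∀ q ∈ W, ∀ ν, P q ν → ν ⬝ᵥ (A * X q) = 0 := by
      intro q hq ν hν
      -- Without rotation there is no acceleration, and the factor of the force is at least 1.
      refine (mul_eq_zero.mp (hf q hq ν hν)).resolve_left ?_
      have h3 := hk q hq
      have h4 : 0 ≤ a ⬝ᵥ a := by
        rw [dot3]
        nlinarith [mul_self_nonneg (a 0), mul_self_nonneg (a 1), mul_self_nonneg (a 2)]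
      have h5 : 0 < 1 + X q ⬝ᵥ (A * X q) := by linarith
      positivity
    by_cases ha0 : a = 0
    · refine h.static ?_ hf'
      simpa [ha0] using hne
    · exact Or.inl (h.flat_of_const ha0 ht hf')
  · exact h.classification_of_rotation hm ha h2 h0 h1 hb ht hk hf

end Sheet

/-- A non-trivial stationary Type I geometry that solves the extrinsic equation lies in a plane or
in a helicoid. -/
theorem liesInPlane_or_liesInHelicoid {n : ℕ} (hn : 1 ≤ n) {A : Fin 3 ⊕ Fin n → ℝ}
    {M : Type*} [TopologicalSpace M] [ChartedSpace (Fin 2 → ℝ) M]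
    [IsManifold 𝓘(ℝ, Fin 2 → ℝ) ∞ M] {V : (Fin 3 ⊕ Fin n → ℝ) → Fin 3 ⊕ Fin n → ℝ}
    {X : M → Fin 3 → ℝ} {W : Set M} (h : IsStationaryTypeI A V X W)
    (hne : IsNontrivial A V X W) (hE : ExtrinsicEquation A V X W) :
    LiesInPlane (fun i => A (Sum.inl i)) (X '' W) ∨
      LiesInHelicoid (fun i => A (Sum.inl i)) (X '' W) := by
  obtain ⟨a, b, hv, ha, h2, h0, h1⟩ := exists_rigid_motion h.smooth_field h.killing
  have hm : (0 : ℝ) < n := by exact_mod_cast hn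
  refine h.sheet.classification hm ha h2 h0 h1 ?_
    (fun q hq ν hν => (extrinsicEquation_vector hn h hE hv hq hν).1)
    (fun q hq => (extrinsicEquation_vector hn h hE hv hq
      -- Positivity does not involve the normal, so ν = 0 will do.
      (ν := 0) (fun _ _ _ _ => zero_dotProduct _)).2.1)
    (fun q hq ν hν => (extrinsicEquation_vector hn h hE hv hq hν).2.2)
  by_contra! hall
  obtain ⟨rfl, rfl, hA⟩ := hall
  rcases hne with ⟨q, hq, hV⟩ | ⟨i, hi⟩
  · apply hV
    have hqe := mem_chart_source (Fin 2 → ℝ) q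
    have hd := ((contDiffOn_comp_symm h.smooth (chart_mem_atlas (Fin 2 → ℝ) q)).contDiffAt
      ((chartAt (Fin 2 → ℝ) q).open_target.mem_nhds ((chartAt (Fin 2 → ℝ) q).map_source
      hqe))).differentiableAt (by simp)
    obtain ⟨-, hV0⟩ := h.exists_fderiv (chart_mem_atlas (Fin 2 → ℝ) q) ⟨hqe, hq⟩ hd
    ext (i | j)
    · simpa [velocity] using congrFun (hv (X q)) i
    · exact hV0 j
  · exact hi (hA i)

end Blackfold

namespace Blackfold

open Matrix

/-! ### Geometries parametrised by the plane -/

section Existence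

variable {n : ℕ} {A : Fin 3 ⊕ Fin n → ℝ} {V : (Fin 3 ⊕ Fin n → ℝ) → Fin 3 ⊕ Fin n → ℝ}
  {Y : (Fin 2 → ℝ) → Fin 3 → ℝ}

theorem continuous_modulusSq (hV : Continuous V) : Continuous (modulusSq A V) := by
  have ht : Continuous (transverse n) := by
    rw [continuous_pi_iff]
    rintro (i | j)
    · exact continuous_apply i
    · exact continuous_const
  have h1 := fun q => (continuous_apply q).comp (hV.comp ht)
  have h2 : modulusSq A V = fun x => 1 + ∑ i, A (Sum.inl i) * x i ^ 2 -
      ((∑ i, V (transverse n x) (Sum.inl i) ^ 2) + ∑ j, V (transverse n x) (Sum.inr j) ^ 2) :=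
    funext fun x => modulusSq_eq A V x
  rw [h2]
  refine Continuous.sub (by fun_prop) (Continuous.add ?_ ?_)
  · exact continuous_finsetSum _ fun i _ => (h1 (Sum.inl i)).pow 2
  · exact continuous_finsetSum _ fun j _ => (h1 (Sum.inr j)).pow 2

theorem isOpen_timelike (hV : Continuous V) (hY : Continuous Y) :
    IsOpen {q | 0 < modulusSq A V (Y q)} :=
  isOpen_lt continuous_const ((continuous_modulusSq hV).comp hY)

theorem modulusSq_pos_of_mem {p q : Fin 2 → ℝ} (hq : q ∈ timelikeComponent A V Y p) :
    0 < modulusSq A V (Y q) := by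
  have h : q ∈ {q | 0 < modulusSq A V (Y q)} := connectedComponentIn_subset _ _ hq
  exact h

/-- By continuity 𝐤² ≥ 0 on the frontier. Where it is positive, the component of q is open and meets
that of p, so the two coincide and q is an interior point. -/
theorem modulusSq_frontier (hV : Continuous V) (hY : Continuous Y) {p q : Fin 2 → ℝ}
    (hq : q ∈ frontier (timelikeComponent A V Y p)) : modulusSq A V (Y q) = 0 := by
  have ho := isOpen_timelike (A := A) hV hY
  have hle : 0 ≤ modulusSq A V (Y q) := by
    have h1 : q ∈ closure {q | 0 < modulusSq A V (Y q)} :=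
      closure_mono (connectedComponentIn_subset _ _) (frontier_subset_closure hq)
    exact closure_minimal (fun x hx => le_of_lt hx)
      (isClosed_le continuous_const ((continuous_modulusSq hV).comp hY)) h1
  refine le_antisymm (not_lt.mp fun hlt => ?_) hle
  have hW : IsOpen (timelikeComponent A V Y p) := ho.connectedComponentIn
  have hC : IsOpen (timelikeComponent A V Y q) := ho.connectedComponentIn
  have hqC : q ∈ timelikeComponent A V Y q := mem_connectedComponentIn hlt
  obtain ⟨z, hz1, hz2⟩ := mem_closure_iff.mp (frontier_subset_closure hq) _ hC hqC
  have h1 : timelikeComponent A V Y p = timelikeComponent A V Y q :=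
    (connectedComponentIn_eq hz2).trans (connectedComponentIn_eq hz1).symm
  rw [hW.frontier_eq, h1] at hq
  exact hq.2 hqC

theorem exists_mapsToField (hY : Differentiable ℝ Y)
    (hV0 : ∀ x j, V (transverse n x) (Sum.inr j) = 0) {σ k : Fin 2 → ℝ}
    (hk : fderiv ℝ Y σ k = velocity V (Y σ)) (τ : ℝ) :
    MapsToField V Y (Fin.cons τ σ) (Fin.cons 1 k) := by
  rw [mapsToField_iff]
  refine ⟨rfl, fun i => ?_, fun j => hV0 _ j⟩
  rw [Fin.tail_cons]
  have := congrFun hk i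
  rw [Surf.apply_eq_single] at this
  simp only [tangent_eq (hY _), Fin.sum_univ_two, Fin.cons_succ]
  simp only [Pi.add_apply, Pi.smul_apply, smul_eq_mul, velocity] at this
  linear_combination this

theorem isStationaryTypeI_timelikeComponent (hY : ContDiff ℝ ∞ Y)
    (hi : ∀ σ, Function.Injective (fderiv ℝ Y σ))
    (hm : ∀ σ N, IsConormal Y σ N → meanCurvature (fun _ => 1) Y σ N = 0) (hV : ContDiff ℝ ∞ V)
    (hV0 : ∀ x j, V (transverse n x) (Sum.inr j) = 0)
    (hK : IsKilling (planeWave A) (stationaryField V))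
    (ht : ∀ σ, ∃ k, fderiv ℝ Y σ k = velocity V (Y σ)) {p : Fin 2 → ℝ}
    (hp : 0 < modulusSq A V (Y p)) : IsStationaryTypeI A V Y (timelikeComponent A V Y p) where
  smooth := contMDiff_iff_contDiff.mpr hY
  immersion e he p _ := by
    rw [chartedSpaceSelf_atlas] at he
    subst he
    exact hi p
  isOpen := (isOpen_timelike hV.continuous hY.continuous).connectedComponentIn
  isConnected := isConnected_connectedComponentIn_iff.mpr hp
  minimal e he p _ N hN := by
    rw [chartedSpaceSelf_atlas] at he
    subst he
    exact hm p N hN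
  smooth_field := hV
  killing := hK
  tangency e he p _ τ := by
    rw [chartedSpaceSelf_atlas] at he
    subst he
    obtain ⟨k, hk⟩ := ht p
    exact ⟨_, exists_mapsToField (hY.differentiable (by simp)) hV0 hk τ⟩
  timelike q hq := modulusSq_pos_of_mem hq

/-- Both sides of the equation vanish term by term: the surface is minimal, the force A Y is
tangent, the velocity has no normal acceleration, and the mixed term is the derivative of the
profile along V. -/
theorem blackfoldEquations_timelikeComponent (hY : ContDiff ℝ ∞ Y)
    (hi : ∀ σ, Function.Injective (fderiv ℝ Y σ))
    (hm : ∀ σ N, IsConormal Y σ N → meanCurvature (fun _ => 1) Y σ N = 0) (hV : ContDiff ℝ ∞ V)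
    (hV0 : ∀ x j, V (transverse n x) (Sum.inr j) = 0)
    (hA : ∀ x, ∑ i, A (Sum.inl i) * x i * velocity V x i = 0)
    (ht : ∀ σ, ∃ k, fderiv ℝ Y σ k = velocity V (Y σ) ∧ ∀ ν, (∀ l, ν ⬝ᵥ fderiv ℝ Y σ l = 0) →
      ν ⬝ᵥ fderiv ℝ (fderiv ℝ Y) σ k k = 0)
    (hf : ∀ σ ν, (∀ l, ν ⬝ᵥ fderiv ℝ Y σ l = 0) → ν ⬝ᵥ ((fun i => A (Sum.inl i)) * Y σ) = 0)
    (p : Fin 2 → ℝ) : BlackfoldEquations A V Y (timelikeComponent A V Y p) := by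
  refine ⟨fun e he q hq τ => ?_, fun q hq => modulusSq_frontier hV.continuous hY.continuous hq⟩
  rw [chartedSpaceSelf_atlas] at he
  subst he
  obtain ⟨k, hk, hkk⟩ := ht q
  have hd : Differentiable ℝ Y := hY.differentiable (by simp)
  refine ⟨_, exists_mapsToField hd hV0 hk τ, ?_⟩
  intro u N hN
  change IsConormal (typeI n Y) (Fin.cons τ q) N at hN
  change meanCurvature (planeWave A) (typeI n Y) (Fin.cons τ q) N = n * ∑ a, ∑ b, u a * u b *
    extrinsicCurvature (planeWave A) (typeI n Y) (Fin.cons τ q) N a b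
  rw [isConormal_typeI_iff, Fin.tail_cons] at hN
  obtain ⟨h0, hN⟩ := hN
  have hN' := (isConormal_iff (hd q) _).mp hN
  have hq' := modulusSq_pos_of_mem hq.2
  have hdet : IsUnit (inducedMetric (fun _ => 1) Y q).det := by
    rw [det_inducedMetric (hd q)]
    exact (dot3_self_pos (cross_ne_zero (hi q))).ne'.isUnit
  rw [meanCurvature_typeI A _ _ _ (by rw [Fin.tail_cons, sum_profile_eq]; exact
    (one_add_profile_pos hq').ne') (by rw [Fin.tail_cons]; exact hdet) h0,
    sum_extrinsicCurvature_typeI A _ _ _ h0, Fin.tail_cons, forceDot_eq, hf q _ hN', hm q _ hN]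
  have h1 : ∑ a : Fin 2, ∑ b : Fin 2, u a.succ * u b.succ *
      extrinsicCurvature (fun _ => 1) Y q (spatial N) a b = 0 := by
    have h2 := hkk _ hN'
    rw [← sum_extrinsicCurvature_euclid isOpen_univ hY.contDiffOn (Set.mem_univ q)] at h2
    rw [← zero_div (√(modulusSq A V (Y q)) * √(modulusSq A V (Y q))), ← h2, Finset.sum_div]
    refine Finset.sum_congr rfl fun a _ => ?_
    rw [Finset.sum_div]
    refine Finset.sum_congr rfl fun b _ => ?_
    change Fin.cons (α := fun _ => ℝ) 1 k a.succ / √(modulusSq A V (Y q)) *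
      (Fin.cons (α := fun _ => ℝ) 1 k b.succ / √(modulusSq A V (Y q))) * _ = _
    rw [Fin.cons_succ, Fin.cons_succ]
    ring
  have h2 : ∑ b : Fin 2, u b.succ * forceDot A (fun i => tangent Y q i b) (Y q) = 0 := by
    have h3 : ∀ b : Fin 2, u b.succ = k b / √(modulusSq A V (Y q)) := fun b => by
      change Fin.cons (α := fun _ => ℝ) 1 k b.succ / √(modulusSq A V (Y q)) = _
      rw [Fin.cons_succ]
    have h4 := hA (Y q)
    have h5 := fun i => congrFun hk i
    simp only [Surf.apply_eq_single _ k, Pi.add_apply, Pi.smul_apply, smul_eq_mul] at h5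
    simp only [Fin.sum_univ_two, h3, forceDot, tangent_eq (hd q), Fin.sum_univ_three, ← h5] at h4 ⊢
    linear_combination h4 / √(modulusSq A V (Y q))
  rw [h1, h2]
  ring

end Existence

/-! ### Orthogonal parametrisations -/

section Orthogonal

variable {Y : (Fin 2 → ℝ) → Fin 3 → ℝ} {σ : Fin 2 → ℝ}

theorem fderiv_eq_of_line {F : (Fin 2 → ℝ) → Fin 3 → ℝ} (hF : DifferentiableAt ℝ F σ)
    {k : Fin 2 → ℝ} {w : Fin 3 → ℝ} (h : ∀ i, HasDerivAt (fun t : ℝ => F (σ + t • k) i) (w i) 0) :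
    fderiv ℝ F σ k = w :=
  (hF.hasFDerivAt.hasLineDerivAt k).unique (hasDerivAt_pi.mpr h)

theorem second_eq_of_line (hY : ContDiff ℝ ∞ Y) {k l : Fin 2 → ℝ} {w : Fin 3 → ℝ}
    (h : ∀ i, HasDerivAt (fun t : ℝ => fderiv ℝ Y (σ + t • k) l i) (w i) 0) :
    fderiv ℝ (fderiv ℝ Y) σ k l = w := by
  have h1 : DifferentiableAt ℝ (fderiv ℝ Y) σ :=
    (hY.contDiffAt.fderiv_right (m := ∞) le_rfl).differentiableAt (by simp)
  have h2 := (h1.hasFDerivAt.clm_apply (hasFDerivAt_const l σ)).hasLineDerivAt k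
  have h3 := h2.unique (hasDerivAt_pi.mpr h)
  simpa using h3

theorem injective_of_orthogonal (h01 : fderiv ℝ Y σ (Pi.single 0 1) ⬝ᵥ
    fderiv ℝ Y σ (Pi.single 1 1) = 0) (h0 : fderiv ℝ Y σ (Pi.single 0 1) ≠ 0)
    (h1 : fderiv ℝ Y σ (Pi.single 1 1) ≠ 0) : Function.Injective (fderiv ℝ Y σ) := by
  rw [injective_iff_map_eq_zero]
  intro k hk
  rw [Surf.apply_eq_single] at hk
  have e0 := congrArg (fun x => x ⬝ᵥ fderiv ℝ Y σ (Pi.single 0 1)) hk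
  have e1 := congrArg (fun x => x ⬝ᵥ fderiv ℝ Y σ (Pi.single 1 1)) hk
  simp only [add_dotProduct, smul_dotProduct, h01, zero_dotProduct, smul_eq_mul,
    dotProduct_comm (fderiv ℝ Y σ (Pi.single 1 1)) (fderiv ℝ Y σ (Pi.single 0 1)),
    mul_zero, add_zero, zero_add] at e0 e1
  ext i
  fin_cases i
  · exact (mul_eq_zero.mp e0).resolve_right (dot3_self_pos h0).ne'
  · exact (mul_eq_zero.mp e1).resolve_right (dot3_self_pos h1).ne'

theorem meanCurvature_of_orthogonal (hY : ContDiff ℝ ∞ Y) (h01 : fderiv ℝ Y σ (Pi.single 0 1) ⬝ᵥ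
    fderiv ℝ Y σ (Pi.single 1 1) = 0)
    (h : ∀ N : Fin 3 → ℝ, (∀ k, N ⬝ᵥ fderiv ℝ Y σ k = 0) →
      (fderiv ℝ Y σ (Pi.single 1 1) ⬝ᵥ fderiv ℝ Y σ (Pi.single 1 1)) *
          (N ⬝ᵥ fderiv ℝ (fderiv ℝ Y) σ (Pi.single 0 1) (Pi.single 0 1))
        + (fderiv ℝ Y σ (Pi.single 0 1) ⬝ᵥ fderiv ℝ Y σ (Pi.single 0 1)) *
          (N ⬝ᵥ fderiv ℝ (fderiv ℝ Y) σ (Pi.single 1 1) (Pi.single 1 1)) = 0)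
    (N : Fin 3 → ℝ) (hN : IsConormal Y σ N) : meanCurvature (fun _ => 1) Y σ N = 0 := by
  rw [meanCurvature_euclid isOpen_univ hY.contDiffOn (Set.mem_univ σ), h01, mul_zero, zero_mul,
    sub_zero, h N ((isConormal_iff (hY.differentiable (by simp) σ) N).mp hN), mul_zero]

end Orthogonal

/-! ### The screw field -/

section Screw

variable {n : ℕ} {A : Fin 3 ⊕ Fin n → ℝ} (Ω h : ℝ)

theorem contDiff_screwField : ContDiff ℝ ∞ (screwField n Ω h) := by
  rw [contDiff_pi]
  rintro (i | j)
  · fin_cases i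
    · exact contDiff_const.mul (contDiff_apply ℝ ℝ (Sum.inl 1))
    · exact contDiff_const.mul (contDiff_apply ℝ ℝ (Sum.inl 0))
    · exact contDiff_const
  · exact contDiff_const

theorem velocity_screwField (x : Fin 3 → ℝ) :
    velocity (screwField n Ω h) x = ![-Ω * x 1, Ω * x 0, Ω * h] := rfl

theorem fderiv_screwField (x v : Fin 3 ⊕ Fin n → ℝ) : fderiv ℝ (screwField n Ω h) x v =
    transverse n ![-Ω * v (Sum.inl 1), Ω * v (Sum.inl 0), 0] := by
  have hd := (contDiff_screwField (n := n) Ω h).differentiable (by simp) x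
  refine (hd.hasFDerivAt.hasLineDerivAt v).unique (hasDerivAt_pi.mpr ?_)
  have hl : ∀ q, HasDerivAt (fun t : ℝ => (x + t • v) q) (v q) 0 := by
    intro q
    have := ((hasDerivAt_id (0 : ℝ)).mul_const (v q)).const_add (x q)
    simpa using this
  rintro (i | j)
  · fin_cases i
    · exact (hl (Sum.inl 1)).const_mul (-Ω)
    · exact (hl (Sum.inl 0)).const_mul Ω
    · exact hasDerivAt_const _ _
  · exact hasDerivAt_const _ _

theorem sum_profile_screwField {Ω h : ℝ}
    (hA : Ω = 0 ∨ A (Sum.inl 0) = A (Sum.inl 1) ∧ (h = 0 ∨ A (Sum.inl 2) = 0)) (x : Fin 3 → ℝ) :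
    ∑ i, A (Sum.inl i) * x i * velocity (screwField n Ω h) x i = 0 := by
  rw [Fin.sum_univ_three, velocity_screwField]
  simp only [cons_val_zero, cons_val_one, cons_val]
  rcases hA with rfl | ⟨h1, rfl | h2⟩
  · ring
  · rw [h1]
    ring
  · rw [h1, h2]
    ring

theorem screwField_inr (x : Fin 3 ⊕ Fin n → ℝ) (j : Fin n) :
    screwField n Ω h x (Sum.inr j) = 0 := rfl

theorem isKilling_screwField {Ω h : ℝ}
    (hA : Ω = 0 ∨ A (Sum.inl 0) = A (Sum.inl 1) ∧ (h = 0 ∨ A (Sum.inl 2) = 0)) :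
    IsKilling (planeWave A) (stationaryField (screwField n Ω h)) := by
  rw [isKilling_iff ((contDiff_screwField Ω h).differentiable (by simp))]
  constructor
  · intro x
    rw [Fintype.sum_sum_type]
    simp only [screwField_inr, mul_zero, Finset.sum_const_zero, add_zero]
    exact sum_profile_screwField hA fun i => x (Sum.inl i)
  · intro x p q
    rw [fderiv_screwField, fderiv_screwField]
    rcases p with i | i <;> rcases q with j | j
    · fin_cases i <;> fin_cases j <;> simp [transverse]
    · fin_cases i <;> simp [transverse]
    · fin_cases j <;> simp [transverse]
    · simp [transverse]

end Screw

end Blackfold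

namespace Blackfold

open Matrix

section Lines

variable (σ k : Fin 2 → ℝ)

theorem hasDerivAt_line (i : Fin 2) : HasDerivAt (fun t : ℝ => (σ + t • k) i) (k i) 0 := by
  have := ((hasDerivAt_id (0 : ℝ)).mul_const (k i)).const_add (σ i)
  simpa using this

theorem line_zero : σ + (0 : ℝ) • k = σ := by simp

theorem hasDerivAt_sin_line (i : Fin 2) : HasDerivAt (fun t : ℝ => Real.sin ((σ + t • k) i))
    (Real.cos (σ i) * k i) 0 := by
  have := (hasDerivAt_line σ k i).sin
  rwa [line_zero] at this

theorem hasDerivAt_cos_line (i : Fin 2) : HasDerivAt (fun t : ℝ => Real.cos ((σ + t • k) i))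
    (-Real.sin (σ i) * k i) 0 := by
  have := (hasDerivAt_line σ k i).cos
  rwa [line_zero] at this

theorem hasDerivAt_sinh_line (c : ℝ) (i : Fin 2) :
    HasDerivAt (fun t : ℝ => Real.sinh ((σ + t • k) i / c)) (Real.cosh (σ i / c) * (k i / c)) 0 := by
  have := ((hasDerivAt_line σ k i).div_const c).sinh
  rwa [line_zero] at this

theorem hasDerivAt_cosh_line (c : ℝ) (i : Fin 2) :
    HasDerivAt (fun t : ℝ => Real.cosh ((σ + t • k) i / c)) (Real.sinh (σ i / c) * (k i / c)) 0 := by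
  have := ((hasDerivAt_line σ k i).div_const c).cosh
  rwa [line_zero] at this

end Lines

variable {n : ℕ} {A : Fin 3 ⊕ Fin n → ℝ}

/-! ### The plane -/

section Plane

theorem contDiff_plane : ContDiff ℝ ∞ plane := by
  rw [contDiff_pi]
  intro i
  fin_cases i
  · exact contDiff_apply ℝ ℝ 0
  · exact contDiff_apply ℝ ℝ 1
  · exact contDiff_const

theorem fderiv_plane (σ k : Fin 2 → ℝ) : fderiv ℝ plane σ k = ![k 0, k 1, 0] := by
  refine fderiv_eq_of_line (contDiff_plane.differentiable (by simp) σ) fun i => ?_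
  fin_cases i
  · exact hasDerivAt_line σ k 0
  · exact hasDerivAt_line σ k 1
  · exact hasDerivAt_const _ _

theorem second_plane (σ k l : Fin 2 → ℝ) : fderiv ℝ (fderiv ℝ plane) σ k l = 0 := by
  refine second_eq_of_line contDiff_plane fun i => ?_
  simp only [fderiv_plane]
  exact hasDerivAt_const _ _

theorem injective_fderiv_plane (σ : Fin 2 → ℝ) : Function.Injective (fderiv ℝ plane σ) := by
  apply injective_of_orthogonal
  · simp [fderiv_plane]
  · intro h
    have := congrFun h 0
    simp [fderiv_plane] at this
  · intro h
    have := congrFun h 1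
    simp [fderiv_plane] at this

theorem meanCurvature_plane (σ : Fin 2 → ℝ) (N : Fin 3 → ℝ) (hN : IsConormal plane σ N) :
    meanCurvature (fun _ => 1) plane σ N = 0 := by
  refine meanCurvature_of_orthogonal contDiff_plane ?_ (fun N _ => ?_) N hN
  · simp [fderiv_plane]
  · simp [second_plane]

theorem fderiv_plane_screw (Ω : ℝ) (σ : Fin 2 → ℝ) :
    fderiv ℝ plane σ ![-Ω * σ 1, Ω * σ 0] = velocity (screwField n Ω 0) (plane σ) := by
  rw [fderiv_plane, velocity_screwField]
  simp [plane]

theorem plane_solution {Ω : ℝ} (hΩ : Ω = 0 ∨ A (Sum.inl 0) = A (Sum.inl 1)) {p : Fin 2 → ℝ}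
    (hp : 0 < modulusSq A (screwField n Ω 0) (plane p)) :
    IsStationaryTypeI A (screwField n Ω 0) plane (timelikeComponent A (screwField n Ω 0) plane p) ∧
      BlackfoldEquations A (screwField n Ω 0) plane
        (timelikeComponent A (screwField n Ω 0) plane p) := by
  have hA : Ω = 0 ∨ A (Sum.inl 0) = A (Sum.inl 1) ∧ ((0 : ℝ) = 0 ∨ A (Sum.inl 2) = 0) :=
    hΩ.imp_right fun h => ⟨h, Or.inl rfl⟩
  refine ⟨isStationaryTypeI_timelikeComponent contDiff_plane injective_fderiv_plane
    meanCurvature_plane (contDiff_screwField Ω 0) (fun _ _ => rfl) (isKilling_screwField hA)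
    (fun σ => ⟨_, fderiv_plane_screw Ω σ⟩) hp,
    blackfoldEquations_timelikeComponent contDiff_plane injective_fderiv_plane
    meanCurvature_plane (contDiff_screwField Ω 0) (fun _ _ => rfl) (sum_profile_screwField hA)
    (fun σ => ⟨_, fderiv_plane_screw Ω σ, fun ν _ => ?_⟩) (fun σ ν hν => ?_) p⟩
  · rw [second_plane, dotProduct_zero]
  · have h0 := hν (Pi.single 0 1)
    have h1 := hν (Pi.single 1 1)
    rw [fderiv_plane, dot3] at h0 h1
    simp at h0 h1
    rw [dot3, h0, h1]
    simp [plane]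

end Plane

/-! ### The helicoid -/

section Helicoid

variable (h : ℝ)

theorem contDiff_helicoid : ContDiff ℝ ∞ (helicoid h) := by
  have h0 : ContDiff ℝ ∞ fun σ : Fin 2 → ℝ => σ 0 := contDiff_apply ℝ ℝ 0
  have h1 : ContDiff ℝ ∞ fun σ : Fin 2 → ℝ => σ 1 := contDiff_apply ℝ ℝ 1
  rw [contDiff_pi]
  intro i
  fin_cases i
  · exact h0.mul h1.cos
  · exact h0.mul h1.sin
  · exact contDiff_const.mul h1

theorem fderiv_helicoid (σ k : Fin 2 → ℝ) : fderiv ℝ (helicoid h) σ k =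
    ![k 0 * Real.cos (σ 1) - k 1 * (σ 0 * Real.sin (σ 1)),
      k 0 * Real.sin (σ 1) + k 1 * (σ 0 * Real.cos (σ 1)), h * k 1] := by
  refine fderiv_eq_of_line ((contDiff_helicoid h).differentiable (by simp) σ) fun i => ?_
  fin_cases i
  · refine ((hasDerivAt_line σ k 0).mul (hasDerivAt_cos_line σ k 1)).congr_deriv ?_
    simp
    ring
  · refine ((hasDerivAt_line σ k 0).mul (hasDerivAt_sin_line σ k 1)).congr_deriv ?_
    simp
    ring
  · exact (hasDerivAt_line σ k 1).const_mul h

theorem second_helicoid (σ k : Fin 2 → ℝ) : fderiv ℝ (fderiv ℝ (helicoid h)) σ k k =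
    ![-2 * k 0 * k 1 * Real.sin (σ 1) - k 1 ^ 2 * (σ 0 * Real.cos (σ 1)),
      2 * k 0 * k 1 * Real.cos (σ 1) - k 1 ^ 2 * (σ 0 * Real.sin (σ 1)), 0] := by
  have h0 := hasDerivAt_line σ k 0
  have hs := hasDerivAt_sin_line σ k 1
  have hc := hasDerivAt_cos_line σ k 1
  refine second_eq_of_line (contDiff_helicoid h) fun i => ?_
  simp only [fderiv_helicoid]
  fin_cases i
  · refine ((hc.const_mul (k 0)).sub ((h0.mul hs).const_mul (k 1))).congr_deriv ?_
    simp
    ring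
  · refine ((hs.const_mul (k 0)).add ((h0.mul hc).const_mul (k 1))).congr_deriv ?_
    simp
    ring
  · exact hasDerivAt_const _ _

theorem orthogonal_helicoid (σ : Fin 2 → ℝ) : fderiv ℝ (helicoid h) σ (Pi.single 0 1) ⬝ᵥ
    fderiv ℝ (helicoid h) σ (Pi.single 1 1) = 0 := by
  rw [fderiv_helicoid, fderiv_helicoid, dot3]
  simp
  ring

theorem injective_fderiv_helicoid {h : ℝ} (hh : h ≠ 0) (σ : Fin 2 → ℝ) :
    Function.Injective (fderiv ℝ (helicoid h) σ) := by
  apply injective_of_orthogonal (orthogonal_helicoid h σ)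
  · intro h0
    have e0 := congrFun h0 0
    have e1 := congrFun h0 1
    simp [fderiv_helicoid] at e0 e1
    have := Real.sin_sq_add_cos_sq (σ 1)
    rw [e0, e1] at this
    norm_num at this
  · intro h0
    have := congrFun h0 2
    simp [fderiv_helicoid, hh] at this

/-- The rulings are horizontal and radial. The force and the acceleration of the screw motion are
both radial, so this one relation balances everything on the helicoid. -/
theorem radial_of_conormal_helicoid {σ : Fin 2 → ℝ} {ν : Fin 3 → ℝ}
    (hν : ∀ l, ν ⬝ᵥ fderiv ℝ (helicoid h) σ l = 0) :
    ν 0 * Real.cos (σ 1) + ν 1 * Real.sin (σ 1) = 0 := by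
  have := hν (Pi.single 0 1)
  rw [fderiv_helicoid, dot3] at this
  simpa using this

theorem meanCurvature_helicoid (σ : Fin 2 → ℝ) (N : Fin 3 → ℝ)
    (hN : IsConormal (helicoid h) σ N) : meanCurvature (fun _ => 1) (helicoid h) σ N = 0 := by
  refine meanCurvature_of_orthogonal (contDiff_helicoid h) (orthogonal_helicoid h σ)
    (fun N hN => ?_) N hN
  have hr := radial_of_conormal_helicoid h hN
  rw [second_helicoid, second_helicoid, dot3 N, dot3 N]
  simp
  right
  linear_combination (-σ 0) * hr

theorem fderiv_helicoid_screw (Ω : ℝ) (σ : Fin 2 → ℝ) :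
    fderiv ℝ (helicoid h) σ ![0, Ω] = velocity (screwField n Ω h) (helicoid h σ) := by
  rw [fderiv_helicoid, velocity_screwField]
  ext i
  fin_cases i <;> simp [helicoid, mul_comm]

theorem helicoid_solution {h : ℝ} (hh : h ≠ 0) (h01 : A (Sum.inl 0) = A (Sum.inl 1))
    (h2 : A (Sum.inl 2) = 0) (Ω : ℝ) {p : Fin 2 → ℝ}
    (hp : 0 < modulusSq A (screwField n Ω h) (helicoid h p)) :
    IsStationaryTypeI A (screwField n Ω h) (helicoid h)
        (timelikeComponent A (screwField n Ω h) (helicoid h) p) ∧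
      BlackfoldEquations A (screwField n Ω h) (helicoid h)
        (timelikeComponent A (screwField n Ω h) (helicoid h) p) := by
  have hA : Ω = 0 ∨ A (Sum.inl 0) = A (Sum.inl 1) ∧ (h = 0 ∨ A (Sum.inl 2) = 0) :=
    Or.inr ⟨h01, Or.inr h2⟩
  refine ⟨isStationaryTypeI_timelikeComponent (contDiff_helicoid h) (injective_fderiv_helicoid hh)
    (meanCurvature_helicoid h) (contDiff_screwField Ω h) (fun _ _ => rfl) (isKilling_screwField hA)
    (fun σ => ⟨_, fderiv_helicoid_screw h Ω σ⟩) hp,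
    blackfoldEquations_timelikeComponent (contDiff_helicoid h) (injective_fderiv_helicoid hh)
    (meanCurvature_helicoid h) (contDiff_screwField Ω h) (fun _ _ => rfl)
    (sum_profile_screwField hA)
    (fun σ => ⟨_, fderiv_helicoid_screw h Ω σ, fun ν hν => ?_⟩) (fun σ ν hν => ?_) p⟩
  · have hr := radial_of_conormal_helicoid h hν
    rw [second_helicoid, dot3]
    simp
    linear_combination (-Ω ^ 2 * σ 0) * hr
  · have hr := radial_of_conormal_helicoid h hν
    rw [dot3]
    simp [helicoid, h01, h2]
    linear_combination (A (Sum.inl 1) * σ 0) * hr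

end Helicoid

/-! ### Scherk's second surfaces -/

section Scherk

variable (c l : ℝ)

theorem contDiff_scherk {m : WithTop ℕ∞} : ContDiff ℝ m (scherk c l) := by
  have h0 : ContDiff ℝ m fun σ : Fin 2 → ℝ => σ 0 := contDiff_apply ℝ ℝ 0
  have h1 : ContDiff ℝ m fun σ : Fin 2 → ℝ => σ 1 := contDiff_apply ℝ ℝ 1
  have hs := (h0.div_const c).sinh
  have hc := (h0.div_const c).cosh
  rw [contDiff_pi]
  intro i
  fin_cases i
  · exact ((contDiff_const.mul (contDiff_const.mul hs)).mul h1.sin).add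
      ((contDiff_const.mul (contDiff_const.mul hc)).mul h1.cos)
  · exact ((contDiff_const.mul (contDiff_const.mul hs)).mul h1.cos).add
      ((contDiff_const.mul (contDiff_const.mul hc)).mul h1.sin)
  · exact (contDiff_const.mul h1).add (contDiff_const.mul h0)

variable {c l : ℝ}

theorem fderiv_scherk (hc : c ≠ 0) (σ k : Fin 2 → ℝ) : fderiv ℝ (scherk c l) σ k =
    ![k 0 * (l * Real.cosh (σ 0 / c) * Real.sin (σ 1) +
        √(1 - l ^ 2) * Real.sinh (σ 0 / c) * Real.cos (σ 1)) +
        k 1 * (l * (c * Real.sinh (σ 0 / c)) * Real.cos (σ 1) -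
          √(1 - l ^ 2) * (c * Real.cosh (σ 0 / c)) * Real.sin (σ 1)),
      k 0 * (-l * Real.cosh (σ 0 / c) * Real.cos (σ 1) +
        √(1 - l ^ 2) * Real.sinh (σ 0 / c) * Real.sin (σ 1)) +
        k 1 * (l * (c * Real.sinh (σ 0 / c)) * Real.sin (σ 1) +
          √(1 - l ^ 2) * (c * Real.cosh (σ 0 / c)) * Real.cos (σ 1)),
      l * c * k 1 + √(1 - l ^ 2) * k 0] := by
  have h0 := hasDerivAt_line σ k 0
  have h1 := hasDerivAt_line σ k 1
  have hs := hasDerivAt_sin_line σ k 1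
  have hco := hasDerivAt_cos_line σ k 1
  have hsh := hasDerivAt_sinh_line σ k c 0
  have hch := hasDerivAt_cosh_line σ k c 0
  refine fderiv_eq_of_line ((contDiff_scherk c l (m := ∞)).differentiable (by simp) σ) fun i => ?_
  fin_cases i
  · refine ((((hsh.const_mul c).const_mul l).mul hs).add
      (((hch.const_mul c).const_mul √(1 - l ^ 2)).mul hco)).congr_deriv ?_
    simp
    field_simp
    ring
  · refine ((((hsh.const_mul c).const_mul (-l)).mul hco).add
      (((hch.const_mul c).const_mul √(1 - l ^ 2)).mul hs)).congr_deriv ?_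
    simp
    field_simp
    ring
  · exact (h1.const_mul (l * c)).add (h0.const_mul √(1 - l ^ 2))

theorem second_scherk_zero (hc : c ≠ 0) (σ : Fin 2 → ℝ) :
    fderiv ℝ (fderiv ℝ (scherk c l)) σ (Pi.single 0 1) (Pi.single 0 1) =
      (c ^ 2)⁻¹ • ![scherk c l σ 0, scherk c l σ 1, 0] := by
  have hsh := hasDerivAt_sinh_line σ (Pi.single 0 1) c 0
  have hch := hasDerivAt_cosh_line σ (Pi.single 0 1) c 0
  refine second_eq_of_line (contDiff_scherk c l) fun i => ?_
  simp only [fderiv_scherk hc]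
  fin_cases i
  · simp [scherk] at hsh hch ⊢
    refine (((hch.const_mul l).mul_const (Real.sin (σ 1))).add
      ((hsh.const_mul √(1 - l ^ 2)).mul_const (Real.cos (σ 1)))).congr_deriv ?_
    field_simp
  · simp [scherk] at hsh hch ⊢
    refine (((hch.const_mul l).mul_const (Real.cos (σ 1))).neg.add
      ((hsh.const_mul √(1 - l ^ 2)).mul_const (Real.sin (σ 1)))).congr_deriv ?_
    field_simp
  · simp
    exact hasDerivAt_const _ _

theorem second_scherk_one (hc : c ≠ 0) (σ : Fin 2 → ℝ) :
    fderiv ℝ (fderiv ℝ (scherk c l)) σ (Pi.single 1 1) (Pi.single 1 1) =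
      -![scherk c l σ 0, scherk c l σ 1, 0] := by
  have hs := hasDerivAt_sin_line σ (Pi.single 1 1) 1
  have hco := hasDerivAt_cos_line σ (Pi.single 1 1) 1
  refine second_eq_of_line (contDiff_scherk c l) fun i => ?_
  simp only [fderiv_scherk hc]
  fin_cases i
  · simp [scherk] at hs hco ⊢
    refine ((hco.const_mul (l * (c * Real.sinh (σ 0 / c)))).sub
      (hs.const_mul (√(1 - l ^ 2) * (c * Real.cosh (σ 0 / c))))).congr_deriv ?_
    ring
  · simp [scherk] at hs hco ⊢
    refine ((hs.const_mul (l * (c * Real.sinh (σ 0 / c)))).add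
      (hco.const_mul (√(1 - l ^ 2) * (c * Real.cosh (σ 0 / c))))).congr_deriv ?_
    ring
  · simp
    exact hasDerivAt_const _ _

theorem sq_sqrt_one_sub {l : ℝ} (hl : |l| < 1) : √(1 - l ^ 2) ^ 2 = 1 - l ^ 2 :=
  Real.sq_sqrt (by nlinarith [(sq_lt_one_iff_abs_lt_one l).mpr hl])

theorem orthogonal_scherk (hc : c ≠ 0) (σ : Fin 2 → ℝ) :
    fderiv ℝ (scherk c l) σ (Pi.single 0 1) ⬝ᵥ fderiv ℝ (scherk c l) σ (Pi.single 1 1) = 0 := by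
  have h1 := Real.sin_sq_add_cos_sq (σ 1)
  have h2 := Real.cosh_sq_sub_sinh_sq (σ 0 / c)
  rw [fderiv_scherk hc, fderiv_scherk hc, dot3]
  simp
  linear_combination (l * √(1 - l ^ 2) * c * (Real.sinh (σ 0 / c) ^ 2 - Real.cosh (σ 0 / c) ^ 2)) *
    h1 - l * √(1 - l ^ 2) * c * h2

theorem metric_scherk_zero (hc : c ≠ 0) (hl : |l| < 1) (σ : Fin 2 → ℝ) :
    fderiv ℝ (scherk c l) σ (Pi.single 0 1) ⬝ᵥ fderiv ℝ (scherk c l) σ (Pi.single 0 1) =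
      Real.cosh (σ 0 / c) ^ 2 := by
  have h1 := Real.sin_sq_add_cos_sq (σ 1)
  have h2 := Real.cosh_sq_sub_sinh_sq (σ 0 / c)
  have h3 := sq_sqrt_one_sub hl
  rw [fderiv_scherk hc, dot3]
  simp
  linear_combination (l ^ 2 * Real.cosh (σ 0 / c) ^ 2 + √(1 - l ^ 2) ^ 2 *
    Real.sinh (σ 0 / c) ^ 2) * h1 + (Real.sinh (σ 0 / c) ^ 2 + 1) * h3 - (1 - l ^ 2) * h2

theorem metric_scherk_one (hc : c ≠ 0) (hl : |l| < 1) (σ : Fin 2 → ℝ) :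
    fderiv ℝ (scherk c l) σ (Pi.single 1 1) ⬝ᵥ fderiv ℝ (scherk c l) σ (Pi.single 1 1) =
      c ^ 2 * Real.cosh (σ 0 / c) ^ 2 := by
  have h1 := Real.sin_sq_add_cos_sq (σ 1)
  have h2 := Real.cosh_sq_sub_sinh_sq (σ 0 / c)
  have h3 := sq_sqrt_one_sub hl
  rw [fderiv_scherk hc, dot3]
  simp
  linear_combination c ^ 2 * (√(1 - l ^ 2) ^ 2 * Real.cosh (σ 0 / c) ^ 2 + l ^ 2 *
    Real.sinh (σ 0 / c) ^ 2) * h1 + c ^ 2 * Real.cosh (σ 0 / c) ^ 2 * h3 - c ^ 2 * l ^ 2 * h2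

theorem injective_fderiv_scherk (hc : c ≠ 0) (hl : |l| < 1) (σ : Fin 2 → ℝ) :
    Function.Injective (fderiv ℝ (scherk c l) σ) := by
  have hp := (Real.cosh_pos (σ 0 / c)).ne'
  apply injective_of_orthogonal (orthogonal_scherk hc σ)
  · intro h0
    have := metric_scherk_zero hc hl σ
    rw [h0, zero_dotProduct] at this
    exact pow_ne_zero 2 hp this.symm
  · intro h0
    have := metric_scherk_one hc hl σ
    rw [h0, zero_dotProduct] at this
    exact mul_ne_zero (pow_ne_zero 2 hc) (pow_ne_zero 2 hp) this.symm

/-- The pure second derivatives are the horizontal position times 1/c² and −1, while the metric is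
cosh²(ρ/c)(dρ² + c² dφ²), so the two terms cancel. -/
theorem meanCurvature_scherk (hc : c ≠ 0) (hl : |l| < 1) (σ : Fin 2 → ℝ) (N : Fin 3 → ℝ)
    (hN : IsConormal (scherk c l) σ N) : meanCurvature (fun _ => 1) (scherk c l) σ N = 0 := by
  refine meanCurvature_of_orthogonal (contDiff_scherk c l) (orthogonal_scherk hc σ)
    (fun N hN => ?_) N hN
  rw [second_scherk_zero hc, second_scherk_one hc, metric_scherk_zero hc hl,
    metric_scherk_one hc hl, dotProduct_smul, dotProduct_neg, smul_eq_mul]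
  field_simp
  ring

theorem fderiv_scherk_screw (hc : c ≠ 0) (Ω : ℝ) (σ : Fin 2 → ℝ) :
    fderiv ℝ (scherk c l) σ ![0, Ω] = velocity (screwField n Ω (l * c)) (scherk c l σ) := by
  rw [fderiv_scherk hc, velocity_screwField]
  ext i
  fin_cases i <;> simp [scherk] <;> ring

theorem isStationaryTypeI_scherk (hc : c ≠ 0) (hl : |l| < 1) {Ω : ℝ}
    (hΩ : Ω = 0 ∨ A (Sum.inl 0) = A (Sum.inl 1) ∧ (l = 0 ∨ A (Sum.inl 2) = 0)) {p : Fin 2 → ℝ}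
    (hp : 0 < modulusSq A (screwField n Ω (l * c)) (scherk c l p)) :
    IsStationaryTypeI A (screwField n Ω (l * c)) (scherk c l)
      (timelikeComponent A (screwField n Ω (l * c)) (scherk c l) p) :=
  isStationaryTypeI_timelikeComponent (contDiff_scherk c l) (injective_fderiv_scherk hc hl)
    (meanCurvature_scherk hc hl) (contDiff_screwField Ω (l * c)) (fun _ _ => rfl)
    (isKilling_screwField (hΩ.imp_right fun h => ⟨h.1, h.2.imp_left fun h => by rw [h, zero_mul]⟩))
    (fun σ => ⟨_, fderiv_scherk_screw hc Ω σ⟩) hp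

end Scherk

end Blackfold

/-! ### Scherk's surfaces lie in no plane and no helicoid. -/

namespace Blackfold

open Matrix

/-- An analytic function on the plane which vanishes on a non-empty open set is zero. -/
theorem eq_zero_of_contDiff_omega {f : (Fin 2 → ℝ) → ℝ} (hf : ContDiff ℝ ω f)
    {W : Set (Fin 2 → ℝ)} (hW : IsOpen W) (hne : W.Nonempty) (h0 : ∀ σ ∈ W, f σ = 0)
    (σ : Fin 2 → ℝ) : f σ = 0 := by
  obtain ⟨p, hp⟩ := hne
  have ha : AnalyticOnNhd ℝ f Set.univ := hf.analyticOnNhd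
  exact ha.eqOn_zero_of_preconnected_of_eventuallyEq_zero isPreconnected_univ (Set.mem_univ p)
    (by filter_upwards [hW.mem_nhds hp] with x hx using h0 x hx) (Set.mem_univ σ)

/-- The function whose zero set is the helicoid `(ρ cos θ, ρ sin θ, h θ)`. -/
def helicoidEquation (h : ℝ) (z : Fin 3 → ℝ) : ℝ :=
  z 0 * Real.sin (z 2 / h) - z 1 * Real.cos (z 2 / h)

/-- The gradient of `helicoidEquation h`. -/
def helicoidGradient (h : ℝ) (z : Fin 3 → ℝ) : Fin 3 → ℝ :=
  ![Real.sin (z 2 / h), -Real.cos (z 2 / h),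
    (z 0 * Real.cos (z 2 / h) + z 1 * Real.sin (z 2 / h)) / h]

theorem helicoidEquation_helicoid {h : ℝ} (hh : h ≠ 0) (τ : Fin 2 → ℝ) :
    helicoidEquation h (helicoid h τ) = 0 := by
  simp only [helicoidEquation, helicoid, cons_val_zero, cons_val_one, cons_val,
    mul_div_cancel_left₀ _ hh]
  ring

theorem contDiff_helicoidEquation (h : ℝ) : ContDiff ℝ ω (helicoidEquation h) := by
  have h2 : ContDiff ℝ ω fun z : Fin 3 → ℝ => z 2 / h := (contDiff_apply ℝ ℝ 2).div_const h
  exact ((contDiff_apply ℝ ℝ 0).mul (Real.contDiff_sin.comp h2)).sub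
    ((contDiff_apply ℝ ℝ 1).mul (Real.contDiff_cos.comp h2))

theorem hasDerivAt_helicoidEquation (h : ℝ) {z : ℝ → Fin 3 → ℝ} {v : Fin 3 → ℝ} {t : ℝ}
    (hz : HasDerivAt z v t) :
    HasDerivAt (fun t => helicoidEquation h (z t)) (helicoidGradient h (z t) ⬝ᵥ v) t := by
  have hc := hasDerivAt_pi.1 hz
  have h2 := (hc 2).div_const h
  refine (((hc 0).mul h2.sin).sub ((hc 1).mul h2.cos)).congr_deriv ?_
  rw [dot3]
  simp only [helicoidGradient, cons_val_zero, cons_val_one, cons_val]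
  ring

/-- A surface that lies in a helicoid has its tangent planes orthogonal to the gradient of the
equation of the helicoid. -/
theorem helicoidGradient_dotProduct_eq_zero {h : ℝ} {Y : (Fin 2 → ℝ) → Fin 3 → ℝ}
    (hY : ContDiff ℝ ω Y) (S : Matrix (Fin 3) (Fin 3) ℝ) (b : Fin 3 → ℝ)
    (h0 : ∀ σ, helicoidEquation h (S *ᵥ (Y σ - b)) = 0) (σ k : Fin 2 → ℝ) :
    helicoidGradient h (S *ᵥ (Y σ - b)) ⬝ᵥ (S *ᵥ fderiv ℝ Y σ k) = 0 := by
  have hl : HasDerivAt (fun t : ℝ => σ + t • k) k 0 := by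
    simpa using ((hasDerivAt_id (0 : ℝ)).smul_const k).const_add σ
  have hY' : HasFDerivAt Y (fderiv ℝ Y σ) (σ + (0 : ℝ) • k) := by
    rw [line_zero]
    exact (hY.differentiable (by simp) σ).hasFDerivAt
  have h1 := (hY'.comp_hasDerivAt (0 : ℝ) hl).sub_const b
  have h2 := ((S.mulVecLin.toContinuousLinearMap).hasFDerivAt.comp_hasDerivAt (0 : ℝ) h1)
  have h3 := hasDerivAt_helicoidEquation h h2
  have h4 : HasDerivAt (fun _ : ℝ => (0 : ℝ)) 0 0 := hasDerivAt_const _ _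
  have h5 := h3.unique (h4.congr_of_eventuallyEq (Filter.Eventually.of_forall fun t => h0 _))
  simpa using h5

section Scherk

variable {c l : ℝ}

theorem not_plane_scherk (hc : 0 < c) (hl : |l| < 1) {W : Set (Fin 2 → ℝ)} (hW : IsOpen W)
    (hne : W.Nonempty) {N : Fin 3 → ℝ} (hN : N ≠ 0) {d : ℝ}
    (h : ∀ σ ∈ W, N ⬝ᵥ scherk c l σ = d) : False := by
  have hq : 0 < √(1 - l ^ 2) := Real.sqrt_pos.2 (by nlinarith [abs_lt.1 hl])
  have hall : ∀ σ, N ⬝ᵥ scherk c l σ - d = 0 := by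
    have hs := contDiff_pi.1 (contDiff_scherk c l (m := ω))
    refine eq_zero_of_contDiff_omega ?_ hW hne fun σ hσ => sub_eq_zero.2 (h σ hσ)
    simp only [dot3]
    exact ((((hs 0).const_smul (N 0)).add ((hs 1).const_smul (N 1))).add
      ((hs 2).const_smul (N 2))).sub contDiff_const
  -- By analyticity the plane contains the whole surface. Turning φ by 2π changes only the third
  -- coordinate, giving N_2 l = 0; half and quarter turns then kill N_0, d and N_1, and a step in ρ
  -- kills N_2.
  have e0 := hall ![0, 0]
  have e1 := hall ![0, Real.pi]
  have e2 := hall ![0, 2 * Real.pi]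
  have e3 := hall ![0, Real.pi / 2]
  have e4 := hall ![1, 0]
  simp only [dot3] at e0 e1 e2 e3 e4
  simp [scherk] at e0 e1 e2 e3 e4
  have hqc : √(1 - l ^ 2) * c ≠ 0 := (mul_pos hq hc).ne'
  have h2 : N 2 * l = 0 := by
    have : N 2 * l * (c * (2 * Real.pi)) = 0 := by linarith
    exact (mul_eq_zero.1 this).resolve_right (by positivity)
  have h0 : N 0 = 0 := by
    have : N 0 * (√(1 - l ^ 2) * c) = 0 := by linear_combination (e0 - e1 + h2 * c * Real.pi) / 2
    exact (mul_eq_zero.1 this).resolve_right hqc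
  have hd : d = 0 := by rw [h0] at e0; linarith
  have h1 : N 1 = 0 := by
    have : N 1 * (√(1 - l ^ 2) * c) = 0 := by
      rw [hd] at e3
      linear_combination e3 - h2 * c * Real.pi / 2
    exact (mul_eq_zero.1 this).resolve_right hqc
  have h3 : N 2 = 0 := by
    simp only [h0, h1, hd] at e4
    have : N 2 * √(1 - l ^ 2) = 0 := by linarith
    exact (mul_eq_zero.1 this).resolve_right hq.ne'
  exact hN (by ext i; fin_cases i <;> assumption)

/-- If Scherk's surface lies in a helicoid, then the radial direction at the points of the central
curve `ρ = 0` is orthogonal to the vector from the axis of the helicoid. -/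
theorem scherk_helicoid_radial (hc : 0 < c) (hl : |l| < 1) {W : Set (Fin 2 → ℝ)} (hW : IsOpen W)
    (hne : W.Nonempty) {R : Matrix (Fin 3) (Fin 3) ℝ} (hR : R ∈ orthogonalGroup (Fin 3) ℝ)
    {b : Fin 3 → ℝ} {h : ℝ} (hh : h ≠ 0)
    (hS : scherk c l '' W ⊆ Set.range fun σ => b + R *ᵥ helicoid h σ) (φ : ℝ) :
    ∀ n : Fin 3 → ℝ, n = ![Real.cos φ, Real.sin φ, 0] →
      n ⬝ᵥ (scherk c l ![0, φ] - b) -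
        (Rᵀ *ᵥ (scherk c l ![0, φ] - b)) 2 * (Rᵀ *ᵥ n) 2 = 0 := by
  rintro n rfl
  have hRR : Rᵀ * R = 1 := (mem_orthogonalGroup_iff' (Fin 3) ℝ).1 hR
  have hRR' : R * Rᵀ = 1 := (mem_orthogonalGroup_iff (Fin 3) ℝ).1 hR
  have hq : √(1 - l ^ 2) ^ 2 = 1 - l ^ 2 := sq_sqrt_one_sub hl
  have hY := contDiff_scherk c l (m := ω)
  have hall : ∀ σ, helicoidEquation h (Rᵀ *ᵥ (scherk c l σ - b)) = 0 := by
    refine eq_zero_of_contDiff_omega ?_ hW hne fun σ hσ => ?_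
    · exact (contDiff_helicoidEquation h).comp
        ((Rᵀ.mulVecLin.toContinuousLinearMap).contDiff.comp (hY.sub contDiff_const))
    · obtain ⟨τ, hτ⟩ := hS ⟨σ, hσ, rfl⟩
      rw [← hτ]
      simp [mulVec_mulVec, hRR, helicoidEquation_helicoid hh]
  have hg := helicoidGradient_dotProduct_eq_zero hY Rᵀ b hall ![0, φ]
  have h0 := hall ![0, φ]
  set Z := Rᵀ *ᵥ (scherk c l ![0, φ] - b) with hZ
  set m := R *ᵥ helicoidGradient h Z with hm
  have hmv : ∀ v, helicoidGradient h Z ⬝ᵥ (Rᵀ *ᵥ v) = m ⬝ᵥ v := fun v => by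
    rw [dotProduct_mulVec, vecMul_transpose]
  have hg0 := hg ![1, 0]
  have hg1 := hg ![0, 1]
  rw [hmv, fderiv_scherk hc.ne', dot3] at hg0 hg1
  simp at hg0 hg1
  have hcs := Real.sin_sq_add_cos_sq φ
  -- On the curve ρ = 0 the tangent plane is spanned by (sin φ, −cos φ, 0) and the vertical, for
  -- every l, so the gradient of the helicoid is radial there.
  have hT : m 0 * Real.sin φ - m 1 * Real.cos φ = 0 := by
    have hc' := hc.ne'
    have : c * (m 0 * Real.sin φ - m 1 * Real.cos φ) = 0 := by
      linear_combination c * l * hg0 - √(1 - l ^ 2) * hg1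
        - c * (m 0 * Real.sin φ - m 1 * Real.cos φ) * hq
    exact (mul_eq_zero.1 this).resolve_left hc'
  have hm2 : m 2 = 0 := by
    have : c * m 2 = 0 := by
      linear_combination c * √(1 - l ^ 2) * hg0 + l * hg1 - c * m 2 * hq
    exact (mul_eq_zero.1 this).resolve_left hc.ne'
  have hmn : m = (m 0 * Real.cos φ + m 1 * Real.sin φ) • ![Real.cos φ, Real.sin φ, 0] := by
    ext i
    fin_cases i
    · simp
      linear_combination -m 0 * hcs + Real.sin φ * hT
    · simp
      linear_combination -m 1 * hcs - Real.cos φ * hT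
    · simpa using hm2
  have ha : m 0 * Real.cos φ + m 1 * Real.sin φ ≠ 0 := by
    intro ha
    rw [ha, zero_smul] at hmn
    have : helicoidGradient h Z = 0 := by
      have h1 : Rᵀ *ᵥ m = helicoidGradient h Z := by rw [hm, mulVec_mulVec, hRR, one_mulVec]
      rw [← h1, hmn, mulVec_zero]
    have s0 := congrFun this 0
    have s1 := congrFun this 1
    simp [helicoidGradient] at s0 s1
    have := Real.sin_sq_add_cos_sq (Z 2 / h)
    rw [s0, s1] at this
    norm_num at this
  -- The first two components of the gradient, paired with those of Z, reproduce the equation of the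
  -- helicoid, which is zero.
  have hfin : m ⬝ᵥ (scherk c l ![0, φ] - b) - Z 2 * (Rᵀ *ᵥ m) 2 = 0 := by
    have h1 : Rᵀ *ᵥ m = helicoidGradient h Z := by rw [hm, mulVec_mulVec, hRR, one_mulVec]
    rw [← hmv, h1, ← hZ, dot3]
    simp only [helicoidEquation] at h0
    simp only [helicoidGradient, cons_val_zero, cons_val_one, cons_val]
    linear_combination h0
  rw [hmn, mulVec_smul, smul_dotProduct, Pi.smul_apply, smul_eq_mul, smul_eq_mul] at hfin
  refine (mul_eq_zero.1 (?_ : (m 0 * Real.cos φ + m 1 * Real.sin φ) * _ = 0)).resolve_left ha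
  linear_combination hfin

theorem not_helicoid_scherk (hc : 0 < c) (hl : |l| < 1) {W : Set (Fin 2 → ℝ)} (hW : IsOpen W)
    (hne : W.Nonempty) {R : Matrix (Fin 3) (Fin 3) ℝ} (hR : R ∈ orthogonalGroup (Fin 3) ℝ)
    {b : Fin 3 → ℝ} {h : ℝ} (hh : h ≠ 0)
    (hS : scherk c l '' W ⊆ Set.range fun σ => b + R *ᵥ helicoid h σ) : False := by
  have key := fun φ => scherk_helicoid_radial hc hl hW hne hR hh hS φ _ rfl
  have hqc : 0 < √(1 - l ^ 2) * c :=
    mul_pos (Real.sqrt_pos.2 (by nlinarith [abs_lt.1 hl])) hc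
  have hRR : Rᵀ * R = 1 := (mem_orthogonalGroup_iff' (Fin 3) ℝ).1 hR
  have hee : R 0 2 ^ 2 + R 1 2 ^ 2 + R 2 2 ^ 2 = 1 := by
    have := congrFun (congrFun hRR 2) 2
    simp [mul_apply, Fin.sum_univ_three] at this
    linear_combination this
  have hs3 : Real.sin (3 * Real.pi / 2) = -1 := by
    rw [show 3 * Real.pi / 2 = Real.pi / 2 + Real.pi by ring, Real.sin_add_pi, Real.sin_pi_div_two]
  have hc3 : Real.cos (3 * Real.pi / 2) = 0 := by
    rw [show 3 * Real.pi / 2 = Real.pi / 2 + Real.pi by ring, Real.cos_add_pi, Real.cos_pi_div_two,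
      neg_zero]
  have hs5 : Real.sin (5 * Real.pi / 2) = 1 := by
    rw [show 5 * Real.pi / 2 = Real.pi / 2 + 2 * Real.pi by ring, Real.sin_add_two_pi,
      Real.sin_pi_div_two]
  have hc5 : Real.cos (5 * Real.pi / 2) = 0 := by
    rw [show 5 * Real.pi / 2 = Real.pi / 2 + 2 * Real.pi by ring, Real.cos_add_two_pi,
      Real.cos_pi_div_two]
  have e0 := key 0
  have e1 := key Real.pi
  have e2 := key (2 * Real.pi)
  have e3 := key (Real.pi / 2)
  have e4 := key (3 * Real.pi / 2)
  have e5 := key (5 * Real.pi / 2)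
  simp only [mulVec, dot3] at e0 e1 e2 e3 e4 e5
  simp [scherk, hs3, hc3, hs5, hc5] at e0 e1 e2 e3 e4 e5
  -- Weights 1, 2, 1 at φ = 0, π, 2π cancel the terms in b and the linear growth in φ, leaving √(1 −
  -- l²) c (1 − e_0²) for the axis direction e, the last column of R. The points shifted by π/2 give
  -- e_1² = 1 as well, too much for a unit vector.
  have hx : R 0 2 ^ 2 = 1 := by
    have : √(1 - l ^ 2) * c * (R 0 2 ^ 2 - 1) = 0 := by
      linear_combination -(2 * e1 + e0 + e2) / 4
    have := (mul_eq_zero.1 this).resolve_left hqc.ne'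
    linarith
  have hy : R 1 2 ^ 2 = 1 := by
    have : √(1 - l ^ 2) * c * (R 1 2 ^ 2 - 1) = 0 := by
      linear_combination -(2 * e4 + e3 + e5) / 4
    have := (mul_eq_zero.1 this).resolve_left hqc.ne'
    linarith
  nlinarith [sq_nonneg (R 2 2)]

theorem not_extrinsicEquation_scherk {n : ℕ} (hn : 1 ≤ n) {A : Fin 3 ⊕ Fin n → ℝ} (hc : 0 < c)
    (hl : |l| < 1) {V : (Fin 3 ⊕ Fin n → ℝ) → Fin 3 ⊕ Fin n → ℝ} {W : Set (Fin 2 → ℝ)}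
    (h : IsStationaryTypeI A V (scherk c l) W) (hne : IsNontrivial A V (scherk c l) W) :
    ¬ ExtrinsicEquation A V (scherk c l) W := by
  intro hE
  rcases liesInPlane_or_liesInHelicoid hn h hne hE with
    ⟨N, d, -, hN, hd, -⟩ | ⟨R, hR, b, a, ha, hS, -⟩
  · exact not_plane_scherk hc hl h.isOpen h.isConnected.nonempty hN
      fun σ hσ => hd _ ⟨σ, hσ, rfl⟩
  · exact not_helicoid_scherk hc hl h.isOpen h.isConnected.nonempty hR ha hS

end Scherk

end Blackfold

end

theorem mainTheorem3 (n : ℕ) (hn : 1 ≤ n) (A : Fin 3 ⊕ Fin n → ℝ) (hA : ∑ q, A q = 0) :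
    (∀ (M : Type*) [TopologicalSpace M] [ChartedSpace (Fin 2 → ℝ) M]
        [IsManifold 𝓘(ℝ, Fin 2 → ℝ) ∞ M]
        (V : (Fin 3 ⊕ Fin n → ℝ) → Fin 3 ⊕ Fin n → ℝ) (X : M → Fin 3 → ℝ) (W : Set M),
        Blackfold.IsStationaryTypeI A V X W → Blackfold.IsNontrivial A V X W →
        Blackfold.ExtrinsicEquation A V X W →
          Blackfold.LiesInPlane (fun i => A (Sum.inl i)) (X '' W) ∨
          Blackfold.LiesInHelicoid (fun i => A (Sum.inl i)) (X '' W)) ∧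
    (∀ Ω : ℝ, (Ω = 0 ∨ A (Sum.inl 0) = A (Sum.inl 1)) →
      ∀ p, 0 < Blackfold.modulusSq A (Blackfold.screwField n Ω 0) (Blackfold.plane p) →
        Blackfold.IsStationaryTypeI A (Blackfold.screwField n Ω 0) Blackfold.plane
          (Blackfold.timelikeComponent A (Blackfold.screwField n Ω 0) Blackfold.plane p) ∧
        Blackfold.BlackfoldEquations A (Blackfold.screwField n Ω 0) Blackfold.plane
          (Blackfold.timelikeComponent A (Blackfold.screwField n Ω 0) Blackfold.plane p)) ∧
    (∀ h : ℝ, h ≠ 0 → A (Sum.inl 0) = A (Sum.inl 1) → A (Sum.inl 2) = 0 →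
      ∀ Ω p, 0 < Blackfold.modulusSq A (Blackfold.screwField n Ω h) (Blackfold.helicoid h p) →
        Blackfold.IsStationaryTypeI A (Blackfold.screwField n Ω h) (Blackfold.helicoid h)
          (Blackfold.timelikeComponent A (Blackfold.screwField n Ω h) (Blackfold.helicoid h) p) ∧
        Blackfold.BlackfoldEquations A (Blackfold.screwField n Ω h) (Blackfold.helicoid h)
          (Blackfold.timelikeComponent A (Blackfold.screwField n Ω h) (Blackfold.helicoid h) p)) ∧
    (∀ c l : ℝ, 0 < c → |l| < 1 →
      (∀ Ω : ℝ, (Ω = 0 ∨ A (Sum.inl 0) = A (Sum.inl 1) ∧ (l = 0 ∨ A (Sum.inl 2) = 0)) →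
        ∀ p, 0 < Blackfold.modulusSq A (Blackfold.screwField n Ω (l * c))
            (Blackfold.scherk c l p) →
          Blackfold.IsStationaryTypeI A (Blackfold.screwField n Ω (l * c)) (Blackfold.scherk c l)
            (Blackfold.timelikeComponent A (Blackfold.screwField n Ω (l * c))
              (Blackfold.scherk c l) p)) ∧
      (∀ (V : (Fin 3 ⊕ Fin n → ℝ) → Fin 3 ⊕ Fin n → ℝ) (W : Set (Fin 2 → ℝ)),
        Blackfold.IsStationaryTypeI A V (Blackfold.scherk c l) W →
        Blackfold.IsNontrivial A V (Blackfold.scherk c l) W →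
        ¬ Blackfold.ExtrinsicEquation A V (Blackfold.scherk c l) W)) :=
  ⟨fun _ _ _ _ _ _ _ h hne hE => Blackfold.liesInPlane_or_liesInHelicoid hn h hne hE,
    fun _ hΩ _ hp => Blackfold.plane_solution hΩ hp,
    fun _ hh h01 h2 Ω _ hp => Blackfold.helicoid_solution hh h01 h2 Ω hp,
    fun _ _ hc hl => ⟨fun _ hΩ _ hp => Blackfold.isStationaryTypeI_scherk hc.ne' hl hΩ hp,
      fun _ _ h hne => Blackfold.not_extrinsicEquation_scherk hn hc hl h hne⟩⟩
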